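/- Let $(V,\omega)$ be a closed (compact, without boundary, Hausdorff, smooth) symplectic manifold of dimension $2n$, and let $\mathrm{Symp}(V,\omega)$ be its group of symplectomorphisms. By a loop in $\mathrm{Symp}(V,\omega)$ we mean a smooth family $\varphi=(\varphi_t)_{t\in\mathbb{R}}$ of symplectomorphisms of $(V,\omega)$ with $\varphi_{t+1}=\varphi_t$; its orbits are the loops $t\mapsto\varphi_t(x)$, $0\le t\le 1$, $x\in V$. The flux $\Phi(\varphi)\in H^1(V;\mathbb{R})$ of such a loop is the (de Rham) cohomology class whose value on every smooth loop $\gamma$ in $V$ is the symplectic area of the cylinder swept by $\gamma$ under $\varphi$, $$\langle\Phi(\varphi),[\gamma]\rangle=\int_0^1\!\!\int_0^1\omega\bigl(\partial_t\,\varphi_t(\gamma(s)),\,\partial_s\,\varphi_t(\gamma(s))\bigr)\,ds\,dt .$$ (1) Suppose that $\omega|_{\pi_2(V)}=0$, i.e. $\int_{[0,1]^2}u^*\omega=0$ for every smooth map $u$ from the square to $V$ that is constant on the boundary of the square. Then every loop $\varphi$ in $\mathrm{Symp}(V,\omega)$ all of whose orbits are contractible in $V$ has zero flux: $\Phi(\varphi)=0$.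 (2) Suppose that $V$ is Lefschetz, i.e. multiplication by $[\omega]^{n-1}$ is an isomorphism $H^1(V;\mathbb{R})\to H^{2n-1}(V;\mathbb{R})$ (for $n\geq 1$). Then every loop $\varphi$ in $\mathrm{Symp}(V,\omega)$ all of whose orbits are homologous to zero over $\mathbb{R}$ (i.e. represent $0$ in the singular homology $H_1(V;\mathbb{R})$) has zero flux: $\Phi(\varphi)=0$. No condition on $c_1(TV)$ is needed; in particular both statements hold whenever $c_1(TV)=0$. -/

import Mathlib

open scoped Manifold ContDiff

noncomputable section

namespace SymplecticFlux

universe u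

section Forms

variable (m : ℕ) (M : Type u) [TopologicalSpace M] [ChartedSpace (EuclideanSpace ℝ (Fin m)) M]

/-- A (not necessarily smooth) differential `k`-form on the boundaryless `m`-manifold `M`:
an alternating `k`-linear form on each tangent space. -/
def Form (k : ℕ) : Type u :=
  (x : M) → (TangentSpace (𝓡 m) x) [⋀^Fin k]→L[ℝ] ℝ

instance (k : ℕ) : AddCommGroup (Form m M k) :=
  inferInstanceAs (AddCommGroup ((x : M) → (TangentSpace (𝓡 m) x) [⋀^Fin k]→L[ℝ] ℝ))

instance (k : ℕ) : Module ℝ (Form m M k) :=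
  inferInstanceAs (Module ℝ ((x : M) → (TangentSpace (𝓡 m) x) [⋀^Fin k]→L[ℝ] ℝ))

variable {m M} {k : ℕ}

/-- The expression of a form in the preferred chart around `x₀`: its pull-back under the inverse
chart, as a form on (the target of the chart in) Euclidean space. -/
def Form.inChart (α : Form m M k) (x₀ : M) (y : EuclideanSpace ℝ (Fin m)) :
    (EuclideanSpace ℝ (Fin m)) [⋀^Fin k]→L[ℝ] ℝ :=
  (α ((extChartAt (𝓡 m) x₀).symm y)).compContinuousLinearMap
    (mfderiv (𝓡 m) (𝓡 m) (extChartAt (𝓡 m) x₀).symm y)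

/-- A form is smooth if its expression in every preferred chart is smooth. -/
def Form.IsSmooth (α : Form m M k) : Prop :=
  ∀ x₀ : M, ContDiffOn ℝ ∞ (α.inChart x₀) (extChartAt (𝓡 m) x₀).target

/-- `IsExtDeriv α β` says that `dα = β`, the exterior derivative being computed in charts. -/
def Form.IsExtDeriv (α : Form m M k) (β : Form m M (k + 1)) : Prop :=
  ∀ x₀ : M, ∀ y ∈ (extChartAt (𝓡 m) x₀).target, extDeriv (α.inChart x₀) y = β.inChart x₀ y

/-- A smooth form with vanishing exterior derivative. -/
def Form.IsClosed (α : Form m M k) : Prop :=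
  α.IsSmooth ∧ α.IsExtDeriv 0

/-- Pull-back of a form under a map `f : M → M`. -/
def Form.pullback (f : M → M) (α : Form m M k) : Form m M k :=
  fun x => (α (f x)).compContinuousLinearMap (mfderiv (𝓡 m) (𝓡 m) f x)

lemma Form.inChart_add (α β : Form m M k) (x₀ : M) :
    (α + β).inChart x₀ = α.inChart x₀ + β.inChart x₀ := by
  ext y v; rfl

lemma Form.inChart_smul (c : ℝ) (α : Form m M k) (x₀ : M) :
    (c • α).inChart x₀ = c • α.inChart x₀ := by
  ext y v; rfl

lemma Form.inChart_zero (x₀ : M) : (0 : Form m M k).inChart x₀ = 0 := by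
  ext y v; rfl

lemma Form.isSmooth_zero : (0 : Form m M k).IsSmooth := fun x₀ => by
  rw [Form.inChart_zero]; exact contDiffOn_const

lemma Form.IsSmooth.add {α β : Form m M k} (hα : α.IsSmooth) (hβ : β.IsSmooth) :
    (α + β).IsSmooth := fun x₀ => by
  rw [Form.inChart_add]; exact (hα x₀).add (hβ x₀)

lemma Form.IsSmooth.smul {α : Form m M k} (c : ℝ) (hα : α.IsSmooth) :
    (c • α).IsSmooth := fun x₀ => by
  rw [Form.inChart_smul]; exact (hα x₀).const_smul c

lemma Form.IsSmooth.differentiableAt {α : Form m M k} (hα : α.IsSmooth) (x₀ : M)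
    {y : EuclideanSpace ℝ (Fin m)} (hy : y ∈ (extChartAt (𝓡 m) x₀).target) :
    DifferentiableAt ℝ (α.inChart x₀) y :=
  ((hα x₀).differentiableOn (by simp)).differentiableAt
    ((isOpen_extChartAt_target x₀).mem_nhds hy)

lemma Form.isExtDeriv_zero : (0 : Form m M k).IsExtDeriv 0 := fun x₀ y _ => by
  rw [Form.inChart_zero, Form.inChart_zero]
  have h := extDeriv_smul (x := y) (0 : ℝ)
    (0 : EuclideanSpace ℝ (Fin m) → (EuclideanSpace ℝ (Fin m)) [⋀^Fin k]→L[ℝ] ℝ)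
  simpa using h

lemma Form.IsExtDeriv.add {α α' : Form m M k} {β β' : Form m M (k + 1)}
    (hα : α.IsSmooth) (hα' : α'.IsSmooth) (h : α.IsExtDeriv β) (h' : α'.IsExtDeriv β') :
    (α + α').IsExtDeriv (β + β') := fun x₀ y hy => by
  rw [Form.inChart_add, Form.inChart_add,
    extDeriv_add (hα.differentiableAt x₀ hy) (hα'.differentiableAt x₀ hy), h x₀ y hy, h' x₀ y hy]
  rfl

lemma Form.IsExtDeriv.smul {α : Form m M k} {β : Form m M (k + 1)} (c : ℝ)
    (h : α.IsExtDeriv β) : (c • α).IsExtDeriv (c • β) := fun x₀ y hy => by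
  rw [Form.inChart_smul, Form.inChart_smul, extDeriv_smul, h x₀ y hy]
  rfl

variable (m M)

/-- The space of closed smooth `k`-forms. -/
def closedForms (k : ℕ) : Submodule ℝ (Form m M k) where
  carrier := {α | α.IsClosed}
  zero_mem' := ⟨Form.isSmooth_zero, Form.isExtDeriv_zero⟩
  add_mem' {α β} hα hβ :=
    ⟨hα.1.add hβ.1, by simpa using Form.IsExtDeriv.add hα.1 hβ.1 hα.2 hβ.2⟩
  smul_mem' c α hα := ⟨hα.1.smul c, by simpa using Form.IsExtDeriv.smul c hα.2⟩

/-- The space of exact `k`-forms, i.e. exterior derivatives of smooth `(k-1)`-forms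
(zero if `k = 0`). -/
def exactForms : (k : ℕ) → Submodule ℝ (Form m M k)
  | 0 => ⊥
  | k + 1 =>
    { carrier := {β | ∃ α : Form m M k, α.IsSmooth ∧ α.IsExtDeriv β}
      zero_mem' := ⟨0, Form.isSmooth_zero, Form.isExtDeriv_zero⟩
      add_mem' := fun ⟨α, hα, h⟩ ⟨α', hα', h'⟩ => ⟨α + α', hα.add hα', h.add hα hα' h'⟩
      smul_mem' := fun c _ ⟨α, hα, h⟩ => ⟨c • α, hα.smul c, h.smul c⟩ }

/-- The real (de Rham) cohomology `H^k(M; ℝ)`. -/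
abbrev DeRham (k : ℕ) : Type u :=
  closedForms m M k ⧸ (exactForms m M k).comap (closedForms m M k).subtype

variable {m M}

/-- The de Rham class of a closed form. -/
def deRhamClass (α : closedForms m M k) : DeRham m M k :=
  Submodule.Quotient.mk α

end Forms

section Wedge

variable {E : Type*} [AddCommGroup E] [Module ℝ E] [TopologicalSpace E]

/-- The wedge product of two alternating forms on a vector space (sum over shuffles). -/
def wedge {k l : ℕ} (a : E [⋀^Fin k]→L[ℝ] ℝ) (b : E [⋀^Fin l]→L[ℝ] ℝ) :
    E [⋀^Fin (k + l)]→L[ℝ] ℝ :=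
  { ((LinearMap.mul' ℝ ℝ).compAlternatingMap
      (a.toAlternatingMap.domCoprod b.toAlternatingMap)).domDomCongr finSumFinEquiv with
    cont := by
      change Continuous fun v : Fin (k + l) → E => LinearMap.mul' ℝ ℝ
        ((a.toAlternatingMap.domCoprod b.toAlternatingMap) fun i => v (finSumFinEquiv i))
      simp only [AlternatingMap.domCoprod_apply, _root_.sum_apply, map_sum]
      refine continuous_finsetSum _ fun σ _ => ?_
      induction σ using Quotient.inductionOn' with | _ σ
      have : ∀ v : Fin (k + l) → E, LinearMap.mul' ℝ ℝ
          (AlternatingMap.domCoprod.summand a.toAlternatingMap b.toAlternatingMap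
            (Quotient.mk'' σ) fun i => v (finSumFinEquiv i)) =
          Equiv.Perm.sign σ • (a (fun i => v (finSumFinEquiv (σ (Sum.inl i)))) *
            b (fun i => v (finSumFinEquiv (σ (Sum.inr i))))) := by
        intro v
        rw [AlternatingMap.domCoprod.summand_mk'']
        rcases Int.units_eq_one_or (Equiv.Perm.sign σ) with h | h <;> rw [h]
        · simp only [one_smul]; rfl
        · simp only [Units.neg_smul, one_smul]
          exact map_neg (LinearMap.mul' ℝ ℝ) (((a.toMultilinearMap.domCoprod
            b.toMultilinearMap).domDomCongr σ) fun i => v (finSumFinEquiv i))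
      simp only [this]
      refine Continuous.const_smul (Continuous.mul ?_ ?_) _
      · exact a.cont.comp (continuous_pi fun i => continuous_apply _)
      · exact b.cont.comp (continuous_pi fun i => continuous_apply _) }

/-- The `j`-fold wedge power of a `2`-form. -/
def wedgePow (a : E [⋀^Fin 2]→L[ℝ] ℝ) : (j : ℕ) → E [⋀^Fin (2 * j)]→L[ℝ] ℝ
  | 0 => ContinuousAlternatingMap.constOfIsEmpty ℝ E (Fin 0) 1
  | j + 1 => wedge (wedgePow a j) a

end Wedge

section Symplectic

variable {m : ℕ} {M : Type u} [TopologicalSpace M] [ChartedSpace (EuclideanSpace ℝ (Fin m)) M]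

/-- A symplectic form: a smooth closed nondegenerate `2`-form. -/
structure IsSymplectic (Ω : Form m M 2) : Prop where
  closed : Ω.IsClosed
  nondegenerate : ∀ (x : M) (v : TangentSpace (𝓡 m) x), (∀ w, Ω x ![v, w] = 0) → v = 0

/-- The group `Symp(M, Ω)` of symplectomorphisms, as a set of diffeomorphisms. -/
def Symp (Ω : Form m M 2) : Set (Diffeomorph (𝓡 m) (𝓡 m) M M ∞) :=
  {f | Form.pullback f Ω = Ω}

/-- A (smooth, `1`-periodic) loop `t ↦ φ t` in `Symp(M, Ω)`. -/
structure IsSympLoop (Ω : Form m M 2) (φ : ℝ → Diffeomorph (𝓡 m) (𝓡 m) M M ∞) : Prop where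
  mem : ∀ t, φ t ∈ Symp Ω
  periodic : ∀ t, φ (t + 1) = φ t
  smooth : ContMDiff (𝓘(ℝ, ℝ).prod (𝓡 m)) (𝓡 m) ∞ fun p : ℝ × M => φ p.1 p.2

/-- A smooth loop in `M`, as a `1`-periodic map from `ℝ`. -/
structure IsSmoothLoop (γ : ℝ → M) : Prop where
  periodic : ∀ s, γ (s + 1) = γ s
  smooth : ContMDiff 𝓘(ℝ, ℝ) (𝓡 m) ∞ γ

/-- The symplectic area `∫ u^*Ω` of a smooth map `u`, over the square `[0,1] × [0,1]`. -/
def area (Ω : Form m M 2) (u : ℝ × ℝ → M) : ℝ :=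
  ∫ t in (0 : ℝ)..1, ∫ s in (0 : ℝ)..1,
    Ω (u (t, s)) ![mfderiv 𝓘(ℝ, ℝ × ℝ) (𝓡 m) u (t, s) ((1, 0) : ℝ × ℝ),
      mfderiv 𝓘(ℝ, ℝ × ℝ) (𝓡 m) u (t, s) ((0, 1) : ℝ × ℝ)]

/-- The integral of a `1`-form along the loop `γ`, over one period. -/
def loopIntegral (α : Form m M 1) (γ : ℝ → M) : ℝ :=
  ∫ s in (0 : ℝ)..1, α (γ s) ![mfderiv 𝓘(ℝ, ℝ) (𝓡 m) γ s (1 : ℝ)]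

/-- `IsFlux Ω φ c` says that the class `c ∈ H¹(M; ℝ)` is the flux of the loop `φ`: its value on
every smooth loop `γ` is the symplectic area of the cylinder `(t, s) ↦ φ_t(γ(s))` swept by `γ`. -/
def IsFlux (Ω : Form m M 2) (φ : ℝ → Diffeomorph (𝓡 m) (𝓡 m) M M ∞) (c : DeRham m M 1) : Prop :=
  ∃ α : closedForms m M 1, deRhamClass α = c ∧
    ∀ γ : ℝ → M, IsSmoothLoop (m := m) γ →
      loopIntegral (α : Form m M 1) γ = area Ω fun z => φ z.1 (γ z.2)

/-- `Ω` vanishes on `π₂(M)`: it integrates to zero over every smooth map of the square to `M`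
which sends the whole boundary of the square to one point `p`. Such maps represent all elements of
`π₂(M, p)`. -/
def VanishesOnPiTwo (Ω : Form m M 2) : Prop :=
  ∀ (p : M) (u : ℝ × ℝ → M), ContMDiff 𝓘(ℝ, ℝ × ℝ) (𝓡 m) ∞ u →
    (∀ s ∈ Set.Icc (0 : ℝ) 1, u (0, s) = p ∧ u (1, s) = p ∧ u (s, 0) = p ∧ u (s, 1) = p) →
    area Ω u = 0

/-- The Lefschetz condition on `(M, Ω)`, where `M` has dimension `2 n`: the map
`H¹(M; ℝ) → H^{2n-1}(M; ℝ)`, `[α] ↦ [Ω^{n-1} ∧ α]`, is an isomorphism. The degree `2n-1` is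
written `2(n-1)+1`. -/
def IsLefschetz (n : ℕ) (Ω : Form m M 2) : Prop :=
  ∃ L : DeRham m M 1 ≃ₗ[ℝ] DeRham m M (2 * (n - 1) + 1),
    ∀ α : closedForms m M 1, ∃ β : closedForms m M (2 * (n - 1) + 1),
      (∀ x, (β : Form m M (2 * (n - 1) + 1)) x =
        wedge (wedgePow (Ω x) (n - 1)) ((α : Form m M 1) x)) ∧
      L (deRhamClass α) = deRhamClass β

/-- The orbit `t ↦ φ_t(x)`, `0 ≤ t ≤ 1`, of a point under a loop of symplectomorphisms. -/
def orbit {Ω : Form m M 2} {φ : ℝ → Diffeomorph (𝓡 m) (𝓡 m) M M ∞} (hφ : IsSympLoop Ω φ)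
    (x : M) : Path (φ 0 x) (φ 0 x) where
  toFun t := φ t x
  continuous_toFun := hφ.smooth.continuous.comp
    (continuous_subtype_val.prodMk continuous_const)
  source' := by simp
  target' := by simpa using congrArg (fun f => f x) (hφ.periodic 0)

end Symplectic

section Homology

open CategoryTheory Simplicial

/-- A loop in a space `X`, as a singular `1`-simplex. -/
def loopSimplex {X : Type u} [TopologicalSpace X] {x : X} (c : Path x x) :
    (TopCat.toSSet.obj (TopCat.of X)) _⦋1⦌ :=
  (TopCat.toSSetObjEquiv (TopCat.of X) (Opposite.op ⦋1⦌)).symm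
    (c.toContinuousMap.comp
      ⟨stdSimplexHomeomorphUnitInterval, stdSimplexHomeomorphUnitInterval.continuous⟩)

/-- The loop `c` is homologous to zero over `ℝ`: as a cycle in the singular chain complex of `X`
with real coefficients, it is a boundary. -/
def IsNullHomologous {X : Type u} [TopologicalSpace X] {x : X} (c : Path x x) : Prop :=
  let S := (TopCat.toSSet.obj (TopCat.of X)).chainComplex (ModuleCat.of ℝ (ULift.{u} ℝ))
  ∃ b : S.X 2,
    S.d 2 1 b =
      (TopCat.toSSet.obj (TopCat.of X)).ιChainComplex
        (R := ModuleCat.of ℝ (ULift.{u} ℝ)) (loopSimplex c) (ULift.up 1)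

end Homology

end SymplecticFlux

end

noncomputable section

namespace SymplecticFlux

universe u

set_option linter.unusedSectionVars false

/-! Both statements reduce to one assertion: for every smooth loop γ the torus (t, s) ↦ φ_t(γ(s))
has zero symplectic area. The zero form then represents the flux.

Contractible orbits. The meridian t ↦ φ_t(γ(0)) is an orbit, so it bounds a disc. Cut the torus
along it and glue in two oppositely oriented copies of the disc: the result is a sphere with the
area of the torus, since the discs cancel, and `VanishesOnPiTwo` makes this area zero. What takes
work is smoothness. The contraction is smoothed without changing it on the boundary of the square
(`exists_smooth_contraction`), and the pieces are joined through parametrizations that are locally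
constant near the seams (`VanishesOnPiTwo.area_torus_eq_zero`, `VanishesOnPiTwo.area_eq_zero`).

Lefschetz case. Let X_t be the velocity field of φ. As the φ_t preserve Ω, each ι_{X_t}Ω is closed,
and the area is the integral over t of its periods along the fixed loop φ_0 ∘ γ
(`IsSympLoop.area_sweep`). Let η be a closed (2n-1)-form Poincaré dual to that loop
(`exists_poincare_dual`). The Lefschetz condition gives η = Ω^{n-1} ∧ β + exact with β closed. The
exact part pairs to zero with closed 1-forms (`integral_ratio_wedgeOne_exact`). Contracting β ∧ Ω^n
= 0 with X gives n Ω^{n-1} ∧ β ∧ ι_XΩ = β(X) Ω^n (`ratio_wedge_pow_contract`). So n times the area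
is the integral over t and V of β(X_t) Ω^n. Since φ_t preserves Ω^n, the integrand may be evaluated
at φ_t(x). By Fubini, what remains for each x is the integral of β along the orbit of x, which is
zero because the orbit is null-homologous (`Form.IsClosed.loopIntegral_eq_zero`).

A top form is integrated by taking its quotient by Ω^n and integrating against the measure of
density |Ω^n|, so no orientation is chosen. Stokes' theorem is needed only for forms supported in
one chart ball, and Poincaré duality rests on the compactly supported Poincaré lemma in top degree.
-/

lemma two_le_infty : (2 : WithTop ℕ∞) ≤ ∞ := WithTop.coe_le_coe.2 (le_top (a := (2 : ℕ∞)))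

/-! ### Smooth families of alternating forms -/

section AlternatingSmoothness

variable {W : Type*} [NormedAddCommGroup W] [NormedSpace ℝ W] {k : ℕ}

/-- Evaluation of an alternating form on all tuples of basis vectors. -/
def evalBasis {ι : Type*} (b : Module.Basis ι ℝ W) (k : ℕ) :
    (W [⋀^Fin k]→L[ℝ] ℝ) →ₗ[ℝ] ((Fin k → ι) → ℝ) where
  toFun F i := F fun j => b (i j)
  map_add' _ _ := rfl
  map_smul' _ _ := rfl

lemma evalBasis_injective {ι : Type*} (b : Module.Basis ι ℝ W) (k : ℕ) :
    Function.Injective (evalBasis b k) := by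
  intro F G h
  apply ContinuousAlternatingMap.toAlternatingMap_injective
  refine Module.Basis.ext_alternating b fun v _ => ?_
  exact congrFun h v

variable {X : Type*} [NormedAddCommGroup X] [NormedSpace ℝ X]

/-- Evaluation on tuples of basis vectors is injective, hence has a linear left inverse, which is
continuous in finite dimension. So a family of forms is a continuous linear image of its scalar
coefficient functions. -/
lemma contDiffAt_alternating_of_apply [FiniteDimensional ℝ W] {F : X → W [⋀^Fin k]→L[ℝ] ℝ}
    {x : X} {n : WithTop ℕ∞} (h : ∀ v, ContDiffAt ℝ n (fun y => F y v) x) :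
    ContDiffAt ℝ n F x := by
  obtain ⟨g, hg⟩ := (evalBasis (Module.finBasis ℝ W) k).exists_leftInverse_of_injective
    (LinearMap.ker_eq_bot.2 (evalBasis_injective (Module.finBasis ℝ W) k))
  have : F = fun y => LinearMap.toContinuousLinearMap g (evalBasis (Module.finBasis ℝ W) k (F y)) :=
    funext fun y => (LinearMap.congr_fun hg (F y)).symm
  rw [this]
  exact (LinearMap.toContinuousLinearMap g).contDiff.contDiffAt.comp x
    (contDiffAt_pi.2 fun i => h _)

lemma contDiffAt_alternating_apply {F : X → W [⋀^Fin k]→L[ℝ] ℝ} {v : X → Fin k → W}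
    {x : X} {n : WithTop ℕ∞} (hF : ContDiffAt ℝ n F x) (hv : ∀ i, ContDiffAt ℝ n (fun y => v y i) x) :
    ContDiffAt ℝ n (fun y => F y (v y)) x := by
  have h1 : ContDiffAt ℝ n (fun p : (ContinuousMultilinearMap ℝ (fun _ : Fin k => W) ℝ) × (Fin k → W) =>
      p.1 p.2) ((F x).toContinuousMultilinearMap, v x) :=
    (ContinuousLinearMap.analyticAt_uncurry_of_multilinear
      (ContinuousLinearMap.id ℝ (ContinuousMultilinearMap ℝ (fun _ : Fin k => W) ℝ))).contDiffAt
  have h2 : ContDiffAt ℝ n (fun y => (F y).toContinuousMultilinearMap) x :=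
    (ContinuousAlternatingMap.toContinuousMultilinearMapCLM ℝ :
      (W [⋀^Fin k]→L[ℝ] ℝ) →L[ℝ] _).contDiff.contDiffAt.comp x hF
  exact ContDiffAt.comp (g := fun p : (ContinuousMultilinearMap ℝ (fun _ : Fin k => W) ℝ) × (Fin k → W) =>
      p.1 p.2) x h1 (h2.prodMk (contDiffAt_pi.2 hv))

lemma contDiffAt_alternating_comp [FiniteDimensional ℝ W] {W' : Type*} [NormedAddCommGroup W']
    [NormedSpace ℝ W'] {F : X → W' [⋀^Fin k]→L[ℝ] ℝ} {L : X → W →L[ℝ] W'}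
    {x : X} {n : WithTop ℕ∞} (hF : ContDiffAt ℝ n F x) (hL : ContDiffAt ℝ n L x) :
    ContDiffAt ℝ n (fun y => (F y).compContinuousLinearMap (L y)) x :=
  contDiffAt_alternating_of_apply fun v =>
    contDiffAt_alternating_apply (v := fun y i => L y (v i)) hF
      fun _ => hL.clm_apply contDiffAt_const

end AlternatingSmoothness

/-! ### Pull-backs of forms to normed spaces -/

section Pullback

variable {m : ℕ} {M : Type u} [TopologicalSpace M] [ChartedSpace (EuclideanSpace ℝ (Fin m)) M]
variable {k : ℕ} {W : Type*} [NormedAddCommGroup W] [NormedSpace ℝ W]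

/-- The pull-back of a form on a manifold under a map from a normed space. -/
def pb (α : Form m M k) (u : W → M) (z : W) : W [⋀^Fin k]→L[ℝ] ℝ :=
  (α (u z)).compContinuousLinearMap (mfderiv 𝓘(ℝ, W) (𝓡 m) u z)

lemma pb_congr (α : Form m M k) {u u' : W → M} {z : W} (h : u =ᶠ[nhds z] u') :
    pb α u z = pb α u' z := by
  let A : M → (EuclideanSpace ℝ (Fin m)) [⋀^Fin k]→L[ℝ] ℝ := α
  -- The form is retyped with values on the fixed model space, so that an equality of base points
  -- can be substituted.
  have key : ∀ (x x' : M) (_ : x = x') (L L' : W →L[ℝ] EuclideanSpace ℝ (Fin m)), L = L' →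
      (A x).compContinuousLinearMap L = (A x').compContinuousLinearMap L' := by
    rintro x _ rfl L _ rfl; rfl
  exact key _ _ h.eq_of_nhds _ _ h.mfderiv_eq

variable {W' : Type*} [NormedAddCommGroup W'] [NormedSpace ℝ W']

lemma pb_comp (α : Form m M k) {u : W → M} {f : W' → W} {z : W'}
    (hu : MDifferentiableAt 𝓘(ℝ, W) (𝓡 m) u (f z)) (hf : DifferentiableAt ℝ f z) :
    pb α (u ∘ f) z = (pb α u (f z)).compContinuousLinearMap (fderiv ℝ f z) := by
  unfold pb
  rw [mfderiv_comp z hu hf.mdifferentiableAt, mfderiv_eq_fderiv]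
  rfl

variable [IsManifold (𝓡 m) ∞ M]

lemma mdifferentiableAt_extChartAt_symm {x₀ : M} {y : EuclideanSpace ℝ (Fin m)}
    (hy : y ∈ (extChartAt (𝓡 m) x₀).target) :
    MDifferentiableAt 𝓘(ℝ, EuclideanSpace ℝ (Fin m)) (𝓡 m) (extChartAt (𝓡 m) x₀).symm y :=
  ((contMDiffOn_extChartAt_symm (n := ∞) x₀).contMDiffAt
    ((isOpen_extChartAt_target x₀).mem_nhds hy)).mdifferentiableAt (by simp)

lemma contMDiffAt_extChartAt_symm {x₀ : M} {y : EuclideanSpace ℝ (Fin m)}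
    (hy : y ∈ (extChartAt (𝓡 m) x₀).target) :
    ContMDiffAt 𝓘(ℝ, EuclideanSpace ℝ (Fin m)) (𝓡 m) ∞ (extChartAt (𝓡 m) x₀).symm y :=
  ((contMDiffOn_extChartAt_symm (n := ∞) x₀).contMDiffAt
    ((isOpen_extChartAt_target x₀).mem_nhds hy))

lemma contDiffAt_chart_comp {u : W → M} {z : W} {n : WithTop ℕ∞} (hn : n ≤ ∞) (hu : ContMDiffAt 𝓘(ℝ, W) (𝓡 m) n u z)
    {x₀ : M} (hx : u z ∈ (extChartAt (𝓡 m) x₀).source) :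
    ContDiffAt ℝ n (extChartAt (𝓡 m) x₀ ∘ u) z := by
  rw [← contMDiffAt_iff_contDiffAt]
  rw [extChartAt_source] at hx
  exact ((contMDiffAt_extChartAt' (n := ∞) hx).of_le hn).comp z hu

lemma eventually_symm_chart_comp {X : Type*} [TopologicalSpace X] {u : X → M} {z : X} (hu : ContinuousAt u z)
    {x₀ : M} (hx : u z ∈ (extChartAt (𝓡 m) x₀).source) :
    u =ᶠ[nhds z] (extChartAt (𝓡 m) x₀).symm ∘ (extChartAt (𝓡 m) x₀ ∘ u) := by
  filter_upwards [hu ((isOpen_extChartAt_source (I := 𝓡 m) x₀).mem_nhds hx)] with y hy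
  exact ((extChartAt (𝓡 m) x₀).left_inv hy).symm

/-- Near `z` the map factors through the chart, so the chain rule reduces pull-backs from the
manifold to calculus between normed spaces. -/
lemma pb_eq_inChart (α : Form m M k) {u : W → M} {z : W}
    (hu : MDifferentiableAt 𝓘(ℝ, W) (𝓡 m) u z) {x₀ : M}
    (hx : u z ∈ (extChartAt (𝓡 m) x₀).source) :
    pb α u z = (α.inChart x₀ (extChartAt (𝓡 m) x₀ (u z))).compContinuousLinearMap
      (fderiv ℝ (extChartAt (𝓡 m) x₀ ∘ u) z) := by
  rw [pb_congr α (eventually_symm_chart_comp hu.continuousAt hx)]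
  refine pb_comp α (mdifferentiableAt_extChartAt_symm ((extChartAt (𝓡 m) x₀).map_source hx)) ?_
  rw [extChartAt_source] at hx
  exact ((mdifferentiableAt_extChartAt (I := 𝓡 m) hx).comp z hu).differentiableAt

lemma pb_eventuallyEq_inChart (α : Form m M k) {u : W → M} {z : W}
    (hu : ContMDiffAt 𝓘(ℝ, W) (𝓡 m) ∞ u z) {x₀ : M}
    (hx : u z ∈ (extChartAt (𝓡 m) x₀).source) :
    pb α u =ᶠ[nhds z] fun z => (α.inChart x₀ (extChartAt (𝓡 m) x₀ (u z))).compContinuousLinearMap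
      (fderiv ℝ (extChartAt (𝓡 m) x₀ ∘ u) z) := by
  filter_upwards [hu.continuousAt ((isOpen_extChartAt_source (I := 𝓡 m) x₀).mem_nhds hx),
    (contMDiffAt_iff_contMDiffAt_nhds (n := 1) (by simp)).1 (hu.of_le (by exact_mod_cast le_top))] with y hy hy'
  exact pb_eq_inChart α (hy'.mdifferentiableAt one_ne_zero) hy

lemma Form.IsSmooth.contDiffAt_inChart {α : Form m M k} (hα : α.IsSmooth) {x₀ : M}
    {y : EuclideanSpace ℝ (Fin m)} (hy : y ∈ (extChartAt (𝓡 m) x₀).target) :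
    ContDiffAt ℝ ∞ (α.inChart x₀) y :=
  (hα x₀).contDiffAt ((isOpen_extChartAt_target x₀).mem_nhds hy)

lemma Form.IsSmooth.contDiffAt_pb [FiniteDimensional ℝ W] {α : Form m M k} (hα : α.IsSmooth)
    {u : W → M} {z : W} (hu : ContMDiffAt 𝓘(ℝ, W) (𝓡 m) ∞ u z) :
    ContDiffAt ℝ ∞ (pb α u) z := by
  have hx := mem_extChartAt_source (I := 𝓡 m) (u z)
  refine ContDiffAt.congr_of_eventuallyEq ?_ (pb_eventuallyEq_inChart α hu hx)
  have h1 := contDiffAt_chart_comp le_rfl hu hx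
  exact contDiffAt_alternating_comp
    (ContDiffAt.comp z (hα.contDiffAt_inChart ((extChartAt (𝓡 m) (u z)).map_source hx)) h1)
    (h1.fderiv_right (m := ∞) (by simp))

/-- Naturality of d: in a chart the pull-back is a pull-back between normed spaces, where d is known
to commute with it. -/
lemma Form.IsExtDeriv.extDeriv_pb {α : Form m M k} {β : Form m M (k + 1)} (hα : α.IsSmooth)
    (h : α.IsExtDeriv β) {u : W → M} {z : W} (hu : ContMDiffAt 𝓘(ℝ, W) (𝓡 m) ∞ u z) :
    extDeriv (pb α u) z = pb β u z := by
  have hx := mem_extChartAt_source (I := 𝓡 m) (u z)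
  have hy := (extChartAt (𝓡 m) (u z)).map_source hx
  rw [(pb_eventuallyEq_inChart α hu hx).extDeriv_eq,
    pb_eq_inChart β (hu.mdifferentiableAt (by simp)) hx, ← h _ _ hy]
  exact extDeriv_pullback (r := ∞) ((hα.contDiffAt_inChart hy).differentiableAt (by simp))
    (contDiffAt_chart_comp le_rfl hu hx) (by
      rw [minSmoothness_of_isRCLikeNormedField]; exact two_le_infty)

end Pullback

/-! ### Signed sums over permutations -/

section AlternatingSums

variable {E : Type*}

/-- The signed sum of a function over all permutations of its arguments. -/
def altSum (n : ℕ) (F : (Fin n → E) → ℝ) (v : Fin n → E) : ℝ :=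
  ∑ σ : Equiv.Perm (Fin n), (Equiv.Perm.sign σ : ℝ) * F (v ∘ σ)

lemma altSum_comp_perm {n : ℕ} (F : (Fin n → E) → ℝ) (ρ : Equiv.Perm (Fin n)) (v : Fin n → E) :
    altSum n (fun w => F (w ∘ ρ)) v = (Equiv.Perm.sign ρ : ℝ) * altSum n F v := by
  unfold altSum
  rw [Finset.mul_sum, ← Equiv.sum_comp (Equiv.mulRight ρ)]
  refine Fintype.sum_equiv (Equiv.mulRight (ρ * ρ)) _ _ fun σ => ?_
  have h : (Equiv.Perm.sign ρ : ℝ) * (Equiv.Perm.sign ρ : ℝ) = 1 := by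
    rcases Int.units_eq_one_or (Equiv.Perm.sign ρ) with h | h <;> simp [h]
  simp only [Equiv.coe_mulRight, Equiv.Perm.sign_mul, Units.val_mul, Int.cast_mul,
    Equiv.Perm.coe_mul, Function.comp_assoc]
  linear_combination (-(Equiv.Perm.sign σ : ℝ) * (Equiv.Perm.sign ρ : ℝ) * F (v ∘ ⇑σ ∘ ⇑ρ ∘ ⇑ρ)) * h

/-- A permutation of n+1 letters is determined by the image p of 0 and a permutation of the other n.
The inverse of `Fin.cycleRange p` sends 0 to p and keeps the order of the rest. -/
lemma sum_perm_succ {n : ℕ} (f : Equiv.Perm (Fin (n + 1)) → ℝ) :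
    ∑ σ, f σ = ∑ p : Fin (n + 1), ∑ e : Equiv.Perm (Fin n),
      f ((Fin.cycleRange p)⁻¹ * Equiv.Perm.decomposeFin.symm (0, e)) := by
  rw [← Fintype.sum_prod_type']
  symm
  refine Function.Bijective.sum_comp (g := f) (e := fun x : Fin (n + 1) × Equiv.Perm (Fin n) =>
    (Fin.cycleRange x.1)⁻¹ * Equiv.Perm.decomposeFin.symm (0, x.2)) ?_
  rw [Fintype.bijective_iff_injective_and_card]
  refine ⟨?_, by simp [Fintype.card_perm, Nat.factorial_succ]⟩
  rintro ⟨p, e⟩ ⟨p', e'⟩ h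
  have h0 : p = p' := by
    have := congrArg (fun σ : Equiv.Perm (Fin (n + 1)) => σ 0) h
    simpa [Equiv.Perm.mul_apply, Equiv.Perm.inv_def, Fin.cycleRange_symm_zero] using this
  subst h0
  have := mul_left_cancel h
  have := Equiv.Perm.decomposeFin.symm.injective this
  simpa using this

/-- Laplace expansion: the cycle that brings the argument p to the front has sign (-1)^p. -/
lemma altSum_succ {n : ℕ} (F : (Fin (n + 1) → E) → ℝ) (v : Fin (n + 1) → E) :
    altSum (n + 1) F v = ∑ p : Fin (n + 1), (-1) ^ (p : ℕ) *
      altSum n (fun w => F (Fin.cons (v p) w)) (p.removeNth v) := by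
  unfold altSum
  rw [sum_perm_succ]
  refine Finset.sum_congr rfl fun p _ => ?_
  rw [Finset.mul_sum]
  refine Finset.sum_congr rfl fun e _ => ?_
  have h : v ∘ ⇑((Fin.cycleRange p)⁻¹ * Equiv.Perm.decomposeFin.symm (0, e)) =
      Fin.cons (v p) (p.removeNth v ∘ e) := by
    funext i
    refine Fin.cases ?_ (fun j => ?_) i
    · simp [Equiv.Perm.inv_def]
    · simp [Equiv.Perm.inv_def, Fin.removeNth]
  rw [h, Equiv.Perm.sign_mul, Equiv.Perm.sign_inv, Fin.sign_cycleRange,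
    Equiv.Perm.decomposeFin.symm_sign]
  simp
  ring

end AlternatingSums

/-! ### Linear algebra of exterior powers of a skew form -/

section Alternating

variable {E : Type*} [AddCommGroup E] [Module ℝ E]

open AlternatingMap

lemma altSum_alternating {n : ℕ} (A : E [⋀^Fin n]→ₗ[ℝ] ℝ) (v : Fin n → E) :
    altSum n A v = n.factorial * A v := by
  unfold altSum
  have : ∀ σ : Equiv.Perm (Fin n), (Equiv.Perm.sign σ : ℝ) * A (v ∘ σ) = A v := fun σ => by
    rw [A.map_perm]
    rcases Int.units_eq_one_or (Equiv.Perm.sign σ) with h | h <;> simp [h]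
  simp [this, Fintype.card_perm]

/-- Wedge product on the left with a linear functional. -/
def eps {k : ℕ} (b : E →ₗ[ℝ] ℝ) (A : E [⋀^Fin k]→ₗ[ℝ] ℝ) : E [⋀^Fin (k + 1)]→ₗ[ℝ] ℝ :=
  alternatizeUncurryFin (b.smulRight A)

/-- Twice the wedge product on the left with a bilinear form. -/
def eps₂ {k : ℕ} (w : E →ₗ[ℝ] E →ₗ[ℝ] ℝ) (A : E [⋀^Fin k]→ₗ[ℝ] ℝ) :
    E [⋀^Fin (k + 2)]→ₗ[ℝ] ℝ :=
  alternatizeUncurryFin (alternatizeUncurryFinLM ∘ₗ (LinearMap.smulRightₗ.flip A ∘ₗ w))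

lemma eps_apply {k : ℕ} (b : E →ₗ[ℝ] ℝ) (A : E [⋀^Fin k]→ₗ[ℝ] ℝ) (v : Fin (k + 1) → E) :
    eps b A v = ∑ i : Fin (k + 1), (-1) ^ (i : ℕ) * (b (v i) * A (i.removeNth v)) := by
  simp [eps, alternatizeUncurryFin_apply]

lemma eps₂_apply {k : ℕ} (w : E →ₗ[ℝ] E →ₗ[ℝ] ℝ) (A : E [⋀^Fin k]→ₗ[ℝ] ℝ)
    (v : Fin (k + 2) → E) :
    eps₂ w A v = ∑ i : Fin (k + 2), (-1) ^ (i : ℕ) * eps (w (v i)) A (i.removeNth v) := by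
  simp [eps₂, eps, alternatizeUncurryFin_apply (n := k + 1)]

/-- In the alternating sum the term 0 inserts `v` into `f`; in every other term `v` stays in front
and the sign shifts by one. All the contraction rules below are instances. -/
lemma curryLeft_alternatizeUncurryFin {n : ℕ} (f : E →ₗ[ℝ] E [⋀^Fin (n + 1)]→ₗ[ℝ] ℝ) (v : E)
    (g : E →ₗ[ℝ] E [⋀^Fin n]→ₗ[ℝ] ℝ) (hg : ∀ x, g x = (f x).curryLeft v) :
    (alternatizeUncurryFin f).curryLeft v = f v - alternatizeUncurryFin g := by
  ext u
  rw [curryLeft_apply_apply, alternatizeUncurryFin_apply, Fin.sum_univ_succ, AlternatingMap.sub_apply,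
    alternatizeUncurryFin_apply, sub_eq_add_neg, ← Finset.sum_neg_distrib]
  congr 1
  · simp [Matrix.vecCons]
  · refine Finset.sum_congr rfl fun i _ => ?_
    have h : Fin.removeNth i.succ (Matrix.vecCons v u) = Matrix.vecCons v (Fin.removeNth i u) := by
      funext j
      refine Fin.cases ?_ (fun j => ?_) j <;> simp [Fin.removeNth]
    rw [h, hg]
    simp [pow_succ]

lemma curryLeft_eps_zero (b : E →ₗ[ℝ] ℝ) (A : E [⋀^Fin 0]→ₗ[ℝ] ℝ) (v : E) :
    (eps b A).curryLeft v = b v • A := by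
  ext u
  simp [eps_apply, Subsingleton.elim (Fin.removeNth 0 (Matrix.vecCons v u)) u]

lemma curryLeft_eps {k : ℕ} (b : E →ₗ[ℝ] ℝ) (A : E [⋀^Fin (k + 1)]→ₗ[ℝ] ℝ) (v : E) :
    (eps b A).curryLeft v = b v • A - eps b (A.curryLeft v) :=
  curryLeft_alternatizeUncurryFin _ _ _ fun _ => rfl

lemma eps_add {k : ℕ} (b : E →ₗ[ℝ] ℝ) (A B : E [⋀^Fin k]→ₗ[ℝ] ℝ) :
    eps b (A + B) = eps b A + eps b B := by
  ext v; simp [eps_apply, mul_add, Finset.sum_add_distrib]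

lemma eps_smul {k : ℕ} (b : E →ₗ[ℝ] ℝ) (c : ℝ) (A : E [⋀^Fin k]→ₗ[ℝ] ℝ) :
    eps b (c • A) = c • eps b A := by
  ext v; simp [eps_apply, Finset.mul_sum, mul_left_comm]

lemma eps₂_add {k : ℕ} (w : E →ₗ[ℝ] E →ₗ[ℝ] ℝ) (A B : E [⋀^Fin k]→ₗ[ℝ] ℝ) :
    eps₂ w (A + B) = eps₂ w A + eps₂ w B := by
  ext v; simp [eps₂_apply, eps_add, mul_add, Finset.sum_add_distrib]

lemma eps₂_smul {k : ℕ} (w : E →ₗ[ℝ] E →ₗ[ℝ] ℝ) (c : ℝ) (A : E [⋀^Fin k]→ₗ[ℝ] ℝ) :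
    eps₂ w (c • A) = c • eps₂ w A := by
  ext v; simp [eps₂_apply, eps_smul, Finset.mul_sum, mul_left_comm]

/-- Alternating a ⊗ b + b ⊗ a gives zero, because it is symmetric. -/
lemma eps_comm {k : ℕ} (a b : E →ₗ[ℝ] ℝ) (A : E [⋀^Fin k]→ₗ[ℝ] ℝ) :
    eps a (eps b A) = -eps b (eps a A) := by
  have h := alternatizeUncurryFin_alternatizeUncurryFinLM_comp_of_symmetric
    (f := (LinearMap.smulRightₗ.flip A ∘ₗ (a.smulRight b + b.smulRight a)))
    (fun x y => by ext v; simp; ring)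
  rw [eq_neg_iff_add_eq_zero, ← h, ← sub_eq_zero]
  ext v
  simp only [eps_apply, alternatizeUncurryFin_apply (n := k + 1), AlternatingMap.add_apply,
    AlternatingMap.sub_apply, LinearMap.comp_apply, alternatizeUncurryFinLM_apply,
    alternatizeUncurryFin_apply (n := k), AlternatingMap.zero_apply]
  rw [← Finset.sum_add_distrib, ← Finset.sum_sub_distrib]
  refine Finset.sum_eq_zero fun i _ => ?_
  have hs : ∀ (n : ℕ) (x : ℝ), ((-1 : ℤ) ^ n) • x = (-1) ^ n * x := fun n x => by simp
  simp only [hs, Finset.mul_sum, ← Finset.sum_add_distrib, ← Finset.sum_sub_distrib]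
  refine Finset.sum_eq_zero fun j _ => ?_
  simp
  ring

lemma curryLeft_eps₂_zero (w : E →ₗ[ℝ] E →ₗ[ℝ] ℝ) (hw : ∀ x y, w x y = -w y x)
    (A : E [⋀^Fin 0]→ₗ[ℝ] ℝ) (v : E) :
    (eps₂ w A).curryLeft v = (2 : ℝ) • eps (w v) A := by
  rw [eps₂, curryLeft_alternatizeUncurryFin _ v ((-w v).smulRight A)
    (fun x => by
      simp only [LinearMap.comp_apply, alternatizeUncurryFinLM_apply]
      refine Eq.trans ?_ (curryLeft_eps_zero (w x) A v).symm
      ext u; simp [hw x v])]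
  ext u
  simp [eps, alternatizeUncurryFin_apply, Finset.sum_neg_distrib]
  ring

/-- The derivation rule for an even form. The factor 2 appears because `eps₂` runs over ordered
pairs of slots, and skewness of `w` makes both orders contribute equally. -/
lemma curryLeft_eps₂ {k : ℕ} (w : E →ₗ[ℝ] E →ₗ[ℝ] ℝ) (hw : ∀ x y, w x y = -w y x)
    (A : E [⋀^Fin (k + 1)]→ₗ[ℝ] ℝ) (v : E) :
    (eps₂ w A).curryLeft v = (2 : ℝ) • eps (w v) A + eps₂ w (A.curryLeft v) := by
  rw [eps₂, curryLeft_alternatizeUncurryFin _ v ((-w v).smulRight A -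
      (alternatizeUncurryFinLM ∘ₗ (LinearMap.smulRightₗ.flip (A.curryLeft v) ∘ₗ w)))
    (fun x => by
      simp only [LinearMap.comp_apply, alternatizeUncurryFinLM_apply]
      refine Eq.trans ?_ (curryLeft_eps (w x) A v).symm
      ext u; simp [hw x v, eps])]
  ext u
  simp [eps, eps₂, alternatizeUncurryFin_apply (n := k + 1), Finset.sum_sub_distrib, mul_sub,
    Finset.sum_neg_distrib]
  ring

lemma curryLeft_injective {k : ℕ} {A B : E [⋀^Fin (k + 1)]→ₗ[ℝ] ℝ}
    (h : ∀ v, A.curryLeft v = B.curryLeft v) : A = B := by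
  ext v
  have := congrArg (fun C => C (Matrix.vecTail v)) (h (Matrix.vecHead v))
  simpa using this

/-- Forms of even degree are central. Both sides have the same contraction with every vector, by
induction on the degree of `A`. -/
lemma eps₂_eps_comm {k : ℕ} (w : E →ₗ[ℝ] E →ₗ[ℝ] ℝ) (hw : ∀ x y, w x y = -w y x)
    (b : E →ₗ[ℝ] ℝ) (A : E [⋀^Fin k]→ₗ[ℝ] ℝ) : eps₂ w (eps b A) = eps b (eps₂ w A) := by
  induction k with
  | zero =>
    refine curryLeft_injective fun v => ?_
    rw [curryLeft_eps₂ w hw, curryLeft_eps, curryLeft_eps₂_zero w hw, curryLeft_eps_zero,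
      eps₂_smul, eps_smul, eps_comm b]
    module
  | succ k ih =>
    refine curryLeft_injective fun v => ?_
    rw [curryLeft_eps₂ w hw, curryLeft_eps, curryLeft_eps, curryLeft_eps₂ w hw, sub_eq_add_neg,
      eps₂_add, ← neg_one_smul ℝ (eps b (A.curryLeft v)), eps₂_smul, eps₂_smul, eps_add, eps_smul,
      eps_comm b, ih]
    module

/-- Powers of a skew bilinear form. -/
def epsPow (w : E →ₗ[ℝ] E →ₗ[ℝ] ℝ) : (j : ℕ) → E [⋀^Fin (2 * j)]→ₗ[ℝ] ℝ
  | 0 => AlternatingMap.constOfIsEmpty ℝ E (Fin 0) 1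
  | j + 1 => (1 / 2 : ℝ) • eps₂ w (epsPow w j)

/-- The power rule for the derivation ι_v. The 1/2 in `epsPow` absorbs the factor 2 of
`curryLeft_eps₂`. -/
lemma curryLeft_epsPow (w : E →ₗ[ℝ] E →ₗ[ℝ] ℝ) (hw : ∀ x y, w x y = -w y x) (j : ℕ) (v : E) :
    AlternatingMap.curryLeft (n := 2 * j + 1) (epsPow w (j + 1)) v =
      ((j : ℝ) + 1) • eps (w v) (epsPow w j) := by
  induction j with
  | zero =>
    change AlternatingMap.curryLeft (n := 1) ((1 / 2 : ℝ) • eps₂ w (epsPow w 0)) v = _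
    rw [AlternatingMap.curryLeft_smul, LinearMap.smul_apply, curryLeft_eps₂_zero w hw]
    module
  | succ j ih =>
    change AlternatingMap.curryLeft (n := 2 * j + 3) ((1 / 2 : ℝ) • eps₂ w (epsPow w (j + 1))) v = _
    rw [AlternatingMap.curryLeft_smul, LinearMap.smul_apply]
    have := curryLeft_eps₂ (k := 2 * j + 1) w hw (epsPow w (j + 1)) v
    rw [ih, eps₂_smul, eps₂_eps_comm w hw] at this
    refine (congrArg (fun x => (1 / 2 : ℝ) • x) this).trans ?_
    have h : eps (w v) (epsPow w (j + 1)) = (1 / 2 : ℝ) • eps (w v) (eps₂ w (epsPow w j)) :=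
      eps_smul _ _ _
    rw [h, smul_add, smul_smul]
    push_cast
    module

/-- If `a = w X`, then `a ∧ b ∧ w ^ k` is a multiple of `b X • w ^ (k + 1)` in top degree. -/
lemma eps_eps_epsPow (w : E →ₗ[ℝ] E →ₗ[ℝ] ℝ) (hw : ∀ x y, w x y = -w y x) (k : ℕ)
    (hdim : ∀ A : E [⋀^Fin (2 * (k + 1) + 1)]→ₗ[ℝ] ℝ, A = 0) (X : E) (b : E →ₗ[ℝ] ℝ) :
    ((k : ℝ) + 1) • eps (w X) (eps b (epsPow w k)) = -(b X • epsPow w (k + 1)) := by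
  -- The form b ∧ w^{k+1} vanishes for reasons of degree; its contraction with X is the claimed
  -- identity.
  have h := congrArg (fun A => AlternatingMap.curryLeft (n := 2 * (k + 1)) A X)
    (hdim (eps b (epsPow w (k + 1))))
  have h2 := curryLeft_eps (k := 2 * k + 1) b (epsPow w (k + 1)) X
  rw [curryLeft_epsPow w hw, eps_smul, eps_comm] at h2
  have h3 : b X • epsPow w (k + 1) - ((k : ℝ) + 1) • -eps (w X) (eps b (epsPow w k)) = 0 :=
    h2.symm.trans h
  rw [smul_neg, sub_neg_eq_add] at h3
  exact eq_neg_of_add_eq_zero_right h3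

/-- In the contraction with `e`, only the slot holding `f` contributes, since `e` is orthogonal to
all the other vectors. -/
lemma epsPow_succ_apply_cons_cons (w : E →ₗ[ℝ] E →ₗ[ℝ] ℝ) (hw : ∀ x y, w x y = -w y x) (j : ℕ)
    (e f : E) (v : Fin (2 * j) → E) (hv : ∀ i, w e (v i) = 0) :
    (epsPow w (j + 1) : E [⋀^Fin (2 * j + 2)]→ₗ[ℝ] ℝ) (Matrix.vecCons e (Matrix.vecCons f v)) =
      ((j : ℝ) + 1) * (w e f * epsPow w j v) := by
  have h := congrArg (fun A => A (Matrix.vecCons f v)) (curryLeft_epsPow w hw j e)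
  simp only [AlternatingMap.curryLeft_apply_apply] at h
  refine h.trans ?_
  rw [AlternatingMap.smul_apply, smul_eq_mul, eps_apply, Fin.sum_univ_succ, Finset.sum_eq_zero]
  · simp
  · intro i _
    simp [hv]

/-- Build a symplectic basis: pick e, f in S with w(e, f) ≠ 0, pass to their orthogonal complement
in S and induct. This is why Ω^n has no zeros. -/
lemma exists_epsPow_ne_zero (w : E →ₗ[ℝ] E →ₗ[ℝ] ℝ) (hw : ∀ x y, w x y = -w y x) (j : ℕ)
    (S : Submodule ℝ E) [FiniteDimensional ℝ E] (hS : 2 * j ≤ Module.finrank ℝ S)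
    (hnd : ∀ v ∈ S, (∀ x ∈ S, w v x = 0) → v = 0) :
    ∃ v : Fin (2 * j) → E, (∀ i, v i ∈ S) ∧ epsPow w j v ≠ 0 := by
  induction j generalizing S with
  | zero => exact ⟨fun i => i.elim0, fun i => i.elim0, by simp [epsPow]⟩
  | succ j ih =>
    have : 0 < Module.finrank ℝ S := by omega
    obtain ⟨⟨e, heS⟩, he⟩ := Module.finrank_pos_iff_exists_ne_zero.1 this
    have he : e ≠ 0 := fun h => he (Subtype.ext h)
    obtain ⟨f, hfS, hf⟩ : ∃ f ∈ S, w e f ≠ 0 := by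
      by_contra! h
      exact he (hnd e heS h)
    have hee : ∀ x, w x x = 0 := fun x => by linarith [hw x x]
    -- The complement is cut out by two linear equations, so at most two dimensions are lost.
    let S' : Submodule ℝ E := S ⊓ ((w e).ker ⊓ (w f).ker)
    have hdim : 2 * j ≤ Module.finrank ℝ S' := by
      let g : S →ₗ[ℝ] ℝ × ℝ := ((w e).prod (w f)).comp S.subtype
      have h1 := g.finrank_range_add_finrank_ker
      have h2 : Module.finrank ℝ g.range ≤ 2 := by
        have := Submodule.finrank_le g.range
        simpa using this
      have h3 : S' = g.ker.map S.subtype := by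
        ext x
        simp [S', g]
        tauto
      rw [h3, LinearEquiv.finrank_eq (Submodule.equivMapOfInjective S.subtype
        S.subtype_injective g.ker).symm]
      omega
    obtain ⟨v, hv, hv'⟩ := ih S' hdim (by
      intro v hv h
      refine hnd v hv.1 fun x hx => ?_
      -- The projection of x to S' along e and f. It differs from x by vectors that pair to zero
      -- with v.
      have h1 := h (x - (w x f / w e f) • e - (w e x / w e f) • f) ⟨?_, ?_, ?_⟩
      · have h2 : w v e = 0 := by rw [hw, show w e v = 0 from hv.2.1, neg_zero]
        have h3 : w v f = 0 := by rw [hw, show w f v = 0 from hv.2.2, neg_zero]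
        simpa [h2, h3] using h1
      · exact S.sub_mem (S.sub_mem hx (S.smul_mem _ heS)) (S.smul_mem _ hfS)
      · simp [hee]
        field_simp
        ring
      · simp [hee, hw f x, hw f e]
        field_simp
        ring)
    refine ⟨(Matrix.vecCons e (Matrix.vecCons f v) : Fin (2 * j + 2) → E), ?_, ?_⟩
    · refine Fin.cases heS (Fin.cases hfS fun i => (hv i).1)
    · refine ne_of_eq_of_ne (epsPow_succ_apply_cons_cons w hw j e f v fun i => (hv i).2.1) ?_
      positivity

end Alternating

/-! ### Wedge products with 1-forms and 2-forms as alternating sums -/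

section Wedge

variable {E : Type*} [AddCommGroup E] [Module ℝ E] [TopologicalSpace E]

/-- The sum over shuffles becomes a sum over all permutations once each shuffle is counted k! l!
times. -/
lemma factorial_mul_wedge_apply {k l : ℕ} (a : E [⋀^Fin k]→L[ℝ] ℝ) (b : E [⋀^Fin l]→L[ℝ] ℝ)
    (v : Fin (k + l) → E) :
    (k.factorial * l.factorial : ℝ) * wedge a b v =
      altSum (k + l) (fun u => a (u ∘ Fin.castAdd l) * b (u ∘ Fin.natAdd k)) v := by
  have h := MultilinearMap.domCoprod_alternization_eq a.toAlternatingMap b.toAlternatingMap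
  have h2 := congrArg (fun A => LinearMap.mul' ℝ ℝ (A fun i => v (finSumFinEquiv i))) h
  simp only [AlternatingMap.smul_apply, map_nsmul, Fintype.card_fin] at h2
  have h3 : wedge a b v = LinearMap.mul' ℝ ℝ ((a.toAlternatingMap.domCoprod b.toAlternatingMap)
    fun i => v (finSumFinEquiv i)) := rfl
  rw [h3, ← Nat.cast_mul, ← nsmul_eq_mul, ← h2, MultilinearMap.alternatization_apply, map_sum, altSum]
  refine Fintype.sum_equiv (finSumFinEquiv.permCongr) _ _ fun σ => ?_
  rw [Equiv.Perm.sign_permCongr]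
  have h4 : ∀ x : TensorProduct ℝ ℝ ℝ, LinearMap.mul' ℝ ℝ (Equiv.Perm.sign σ • x) =
      (Equiv.Perm.sign σ : ℝ) * LinearMap.mul' ℝ ℝ x := fun x => by
    rcases Int.units_eq_one_or (Equiv.Perm.sign σ) with h | h <;> simp [h]
  rw [h4]
  congr 1
  simp [MultilinearMap.domDomCongr_apply, Function.comp_def]

/-- A `1`-form on a vector space as a linear functional. -/
def lin (b : E [⋀^Fin 1]→L[ℝ] ℝ) : E →ₗ[ℝ] ℝ where
  toFun x := b ![x]
  map_add' x y := b.map_vecCons_add ![] x y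
  map_smul' c x := b.map_vecCons_smul ![] c x

/-- A `2`-form on a vector space as a bilinear form. -/
def bilin (w : E [⋀^Fin 2]→L[ℝ] ℝ) : E →ₗ[ℝ] E →ₗ[ℝ] ℝ :=
  LinearMap.mk₂ ℝ (fun x y => w ![x, y]) (fun x x' y => w.map_vecCons_add ![y] x x')
    (fun c x y => w.map_vecCons_smul ![y] c x)
    (fun x y y' => by
      simpa using (w.toAlternatingMap.curryLeft x).map_vecCons_add ![] y y')
    (fun c x y => by
      simpa using (w.toAlternatingMap.curryLeft x).map_vecCons_smul ![] c y)

lemma lin_apply (b : E [⋀^Fin 1]→L[ℝ] ℝ) (x : E) : lin b x = b ![x] := rfl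

lemma bilin_apply (w : E [⋀^Fin 2]→L[ℝ] ℝ) (x y : E) : bilin w x y = w ![x, y] := rfl

lemma bilin_skew (w : E [⋀^Fin 2]→L[ℝ] ℝ) (x y : E) : bilin w x y = -bilin w y x := by
  rw [bilin_apply, bilin_apply]
  refine Eq.trans ?_ (w.toAlternatingMap.map_swap ![y, x] (i := 0) (j := 1) (by simp))
  refine congrArg (fun v => w v) ?_
  funext i; fin_cases i <;> simp

lemma wedge_one_apply {k : ℕ} (A : E [⋀^Fin k]→L[ℝ] ℝ) (b : E [⋀^Fin 1]→L[ℝ] ℝ)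
    (v : Fin (k + 1) → E) :
    wedge A b v = (-1) ^ k * eps (lin b) A.toAlternatingMap v := by
  have h := factorial_mul_wedge_apply A b v
  -- Rotating the last argument to the front exchanges the factors; the rotation has sign (-1)^k.
  have h1 : (fun u : Fin (k + 1) → E => A (u ∘ Fin.castAdd 1) * b (u ∘ Fin.natAdd k)) =
      fun u => (fun u' : Fin (k + 1) → E => b ![u' 0] * A (Fin.tail u')) (u ∘ ⇑(finRotate (k + 1))⁻¹) := by
    funext u
    rw [mul_comm]
    congr 2
    · funext i
      fin_cases i
      simp only [Function.comp_apply, Fin.zero_eta, Matrix.cons_val_fin_one]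
      congr 1
    · funext i
      simp only [Function.comp_apply, Fin.tail]
      congr 1
      rw [Equiv.Perm.eq_inv_iff_eq]
      ext
      simp [Fin.castAdd, Fin.val_add]
  rw [h1, altSum_comp_perm (fun u' : Fin (k + 1) → E => b ![u' 0] * A (Fin.tail u')), altSum_succ,
    Equiv.Perm.sign_inv, sign_finRotate] at h
  have hk : (k.factorial : ℝ) ≠ 0 := by positivity
  apply mul_left_cancel₀ hk
  simp only [Fin.cons_zero, Fin.tail_cons] at h
  have h2 : ∀ (c : ℝ) (u : Fin k → E), altSum k (fun w => c * A w) u = k.factorial * (c * A u) := by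
    intro c u
    exact altSum_alternating (c • A.toAlternatingMap) u
  simp only [h2] at h
  rw [eps_apply]
  simp only [Nat.factorial_one, Nat.cast_one, mul_one, Nat.add_sub_cancel] at h
  rw [h]
  push_cast
  simp only [Finset.mul_sum, lin_apply]
  refine Finset.sum_congr rfl fun i _ => ?_
  simp
  ring

lemma wedge_two_apply {k : ℕ} (A : E [⋀^Fin k]→L[ℝ] ℝ) (w : E [⋀^Fin 2]→L[ℝ] ℝ)
    (v : Fin (k + 2) → E) :
    wedge A w v = 1 / 2 * eps₂ (bilin w) A.toAlternatingMap v := by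
  have h := factorial_mul_wedge_apply A w v
  -- Two rotations bring the last two arguments to the front, and their signs cancel.
  have h1 : (fun u : Fin (k + 2) → E => A (u ∘ Fin.castAdd 2) * w (u ∘ Fin.natAdd k)) =
      fun u => (fun u' : Fin (k + 2) → E => w ![u' 0, u' 1] * A (Fin.tail (Fin.tail u')))
        (u ∘ ⇑((finRotate (k + 2) * finRotate (k + 2))⁻¹ : Equiv.Perm (Fin (k + 2)))) := by
    have hr : ∀ i : Fin (k + 2), finRotate (k + 2) i = i + 1 := fun i => finRotate_apply i
    funext u
    rw [mul_comm]
    congr 2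
    · funext i
      fin_cases i
      · simp only [Function.comp_apply]
        refine congrArg u ?_
        rw [Equiv.Perm.eq_inv_iff_eq, Equiv.Perm.mul_apply, hr, hr]
        ext
        simp [Fin.val_add]
      · simp only [Function.comp_apply]
        refine congrArg u ?_
        rw [Equiv.Perm.eq_inv_iff_eq, Equiv.Perm.mul_apply, hr, hr]
        ext
        simp [Fin.val_add]
    · funext i
      simp only [Function.comp_apply, Fin.tail]
      congr 1
      rw [Equiv.Perm.eq_inv_iff_eq, Equiv.Perm.mul_apply, hr, hr]
      ext
      simp [Fin.val_add]
  rw [h1, altSum_comp_perm (fun u' : Fin (k + 2) → E => w ![u' 0, u' 1] * A (Fin.tail (Fin.tail u'))),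
    altSum_succ, Equiv.Perm.sign_inv, Equiv.Perm.sign_mul] at h
  have hk : (k.factorial : ℝ) ≠ 0 := by positivity
  apply mul_left_cancel₀ hk
  have h2 : ∀ (c : ℝ) (u : Fin k → E), altSum k (fun w => c * A w) u = k.factorial * (c * A u) := by
    intro c u
    exact altSum_alternating (c • A.toAlternatingMap) u
  have h0 : ∀ (x : E) (u : Fin (k + 1) → E), (Fin.cons x u : Fin (k + 2) → E) 1 = u 0 :=
    fun _ _ => rfl
  simp only [Fin.cons_zero, Fin.tail_cons, h0, altSum_succ, h2] at h
  rw [eps₂_apply]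
  simp only [eps_apply]
  have hs : (((Equiv.Perm.sign (finRotate (k + 2)) * Equiv.Perm.sign (finRotate (k + 2)) : ℤˣ) : ℤ) : ℝ)
    = 1 := by
    rw [Int.units_mul_self]; simp
  rw [hs, Nat.factorial_two, Nat.cast_two, one_mul] at h
  have h3 : (k.factorial : ℝ) * wedge A w v = 1 / 2 * (k.factorial * 2 * wedge A w v) := by ring
  rw [h3, h]
  simp only [Finset.mul_sum, bilin_apply]
  refine Finset.sum_congr rfl fun i _ => Finset.sum_congr rfl fun j _ => ?_
  simp
  ring

lemma wedgePow_toAlternatingMap (w : E [⋀^Fin 2]→L[ℝ] ℝ) (j : ℕ) :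
    (wedgePow w j).toAlternatingMap = epsPow (bilin w) j := by
  induction j with
  | zero => rfl
  | succ j ih =>
    ext v
    refine (wedge_two_apply (wedgePow w j) w v).trans ?_
    rw [ih]
    rfl

end Wedge

/-! ### Real singular cocycles on null-homologous loops -/

section SingularChains

open CategoryTheory Simplicial

/-- A function on 1-simplices extends linearly to chains. The hypothesis `hI` makes it a cocycle,
and cocycles kill boundaries. -/
lemma cochain_apply_eq_zero_of_isNullHomologous {X : Type u} [TopologicalSpace X] {x : X} (c : Path x x)
    (I : C(stdSimplex ℝ (Fin 2), X) → ℝ)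
    (hI : ∀ τ : C(stdSimplex ℝ (Fin 3), X),
      I (τ.comp ⟨stdSimplex.map (Fin.succAbove 0), stdSimplex.continuous_map _⟩)
        - I (τ.comp ⟨stdSimplex.map (Fin.succAbove 1), stdSimplex.continuous_map _⟩)
        + I (τ.comp ⟨stdSimplex.map (Fin.succAbove 2), stdSimplex.continuous_map _⟩) = 0)
    (hc : IsNullHomologous c) :
    I (c.toContinuousMap.comp
      ⟨stdSimplexHomeomorphUnitInterval, stdSimplexHomeomorphUnitInterval.continuous⟩) = 0 := by
  let S := TopCat.toSSet.obj (TopCat.of X)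
  let R := ModuleCat.of ℝ (ULift.{u} ℝ)
  obtain ⟨b, hb⟩ := hc
  -- The chain group is a coproduct of copies of ℝ indexed by simplices; its universal property
  -- gives the linear extension.
  let Ψ : (S.chainComplex R).X 1 ⟶ R :=
    Limits.Sigma.desc fun s => ModuleCat.ofHom ((I (TopCat.toSSetObjEquiv (TopCat.of X) _ s)) • LinearMap.id)
  have hΨ : ∀ s : S _⦋1⦌, S.ιChainComplex (R := R) s ≫ Ψ =
      ModuleCat.ofHom ((I (TopCat.toSSetObjEquiv (TopCat.of X) _ s)) • LinearMap.id) := fun s => by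
    exact Limits.Sigma.ι_desc _ _
  have hd : (S.chainComplex R).d 2 1 ≫ Ψ = 0 := by
    refine SSet.chainComplex_hom_ext fun s => ?_
    rw [← Category.assoc, SSet.ιChainComplex_d, Limits.comp_zero, Preadditive.sum_comp]
    simp only [Preadditive.zsmul_comp, hΨ]
    have h := hI (TopCat.toSSetObjEquiv (TopCat.of X) _ s)
    have hs : ∀ i : Fin 3, TopCat.toSSetObjEquiv (TopCat.of X) _ (S.δ i s) =
        (TopCat.toSSetObjEquiv (TopCat.of X) _ s).comp
          ⟨stdSimplex.map (Fin.succAbove i), stdSimplex.continuous_map _⟩ := fun i => rfl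
    refine (Fin.sum_univ_three _).trans ?_
    rw [hs, hs, hs]
    ext y
    have h' := congrArg (fun r : ℝ => (r • y).down) h
    simpa [sub_eq_add_neg, add_smul, neg_smul] using h'
  have h1 : Ψ (S.ιChainComplex (R := R) (loopSimplex c) (ULift.up 1)) = 0 := by
    refine (congrArg Ψ hb).symm.trans ?_
    exact congrArg (fun f => f b) hd
  have h2 := congrArg (fun f => f (ULift.up (1 : ℝ))) (hΨ (loopSimplex c))
  have h3 := congrArg ULift.down (h2.symm.trans h1)
  simp at h3
  exact h3

end SingularChains

/-! ### Local primitives and periods of closed 1-forms -/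

section Primitives

variable {m : ℕ} {M : Type u} [TopologicalSpace M] [ChartedSpace (EuclideanSpace ℝ (Fin m)) M]

/-- `1`-forms on a normed space as continuous linear functionals. -/
def linL (W : Type*) [NormedAddCommGroup W] [NormedSpace ℝ W] : (W [⋀^Fin 1]→L[ℝ] ℝ) →L[ℝ] W →L[ℝ] ℝ :=
  (ContinuousAlternatingMap.ofSubsingletonLIE (𝕜 := ℝ) (E := W) (F := ℝ) (0 : Fin 1)).symm.toContinuousLinearEquiv

lemma linL_apply {W : Type*} [NormedAddCommGroup W] [NormedSpace ℝ W] (b : W [⋀^Fin 1]→L[ℝ] ℝ) (x : W) :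
    linL W b x = b ![x] := by
  change b (fun _ => x) = _
  congr 1
  funext i
  fin_cases i
  rfl

/-- The value of a `1`-form at a point as a continuous linear functional. -/
def Form.cov (β : Form m M 1) (x : M) : EuclideanSpace ℝ (Fin m) →L[ℝ] ℝ :=
  linL (EuclideanSpace ℝ (Fin m)) (β x)

/-- `f` is a primitive of the `1`-form `β` on the open set `N`. -/
def IsPrimitiveOn (β : Form m M 1) (f : M → ℝ) (N : Set M) : Prop :=
  IsOpen N ∧ ∀ x ∈ N, HasMFDerivAt (𝓡 m) 𝓘(ℝ, ℝ) f x (β.cov x)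

lemma IsPrimitiveOn.hasFDerivAt_comp {β : Form m M 1} {f : M → ℝ} {N : Set M} (h : IsPrimitiveOn β f N)
    {W : Type*} [NormedAddCommGroup W] [NormedSpace ℝ W] {u : W → M} {z : W}
    (hu : MDifferentiableAt 𝓘(ℝ, W) (𝓡 m) u z) (hz : u z ∈ N) :
    HasFDerivAt (f ∘ u) (linL W (pb β u z)) z := by
  have := (h.2 _ hz).comp z hu.hasMFDerivAt
  have h2 := HasMFDerivAt.hasFDerivAt this
  have key : linL W (pb β u z) = (β.cov (u z)).comp
      (mfderiv 𝓘(ℝ, W) (𝓡 m) u z : W →L[ℝ] EuclideanSpace ℝ (Fin m)) := by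
    ext v
    rw [linL_apply]
    refine Eq.trans ?_ (linL_apply (W := EuclideanSpace ℝ (Fin m)) (β (u z)) _).symm
    change β (u z) _ = _
    congr 1
    funext i
    fin_cases i
    rfl
  rw [key]
  exact h2

variable [IsManifold (𝓡 m) ∞ M]

lemma fderiv_symm_of_extDeriv_eq_zero {W : Type*} [NormedAddCommGroup W] [NormedSpace ℝ W]
    {θ : W → W [⋀^Fin 1]→L[ℝ] ℝ} {y : W} (h : extDeriv θ y = 0) (hθ : DifferentiableAt ℝ θ y) (v w : W) :
    fderiv ℝ (fun y => linL W (θ y)) y v w = fderiv ℝ (fun y => linL W (θ y)) y w v := by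
  have h1 : fderiv ℝ (fun y => linL W (θ y)) y = (linL W).comp (fderiv ℝ θ y) :=
    ((linL W).hasFDerivAt.comp y hθ.hasFDerivAt).fderiv
  have h2 := congrArg (fun A => A ![v, w]) h
  simp only [extDeriv, ContinuousAlternatingMap.alternatizeUncurryFin_apply] at h2
  rw [h1]
  simp only [ContinuousLinearMap.comp_apply, linL_apply]
  have e1 : Fin.removeNth 0 ![v, w] = ![w] := by ext i; fin_cases i; rfl
  have e2 : Fin.removeNth 1 ![v, w] = ![v] := by ext i; fin_cases i; rfl
  simp [e1, e2] at h2
  linarith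

/-- The preimage of a ball under the chart at `p`, centred at `p`. -/
def chartBall (p : M) (r : ℝ) : Set M :=
  (extChartAt (𝓡 m) p).source ∩ extChartAt (𝓡 m) p ⁻¹' Metric.ball (extChartAt (𝓡 m) p p) r

lemma isOpen_chartBall (p : M) (r : ℝ) : IsOpen (chartBall (m := m) p r) :=
  (continuousOn_extChartAt p).isOpen_inter_preimage (isOpen_extChartAt_source p) Metric.isOpen_ball

lemma mem_chartBall_self (p : M) {r : ℝ} (hr : 0 < r) : p ∈ chartBall (m := m) p r :=
  ⟨mem_extChartAt_source p, Metric.mem_ball_self hr⟩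

/-- The Poincaré lemma on a convex ball in the chart, transported back by the chart. -/
lemma Form.IsClosed.exists_isPrimitiveOn_chartBall {β : Form m M 1} (hβ : β.IsClosed) (p : M) {r : ℝ}
    (hball : Metric.ball (extChartAt (𝓡 m) p p) r ⊆ (extChartAt (𝓡 m) p).target) :
    ∃ f : M → ℝ, IsPrimitiveOn β f (chartBall (m := m) p r) := by
  set e := extChartAt (𝓡 m) p
  obtain ⟨F, hF⟩ := (convex_ball (e p) r).exists_forall_hasFDerivAt_of_fderiv_symmetric
    Metric.isOpen_ball
    (show DifferentiableOn ℝ (fun y => linL _ (β.inChart p y)) _ from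
      fun y hy => ((linL _).differentiableAt.comp y
        (hβ.1.differentiableAt p (hball hy))).differentiableWithinAt)
    (fun y hy v w => fderiv_symm_of_extDeriv_eq_zero ((hβ.2 p y (hball hy)).trans
      (by rw [Form.inChart_zero]; rfl)) (hβ.1.differentiableAt p (hball hy)) v w)
  refine ⟨F ∘ e, isOpen_chartBall p r, ?_⟩
  rintro x ⟨hx, hxr⟩
  have hx' := hx
  rw [extChartAt_source] at hx'
  have h1 := HasMFDerivAt.comp x (hF _ hxr).hasMFDerivAt
    (mdifferentiableAt_extChartAt (I := 𝓡 m) hx').hasMFDerivAt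
  have key : (β.cov x) = (linL _ (β.inChart p (e x))).comp
      (mfderiv (𝓡 m) 𝓘(ℝ, EuclideanSpace ℝ (Fin m)) e x :
        EuclideanSpace ℝ (Fin m) →L[ℝ] EuclideanSpace ℝ (Fin m)) := by
    have hid : x = e.symm (e x) := (e.left_inv hx).symm
    have h2 : ∀ v : EuclideanSpace ℝ (Fin m),
        mfderiv 𝓘(ℝ, EuclideanSpace ℝ (Fin m)) (𝓡 m) e.symm (e x)
        (mfderiv (𝓡 m) 𝓘(ℝ, EuclideanSpace ℝ (Fin m)) e x v) = v := by
      intro v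
      have h3 : e.symm ∘ e =ᶠ[nhds x] id := by
        filter_upwards [(isOpen_extChartAt_source (I := 𝓡 m) p).mem_nhds hx] with y hy
        exact e.left_inv hy
      have h4 := h3.mfderiv_eq (I := 𝓡 m) (I' := 𝓡 m)
      rw [mfderiv_comp x (mdifferentiableAt_extChartAt_symm (e.map_source hx))
        (mdifferentiableAt_extChartAt (I := 𝓡 m) hx'), mfderiv_id] at h4
      exact congrArg (fun L : EuclideanSpace ℝ (Fin m) →L[ℝ] EuclideanSpace ℝ (Fin m) => L v) h4
    ext v
    let A : M → (EuclideanSpace ℝ (Fin m)) [⋀^Fin 1]→L[ℝ] ℝ := β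
    have h5 : ∀ (x' : M) (_ : x = x') (w w' : EuclideanSpace ℝ (Fin m)), w = w' →
        linL _ (A x) w = linL _ (A x') w' := by
      rintro _ rfl w _ rfl; rfl
    refine (h5 _ hid _ _ (h2 v).symm).trans ?_
    refine (linL_apply (W := EuclideanSpace ℝ (Fin m)) (A _) _).trans ?_
    refine Eq.trans ?_ (linL_apply (W := EuclideanSpace ℝ (Fin m)) (β.inChart p (e x)) _).symm
    change A _ _ = A _ _
    congr 1
    funext i
    fin_cases i
    rfl
  rw [key]
  exact h1

lemma Form.IsClosed.exists_isPrimitiveOn {β : Form m M 1} (hβ : β.IsClosed) (p : M) :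
    ∃ f N, p ∈ N ∧ IsPrimitiveOn β f N := by
  obtain ⟨r, hr, hball⟩ := Metric.isOpen_iff.1 (isOpen_extChartAt_target (I := 𝓡 m) p) _
    (mem_extChartAt_target p)
  obtain ⟨f, hf⟩ := hβ.exists_isPrimitiveOn_chartBall p hball
  exact ⟨f, _, mem_chartBall_self p hr, hf⟩

/-- The difference of two primitives has zero derivative, so it is constant on a ball in the chart.
-/
lemma IsPrimitiveOn.eventually_sub_eq {β : Form m M 1} {f f' : M → ℝ} {N N' : Set M}
    (h : IsPrimitiveOn β f N) (h' : IsPrimitiveOn β f' N') {x : M} (hx : x ∈ N) (hx' : x ∈ N') :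
    ∀ᶠ y in nhds x, f y - f x = f' y - f' x := by
  set e := extChartAt (𝓡 m) x
  have hopen : e.target ∩ e.symm ⁻¹' (N ∩ N') ∈ nhds (e x) := by
    refine ((continuousOn_extChartAt_symm x).isOpen_inter_preimage (isOpen_extChartAt_target x)
      (h.1.inter h'.1)).mem_nhds ⟨mem_extChartAt_target x, ?_⟩
    simp [e, hx, hx']
  obtain ⟨r, hr, hball⟩ := Metric.mem_nhds_iff.1 hopen
  have hd : ∀ y ∈ Metric.ball (e x) r,
      HasFDerivWithinAt (fun y => f (e.symm y) - f' (e.symm y)) (0 : _ →L[ℝ] ℝ) (Metric.ball (e x) r) y := by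
    intro y hy
    have hmd := mdifferentiableAt_extChartAt_symm (hball hy).1
    have := (h.hasFDerivAt_comp hmd (hball hy).2.1).sub (h'.hasFDerivAt_comp hmd (hball hy).2.2)
    rw [sub_self] at this
    exact this.hasFDerivWithinAt
  filter_upwards [(isOpen_extChartAt_source (I := 𝓡 m) x).mem_nhds (mem_extChartAt_source x),
    (continuousAt_extChartAt (I := 𝓡 m) x) (Metric.ball_mem_nhds _ hr)] with y hy hyr
  have := (convex_ball (e x) r).is_const_of_fderivWithin_eq_zero (𝕜 := ℝ)
    (fun y hy => (hd y hy).differentiableWithinAt)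
    (fun y hy => (hd y hy).fderivWithin (Metric.isOpen_ball.uniqueDiffWithinAt hy))
    hyr (Metric.mem_ball_self hr)
  simp only [e, (extChartAt (𝓡 m) x).left_inv hy,
    (extChartAt (𝓡 m) x).left_inv (mem_extChartAt_source x)] at this
  linarith

variable {Y : Type*} [TopologicalSpace Y] {Y' : Type*} [TopologicalSpace Y']

/-- `g` is locally on `K` the composition of `u` with a primitive of `β`, up to a constant. -/
def IsLocalPrimitive (β : Form m M 1) (K : Set Y) (u : Y → M) (g : Y → ℝ) : Prop :=
  ∀ z ∈ K, ∃ f N, IsPrimitiveOn β f N ∧ u z ∈ N ∧ ∀ᶠ z' in nhdsWithin z K, g z' - g z = f (u z') - f (u z)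

lemma IsLocalPrimitive.comp {β : Form m M 1} {K : Set Y} {u : Y → M} {g : Y → ℝ}
    (h : IsLocalPrimitive β K u g) {K' : Set Y'} {q : Y' → Y} (hq : ContinuousOn q K')
    (hqK : Set.MapsTo q K' K) : IsLocalPrimitive β K' (u ∘ q) (g ∘ q) := fun z hz => by
  obtain ⟨f, N, hf, hN, hev⟩ := h _ (hqK hz)
  exact ⟨f, N, hf, hN, ((hq z hz).tendsto_nhdsWithin hqK).eventually hev⟩

lemma IsPreconnected.eq_of_eventually_eq {K : Set Y} (hK : IsPreconnected K) {g : Y → ℝ}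
    (h : ∀ z ∈ K, ∀ᶠ z' in nhdsWithin z K, g z' = g z) {z z' : Y} (hz : z ∈ K) (hz' : z' ∈ K) :
    g z = g z' := by
  have := isPreconnected_iff_preconnectedSpace.1 hK
  have hl : IsLocallyConstant (K.domRestrict g) := by
    refine (IsLocallyConstant.iff_eventually_eq _).2 fun z => ?_
    have := h z z.2
    rw [nhdsWithin_eq_map_subtype_coe z.2] at this
    exact this
  exact hl.apply_eq_of_preconnectedSpace ⟨z, hz⟩ ⟨z', hz'⟩

/-- Increments of a local primitive depend only on the form and the map. This defines the integral
of a closed form along a path that is merely continuous. -/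
lemma IsLocalPrimitive.sub_eq_sub {β : Form m M 1} {K : Set Y} {u u' : Y → M} {g g' : Y → ℝ}
    (h : IsLocalPrimitive β K u g) (h' : IsLocalPrimitive β K u' g') (huu : Set.EqOn u u' K)
    (hu : ContinuousOn u K) (hK : IsPreconnected K) {z z' : Y} (hz : z ∈ K) (hz' : z' ∈ K) :
    g z' - g z = g' z' - g' z := by
  have := IsPreconnected.eq_of_eventually_eq hK (g := fun z => g z - g' z) (fun z hz => by
    obtain ⟨f, N, hf, hN, hev⟩ := h z hz
    obtain ⟨f', N', hf', hN', hev'⟩ := h' z hz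
    rw [← huu hz] at hN'
    filter_upwards [hev, hev', (hu z hz).eventually (hf.eventually_sub_eq hf' hN hN'),
      self_mem_nhdsWithin] with z' h1 h2 h3 h4
    rw [← huu hz, ← huu h4] at h2
    linarith) hz hz'
  linarith

lemma IsLocalPrimitive.continuousOn {β : Form m M 1} {K : Set Y} {u : Y → M} {g : Y → ℝ}
    (h : IsLocalPrimitive β K u g) (hu : ContinuousOn u K) : ContinuousOn g K := fun z hz => by
  obtain ⟨f, N, hf, hN, hev⟩ := h z hz
  have h1 : ContinuousWithinAt (fun z' => f (u z') - f (u z) + g z) K z :=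
    (((hf.2 _ hN).continuousAt.comp_continuousWithinAt (hu z hz)).sub continuousWithinAt_const).add
      continuousWithinAt_const
  refine h1.congr_of_eventuallyEq ?_ (by ring)
  filter_upwards [hev] with z' h
  linarith

/-- The fundamental theorem of calculus. Differentiability is needed only in the open interval, with
continuity at the ends. -/
lemma IsLocalPrimitive.integral_eq {β : Form m M 1} (hβ : β.IsSmooth) {u : ℝ → M} {g : ℝ → ℝ}
    (h : IsLocalPrimitive β (Set.Icc 0 1) u g) (hu : ContMDiff 𝓘(ℝ, ℝ) (𝓡 m) ∞ u) :
    loopIntegral β u = g 1 - g 0 := by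
  have hint : ∀ s, β (u s) ![mfderiv 𝓘(ℝ, ℝ) (𝓡 m) u s (1 : ℝ)] = pb β u s ![(1 : ℝ)] := by
    intro s
    change _ = β (u s) _
    congr 1
    funext i
    fin_cases i
    rfl
  have hcont : Continuous fun s => pb β u s ![(1 : ℝ)] := by
    refine continuous_iff_continuousAt.2 fun s => ?_
    exact (contDiffAt_alternating_apply (hβ.contDiffAt_pb (hu s))
      (fun i => contDiffAt_const (c := ![(1 : ℝ)] i))).continuousAt
  unfold loopIntegral
  simp only [hint]
  refine intervalIntegral.integral_eq_sub_of_hasDeriv_right_of_le zero_le_one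
    (h.continuousOn hu.continuous.continuousOn) (fun s hs => ?_) (hcont.intervalIntegrable _ _)
  obtain ⟨f, N, hf, hN, hev⟩ := h s (Set.Ioo_subset_Icc_self hs)
  rw [nhdsWithin_eq_nhds.2 (Icc_mem_nhds hs.1 hs.2)] at hev
  have h1 := (hf.hasFDerivAt_comp ((hu s).mdifferentiableAt (by simp)) hN).hasDerivAt
  rw [linL_apply] at h1
  refine HasDerivAt.hasDerivWithinAt ?_
  refine (h1.add_const (g s - f (u s))).congr_of_eventuallyEq ?_
  filter_upwards [hev] with z h
  simp only [Function.comp_apply]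
  linarith

variable {W : Type*} [NormedAddCommGroup W] [NormedSpace ℝ W]

/-- Integrate along the segments from a base point `x₀`: subdivide each segment below a Lebesgue
number and add up increments of primitives. Neighbouring segments give compatible sums because the
primitives agree up to constants on intersections of balls with `K`, which are convex. -/
lemma Form.IsClosed.exists_isLocalPrimitive {β : Form m M 1} (hβ : β.IsClosed) {K : Set W}
    (hK : IsCompact K) (hKc : Convex ℝ K) {u : W → M} (hu : ContinuousOn u K) :
    ∃ g, IsLocalPrimitive β K u g := by
  rcases K.eq_empty_or_nonempty with rfl | ⟨x₀, hx₀⟩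
  · exact ⟨0, fun z hz => hz.elim⟩
  choose f N hpN hf using hβ.exists_isPrimitiveOn
  have hU : ∀ p : M, ∃ U : Set W, IsOpen U ∧ u ⁻¹' N p ∩ K = U ∩ K := fun p =>
    continuousOn_iff'.1 hu (N p) (hf p).1
  choose U hUo hUK using hU
  obtain ⟨δ, hδ, hLeb⟩ := lebesgue_number_lemma_of_metric hK hUo (fun z hz => by
    refine Set.mem_iUnion.2 ⟨u z, ?_⟩
    have : z ∈ u ⁻¹' N (u z) ∩ K := ⟨hpN _, hz⟩
    rw [hUK] at this
    exact this.1)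
  have hLeb' : ∀ z : W, ∃ i, z ∈ K → Metric.ball z δ ⊆ U i := fun z => by
    by_cases hz : z ∈ K
    · obtain ⟨i, hi⟩ := hLeb z hz; exact ⟨i, fun _ => hi⟩
    · exact ⟨u z, fun h => (hz h).elim⟩
  choose i hi using hLeb'
  have hmem : ∀ z ∈ K, ∀ z' ∈ K, dist z' z < δ → u z' ∈ N (i z) := fun z hz z' hz' hd => by
    have : z' ∈ U (i z) ∩ K := ⟨hi z hz hd, hz'⟩
    rw [← hUK] at this
    exact this.1
  -- consistency of the local primitives
  have hcons : ∀ z ∈ K, ∀ w ∈ K, ∀ a ∈ K, ∀ b ∈ K, dist a z < δ → dist b z < δ → dist a w < δ →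
      dist b w < δ → f (i z) (u b) - f (i z) (u a) = f (i w) (u b) - f (i w) (u a) := by
    intro z hz w hw a ha b hb haz hbz haw hbw
    have hS : IsPreconnected (K ∩ (Metric.ball z δ ∩ Metric.ball w δ)) :=
      (hKc.inter ((convex_ball z δ).inter (convex_ball w δ))).isPreconnected
    have := IsPreconnected.eq_of_eventually_eq hS (g := fun a => f (i z) (u a) - f (i w) (u a))
      (fun c hc => by
        have := (hf (i z)).eventually_sub_eq (hf (i w)) (hmem z hz c hc.1 hc.2.1)
          (hmem w hw c hc.1 hc.2.2)
        filter_upwards [((hu c hc.1).mono Set.inter_subset_left).eventually this] with d hd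
        linarith) (z := a) (z' := b) ⟨ha, haz, haw⟩ ⟨hb, hbz, hbw⟩
    linarith
  obtain ⟨R, hR⟩ := hK.isBounded.subset_ball x₀
  -- So many steps that consecutive points on a segment from `x₀` are less than δ/4 apart. With z
  -- and z' also δ/4-close, the corners of each thin quadrilateral fit in one ball of radius δ.
  obtain ⟨n, hn⟩ := exists_nat_gt (4 * |R| / δ)
  have hn0 : (0 : ℝ) < n := lt_of_le_of_lt (by positivity) hn
  have hnR : |R| / n < δ / 4 := by
    rw [div_lt_iff₀ hδ] at hn
    rw [div_lt_iff₀ hn0]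
    linarith
  let p : ℕ → W → W := fun k z => x₀ + ((k : ℝ) / n) • (z - x₀)
  have hpK : ∀ k ≤ n, ∀ z ∈ K, p k z ∈ K := fun k hk z hz =>
    hKc.add_smul_sub_mem hx₀ hz ⟨by positivity, by rw [div_le_one hn0]; exact_mod_cast hk⟩
  have hstep : ∀ k, ∀ z ∈ K, dist (p (k + 1) z) (p k z) < δ / 4 := fun k z hz => by
    have : p (k + 1) z - p k z = ((1 : ℝ) / n) • (z - x₀) := by
      simp only [p]; push_cast; module
    rw [dist_eq_norm, this, norm_smul, Real.norm_of_nonneg (by positivity)]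
    refine lt_of_le_of_lt ?_ hnR
    rw [div_mul_eq_mul_div, one_mul]
    gcongr
    have := hR hz
    rw [mem_ball_iff_norm] at this
    exact this.le.trans (le_abs_self R)
  have hclose : ∀ k ≤ n, ∀ z z', dist z z' < δ / 4 → dist (p k z) (p k z') < δ / 4 := by
    intro k hk z z' hd
    have : p k z - p k z' = ((k : ℝ) / n) • (z - z') := by simp only [p]; module
    rw [dist_eq_norm, this, norm_smul, Real.norm_of_nonneg (by positivity), ← dist_eq_norm]
    refine lt_of_le_of_lt ?_ hd
    refine mul_le_of_le_one_left dist_nonneg ?_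
    rw [div_le_one hn0]; exact_mod_cast hk
  let g : W → ℝ := fun z => ∑ k ∈ Finset.range n,
    (f (i (p k z)) (u (p (k + 1) z)) - f (i (p k z)) (u (p k z)))
  refine ⟨g, fun z hz => ⟨f (i z), N (i z), hf _, hmem z hz z hz (by simpa using hδ), ?_⟩⟩
  have hpn : ∀ z, p n z = z := fun z => by simp [p, div_self hn0.ne']
  filter_upwards [self_mem_nhdsWithin,
    nhdsWithin_le_nhds (Metric.ball_mem_nhds z (show (0 : ℝ) < δ / 4 by positivity))] with z' hz' hd
  rw [Metric.mem_ball] at hd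
  -- `D k` is the increment across from one segment to the other at level k. The difference g z' - g
  -- z telescopes to D n - D 0, and D 0 = 0 because all segments start at `x₀`.
  let D : ℕ → ℝ := fun k => f (i (p k z)) (u (p k z')) - f (i (p k z)) (u (p k z))
  have hD : g z' - g z = ∑ k ∈ Finset.range n, (D (k + 1) - D k) := by
    simp only [g, D]
    rw [← Finset.sum_sub_distrib]
    refine Finset.sum_congr rfl fun k hk => ?_
    have hk' : k ≤ n := (Finset.mem_range.1 hk).le
    have hk1 : k + 1 ≤ n := Finset.mem_range.1 hk
    have a1 := hpK k hk' z hz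
    have a2 := hpK k hk' z' hz'
    have a3 := hpK (k + 1) hk1 z hz
    have a4 := hpK (k + 1) hk1 z' hz'
    have d1 := hstep k z hz
    have d2 := hstep k z' hz'
    have d3 := hclose k hk' z' z hd
    have d4 := hclose (k + 1) hk1 z' z hd
    have t1 : dist (p (k + 1) z') (p k z) < δ :=
      lt_of_le_of_lt (dist_triangle _ (p (k + 1) z) _) (by linarith)
    have e1 := hcons _ a1 _ a2 _ a2 _ a4 (by linarith) t1 (by simpa using hδ) (by linarith)
    have e2 := hcons _ a1 _ a3 _ a3 _ a4 (by linarith) t1 (by simpa using hδ) (by linarith)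
    linarith
  rw [hD, Finset.sum_range_sub]
  simp [D, hpn, p]

/-- The unit square. -/
def unitSquare : Set (ℝ × ℝ) := Set.Icc 0 1 ×ˢ Set.Icc 0 1

lemma isCompact_unitSquare : IsCompact unitSquare := isCompact_Icc.prod isCompact_Icc

lemma convex_unitSquare : Convex ℝ unitSquare := (convex_Icc 0 1).prod (convex_Icc 0 1)

/-- The integral of a closed `1`-form along a loop is invariant under homotopies of loops. -/
lemma Form.IsClosed.loopIntegral_eq_of_homotopy {β : Form m M 1} (hβ : β.IsClosed) {u : ℝ × ℝ → M}
    (hu : ContMDiff 𝓘(ℝ, ℝ × ℝ) (𝓡 m) ∞ u) (hper : ∀ t, u (t, 1) = u (t, 0)) {a : ℝ}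
    (ha : a ∈ Set.Icc (0 : ℝ) 1) :
    loopIntegral β (fun s => u (a, s)) = loopIntegral β (fun s => u (0, s)) := by
  obtain ⟨g, hg⟩ := hβ.exists_isLocalPrimitive isCompact_unitSquare convex_unitSquare
    hu.continuous.continuousOn
  have h0 : (0 : ℝ) ∈ Set.Icc (0 : ℝ) 1 := by simp
  have h1 : (1 : ℝ) ∈ Set.Icc (0 : ℝ) 1 := by simp
  have hI : ∀ b ∈ Set.Icc (0 : ℝ) 1, loopIntegral β (fun s => u (b, s)) = g (b, 1) - g (b, 0) := by
    intro b hb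
    have hq : ContDiff ℝ ∞ fun s : ℝ => (b, s) := contDiff_const.prodMk contDiff_id
    exact IsLocalPrimitive.integral_eq hβ.1
      (hg.comp (q := fun s : ℝ => (b, s)) hq.continuous.continuousOn fun s hs => ⟨hb, hs⟩)
      (hu.comp hq.contMDiff)
  have hside : ∀ s ∈ Set.Icc (0 : ℝ) 1, IsLocalPrimitive β (Set.Icc (0 : ℝ) 1) (fun t => u (t, s))
      (fun t => g (t, s)) := fun s hs =>
    hg.comp (q := fun t : ℝ => (t, s)) (by fun_prop) fun t ht => ⟨ht, hs⟩
  -- The sides s = 0 and s = 1 of the square trace the same path, so the primitive has the same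
  -- increment along both.
  have h2 := (hside 1 h1).sub_eq_sub (hside 0 h0) (fun t _ => hper t)
    (hu.continuous.comp (by fun_prop : Continuous fun t : ℝ => (t, (1 : ℝ)))).continuousOn
    isPreconnected_Icc ha h0
  rw [hI a ha, hI 0 h0]
  linarith

lemma isLocalPrimitive_const (β : Form m M 1) (hβ : β.IsClosed) (K : Set Y) (x : M) (c : ℝ) :
    IsLocalPrimitive β K (fun _ => x) (fun _ => c) := fun z hz => by
  obtain ⟨f, N, hN, hf⟩ := hβ.exists_isPrimitiveOn x
  exact ⟨f, N, hf, hN, by simp⟩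

/-- The segment parametrization of the standard `1`-simplex by a real number. -/
def simplexSegment (t : ℝ) : stdSimplex ℝ (Fin 2) :=
  stdSimplexHomeomorphUnitInterval.symm (Set.projIcc 0 1 zero_le_one t)

lemma continuous_simplexSegment : Continuous simplexSegment :=
  stdSimplexHomeomorphUnitInterval.symm.continuous.comp continuous_projIcc

lemma coe_simplexSegment {t : ℝ} (ht : t ∈ Set.Icc (0 : ℝ) 1) :
    (simplexSegment t : Fin 2 → ℝ) = ![1 - t, t] := by
  rw [simplexSegment, Set.projIcc_of_mem _ ht]
  funext i
  fin_cases i <;> rfl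

lemma Form.IsClosed.exists_isLocalPrimitive_simplex {β : Form m M 1} (hβ : β.IsClosed)
    (τ : C(stdSimplex ℝ (Fin 2), M)) :
    ∃ g, IsLocalPrimitive β (Set.Icc (0 : ℝ) 1) (τ ∘ simplexSegment) g :=
  hβ.exists_isLocalPrimitive isCompact_Icc (convex_Icc 0 1)
    (τ.continuous.comp continuous_simplexSegment).continuousOn

/-- The integral of a closed form over a singular `1`-simplex. -/
def simplexIntegral {β : Form m M 1} (hβ : β.IsClosed) (τ : C(stdSimplex ℝ (Fin 2), M)) : ℝ :=
  (hβ.exists_isLocalPrimitive_simplex τ).choose 1 - (hβ.exists_isLocalPrimitive_simplex τ).choose 0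

lemma simplexIntegral_eq {β : Form m M 1} (hβ : β.IsClosed) (τ : C(stdSimplex ℝ (Fin 2), M))
    {u : ℝ → M} {g : ℝ → ℝ} (hg : IsLocalPrimitive β (Set.Icc (0 : ℝ) 1) u g)
    (hu : ∀ t ∈ Set.Icc (0 : ℝ) 1, u t = τ (simplexSegment t)) : simplexIntegral hβ τ = g 1 - g 0 :=
  (hβ.exists_isLocalPrimitive_simplex τ).choose_spec.sub_eq_sub hg (fun t ht => (hu t ht).symm)
    (τ.continuous.comp continuous_simplexSegment).continuousOn isPreconnected_Icc (by simp) (by simp)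

/-- A parametrization of the standard triangle by the unit square. -/
def squareToTriangle (z : unitSquare) : stdSimplex ℝ (Fin 3) :=
  -- The side where the first coordinate is 0 collapses to the vertex 0; the other three sides
  -- parametrize the three faces.
  ⟨![1 - z.1.1, z.1.1 * (1 - z.1.2), z.1.1 * z.1.2], by
    obtain ⟨⟨s, t⟩, ⟨hs0, hs1⟩, ⟨ht0, ht1⟩⟩ := z
    simp only at hs0 hs1 ht0 ht1
    constructor
    · intro i
      fin_cases i
      · simpa using hs1
      · simpa using mul_nonneg hs0 (sub_nonneg.2 ht1)
      · simpa using mul_nonneg hs0 ht0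
    · simp [Fin.sum_univ_three]
      ring⟩

lemma continuous_squareToTriangle : Continuous squareToTriangle := by
  refine Continuous.subtype_mk (continuous_pi fun i => ?_) _
  fin_cases i <;> simp <;> fun_prop

lemma coe_map_succAbove (i : Fin 3) (z : stdSimplex ℝ (Fin 2)) (j : Fin 3) :
    (stdSimplex.map (Fin.succAbove i) z : Fin 3 → ℝ) j =
      ∑ k : Fin 2, if i.succAbove k = j then (z : Fin 2 → ℝ) k else 0 := by
  rw [stdSimplex.map_coe, FunOnFinite.linearMap_apply_apply, Finset.sum_filter]

/-- Pulled back to the square, the form has a single-valued local primitive, whose increments around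
the boundary add up to zero. -/
lemma simplexIntegral_boundary {β : Form m M 1} (hβ : β.IsClosed) (τ : C(stdSimplex ℝ (Fin 3), M)) :
    simplexIntegral hβ (τ.comp ⟨stdSimplex.map (Fin.succAbove 0), stdSimplex.continuous_map _⟩)
    - simplexIntegral hβ (τ.comp ⟨stdSimplex.map (Fin.succAbove 1), stdSimplex.continuous_map _⟩)
    + simplexIntegral hβ (τ.comp ⟨stdSimplex.map (Fin.succAbove 2), stdSimplex.continuous_map _⟩) = 0 := by
  classical
  let x₀ := τ (squareToTriangle ⟨(0, 0), by simp [unitSquare]⟩)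
  -- The value off the square is arbitrary; only continuity on the square matters.
  let u : ℝ × ℝ → M := fun z => if h : z ∈ unitSquare then τ (squareToTriangle ⟨z, h⟩) else x₀
  have hu : ContinuousOn u unitSquare := by
    rw [continuousOn_iff_continuous_domRestrict]
    refine (τ.continuous.comp continuous_squareToTriangle).congr fun z => ?_
    simp [u]
  obtain ⟨g, hg⟩ := hβ.exists_isLocalPrimitive isCompact_unitSquare convex_unitSquare hu
  have hedge : ∀ (i : Fin 3) (q : ℝ → ℝ × ℝ), Continuous q → (hq : Set.MapsTo q (Set.Icc 0 1) unitSquare) →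
      (∀ t (ht : t ∈ Set.Icc (0 : ℝ) 1), (squareToTriangle ⟨q t, hq ht⟩ : Fin 3 → ℝ) =
        stdSimplex.map (Fin.succAbove i) (simplexSegment t)) →
      simplexIntegral hβ (τ.comp ⟨stdSimplex.map (Fin.succAbove i), stdSimplex.continuous_map _⟩) =
        g (q 1) - g (q 0) := by
    intro i q hqc hq heq
    refine simplexIntegral_eq hβ _ (hg.comp hqc.continuousOn hq) fun t ht => ?_
    have : squareToTriangle ⟨q t, hq ht⟩ = stdSimplex.map (Fin.succAbove i) (simplexSegment t) :=
      Subtype.ext (heq t ht)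
    simp [u, hq ht, this]
  rw [hedge 0 (fun t => (1, t)) (by fun_prop) (fun t ht => ⟨by simp, ht⟩)
      (fun t ht => by
        funext j
        rw [coe_map_succAbove, coe_simplexSegment ht]
        fin_cases j <;> simp [squareToTriangle, Fin.sum_univ_two] <;> rfl),
    hedge 1 (fun t => (t, 1)) (by fun_prop) (fun t ht => ⟨ht, by simp⟩)
      (fun t ht => by
        funext j
        rw [coe_map_succAbove, coe_simplexSegment ht]
        fin_cases j <;> simp [squareToTriangle, Fin.sum_univ_two, Fin.succAbove] <;> rfl),
    hedge 2 (fun t => (t, 0)) (by fun_prop) (fun t ht => ⟨ht, by simp⟩)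
      (fun t ht => by
        funext j
        rw [coe_map_succAbove, coe_simplexSegment ht]
        fin_cases j <;> simp [squareToTriangle, Fin.sum_univ_two, Fin.succAbove] <;> rfl)]
  -- The fourth side of the square is a constant path and contributes nothing.
  have h3 := (hg.comp (q := fun t : ℝ => (0, t)) (K' := Set.Icc 0 1) (by fun_prop)
    (fun t ht => ⟨by simp, ht⟩)).sub_eq_sub (isLocalPrimitive_const β hβ (Set.Icc 0 1) x₀ 0)
    (fun t ht => by
      have : ((0 : ℝ), t) ∈ unitSquare := ⟨by simp, ht⟩
      simp only [Function.comp_apply, u, this, dite_true, x₀]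
      congr 1
      exact Subtype.ext (by simp [squareToTriangle]))
    (hu.comp (by fun_prop) fun t ht => ⟨by simp, ht⟩) isPreconnected_Icc
    (z := 0) (z' := 1) (by simp) (by simp)
  simp only [Function.comp_apply] at h3
  linarith

/-- The integral of a closed form along a smooth loop vanishes if the loop is null-homologous. -/
lemma Form.IsClosed.loopIntegral_eq_zero {β : Form m M 1} (hβ : β.IsClosed) {c : ℝ → M}
    (hc : ContMDiff 𝓘(ℝ, ℝ) (𝓡 m) ∞ c) {x : M} (P : Path x x)
    (hP : ∀ t : unitInterval, P t = c t) (h0 : IsNullHomologous P) : loopIntegral β c = 0 := by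
  have h := cochain_apply_eq_zero_of_isNullHomologous P (simplexIntegral hβ)
    (simplexIntegral_boundary hβ) h0
  obtain ⟨g, hg⟩ := hβ.exists_isLocalPrimitive isCompact_Icc (convex_Icc (0 : ℝ) 1)
    hc.continuous.continuousOn
  rw [hg.integral_eq hβ.1 hc]
  refine (simplexIntegral_eq hβ _ hg fun t ht => ?_).symm.trans h
  simp [simplexSegment, Set.projIcc_of_mem _ ht, hP]

end Primitives

/-! ### Contraction of a closed 2-form with a symplectic vector field -/

section Contraction

variable {m : ℕ} {M : Type u} [TopologicalSpace M] [ChartedSpace (EuclideanSpace ℝ (Fin m)) M]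
variable {k : ℕ} {W : Type*} [NormedAddCommGroup W] [NormedSpace ℝ W]

lemma Form.congr_apply (α : Form m M k) {x x' : M} (h : x = x') {v v' : Fin k → EuclideanSpace ℝ (Fin m)}
    (hv : v = v') : (α x : (EuclideanSpace ℝ (Fin m)) [⋀^Fin k]→L[ℝ] ℝ) v =
      (α x' : (EuclideanSpace ℝ (Fin m)) [⋀^Fin k]→L[ℝ] ℝ) v' := by
  subst h; subst hv; rfl

lemma pb_apply (α : Form m M k) (u : W → M) (z : W) (v : Fin k → W) :
    pb α u z v = (α (u z) : (EuclideanSpace ℝ (Fin m)) [⋀^Fin k]→L[ℝ] ℝ)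
      fun i => (mfderiv 𝓘(ℝ, W) (𝓡 m) u z (v i) : EuclideanSpace ℝ (Fin m)) := rfl

lemma pb_pullback (α : Form m M k) {f : M → M} {u : W → M} {z : W}
    (hf : MDifferentiableAt (𝓡 m) (𝓡 m) f (u z)) (hu : MDifferentiableAt 𝓘(ℝ, W) (𝓡 m) u z) :
    pb α (f ∘ u) z = pb (Form.pullback f α) u z := by
  unfold pb
  rw [mfderiv_comp z hf hu]
  rfl

/-- Contraction of a `2`-form with a vector field. -/
def Form.contract (Ω : Form m M 2) (X : M → EuclideanSpace ℝ (Fin m)) : Form m M 1 := fun x =>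
  ContinuousAlternatingMap.curryLeft (Ω x : (EuclideanSpace ℝ (Fin m)) [⋀^Fin 2]→L[ℝ] ℝ) (X x)

lemma Form.contract_apply (Ω : Form m M 2) (X : M → EuclideanSpace ℝ (Fin m)) (x : M)
    (v : Fin 1 → EuclideanSpace ℝ (Fin m)) :
    (Ω.contract X x : (EuclideanSpace ℝ (Fin m)) [⋀^Fin 1]→L[ℝ] ℝ) v =
      (Ω x : (EuclideanSpace ℝ (Fin m)) [⋀^Fin 2]→L[ℝ] ℝ) ![X x, v 0] := by
  refine (ContinuousAlternatingMap.curryLeft_apply_apply _ _ _).trans ?_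
  refine Form.congr_apply Ω rfl ?_
  funext i
  fin_cases i <;> rfl

variable [IsManifold (𝓡 m) ∞ M]

/-- The contraction of a closed form with the velocity field of a family of maps preserving it
is closed. -/
lemma Form.IsClosed.contract_velocity {Ω : Form m M 2} (hΩ : Ω.IsClosed) {ψ : ℝ × M → M}
    (hψ : ContMDiff (𝓘(ℝ, ℝ).prod (𝓡 m)) (𝓡 m) ∞ ψ)
    (hpres : ∀ s, Form.pullback (fun x => ψ (s, x)) Ω = Ω) (h0 : ∀ x, ψ (0, x) = x) :
    (Ω.contract fun x => mfderiv 𝓘(ℝ, ℝ) (𝓡 m) (fun s => ψ (s, x)) 0 (1 : ℝ)).IsClosed := by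
  set a := Ω.contract fun x => mfderiv 𝓘(ℝ, ℝ) (𝓡 m) (fun s => ψ (s, x)) 0 (1 : ℝ) with ha
  set E := EuclideanSpace ℝ (Fin m)
  -- Cartan's formula is avoided by pulling Ω back under u(s, y) = ψ_s(y) on the product of time and
  -- a chart. The contraction is u*Ω(∂_s, ·) at s = 0, and on each slice u*Ω restricts to the chart
  -- expression of Ω, independently of s.
  have main : ∀ x₀ : M, ∀ y ∈ (extChartAt (𝓡 m) x₀).target,
      let u : ℝ × E → M := fun p => ψ (p.1, (extChartAt (𝓡 m) x₀).symm p.2)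
      (∀ s, ContMDiffAt 𝓘(ℝ, ℝ × E) (𝓡 m) ∞ u (s, y)) ∧
      (∀ v, a.inChart x₀ y v = pb Ω u (0, y) ![(1, 0), (0, v 0)]) ∧
      (∀ s v w, pb Ω u (s, y) ![(0, v), (0, w)] = Ω.inChart x₀ y ![v, w]) := by
    intro x₀ y hy u
    have hu : ∀ s, ContMDiffAt 𝓘(ℝ, ℝ × E) (𝓡 m) ∞ u (s, y) := fun s => by
      refine (hψ.contMDiffAt).comp (s, y) (ContMDiffAt.prodMk ?_ ?_)
      · exact contDiff_fst.contMDiff.contMDiffAt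
      · exact (contMDiffAt_extChartAt_symm hy).comp (s, y) contDiff_snd.contMDiff.contMDiffAt
    have hslice : ∀ s, pb Ω (u ∘ fun y => (s, y)) y = Ω.inChart x₀ y := fun s => by
      have := pb_pullback Ω (f := fun x => ψ (s, x)) (u := (extChartAt (𝓡 m) x₀).symm) (z := y)
        ((hψ.comp (contMDiff_const.prodMk contMDiff_id)).mdifferentiable (by simp) _)
        (mdifferentiableAt_extChartAt_symm hy)
      rw [hpres] at this
      exact this
    have hsl : ∀ s, HasFDerivAt (fun y : E => (s, y)) (ContinuousLinearMap.inr ℝ ℝ E) y := fun s =>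
      hasFDerivAt_prodMk_right s y
    refine ⟨hu, fun v => ?_, fun s v w => ?_⟩
    · have e1 : mfderiv 𝓘(ℝ, E) (𝓡 m) (extChartAt (𝓡 m) x₀).symm y (v 0) =
          (mfderiv 𝓘(ℝ, ℝ × E) (𝓡 m) u (0, y) ((0 : ℝ), v 0) : E) := by
        have h1 : (extChartAt (𝓡 m) x₀).symm = u ∘ fun y => ((0 : ℝ), y) := by
          funext y'; exact (h0 _).symm
        have h2 := mfderiv_comp y ((hu 0).mdifferentiableAt (by simp)) (hsl 0).differentiableAt.mdifferentiableAt
        rw [mfderiv_eq_fderiv, (hsl 0).fderiv] at h2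
        have h3 : ∀ f g : E → M, f = g → (mfderiv 𝓘(ℝ, E) (𝓡 m) f y : E →L[ℝ] E) = mfderiv 𝓘(ℝ, E) (𝓡 m) g y := by
          rintro f _ rfl; rfl
        exact congrArg (fun L : E →L[ℝ] E => L (v 0)) ((h3 _ _ h1).trans h2)
      have e2 : mfderiv 𝓘(ℝ, ℝ) (𝓡 m) (fun s => ψ (s, (extChartAt (𝓡 m) x₀).symm y)) 0 (1 : ℝ) =
          (mfderiv 𝓘(ℝ, ℝ × E) (𝓡 m) u (0, y) ((1 : ℝ), (0 : E)) : E) := by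
        have hl : HasFDerivAt (fun s : ℝ => (s, y)) (ContinuousLinearMap.inl ℝ ℝ E) 0 :=
          hasFDerivAt_prodMk_left 0 y
        have h2 := mfderiv_comp 0 ((hu 0).mdifferentiableAt (by simp)) hl.differentiableAt.mdifferentiableAt
        rw [mfderiv_eq_fderiv, hl.fderiv] at h2
        exact congrArg (fun L : ℝ →L[ℝ] E => L 1) h2
      change (Ω.contract (fun x => mfderiv 𝓘(ℝ, ℝ) (𝓡 m) (fun s => ψ (s, x)) 0 (1 : ℝ))
        ((extChartAt (𝓡 m) x₀).symm y) : E [⋀^Fin 1]→L[ℝ] ℝ)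
        (fun i => (mfderiv 𝓘(ℝ, E) (𝓡 m) (extChartAt (𝓡 m) x₀).symm y (v i) : E)) = _
      refine (Form.contract_apply Ω (fun x => mfderiv 𝓘(ℝ, ℝ) (𝓡 m) (fun s => ψ (s, x)) 0 (1 : ℝ))
        ((extChartAt (𝓡 m) x₀).symm y)
        (fun i => (mfderiv 𝓘(ℝ, E) (𝓡 m) (extChartAt (𝓡 m) x₀).symm y (v i) : E))).trans ?_
      rw [pb_apply]
      refine Form.congr_apply Ω (h0 _).symm ?_
      funext i
      fin_cases i
      · exact e2
      · exact e1
    · rw [← hslice s, pb_comp Ω ((hu s).mdifferentiableAt (by simp)) (hsl s).differentiableAt, (hsl s).fderiv]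
      rw [ContinuousAlternatingMap.compContinuousLinearMap_apply]
      congr 1
      funext i
      fin_cases i <;> rfl
  have hsmooth : a.IsSmooth := by
    intro x₀ y hy
    obtain ⟨hu, h1, -⟩ := main x₀ y hy
    refine ContDiffAt.contDiffWithinAt (contDiffAt_alternating_of_apply fun v => ?_)
    have h2 : (fun y' => a.inChart x₀ y' v) =ᶠ[nhds y] fun y' =>
        pb Ω (fun p : ℝ × E => ψ (p.1, (extChartAt (𝓡 m) x₀).symm p.2)) (0, y') ![(1, 0), (0, v 0)] := by
      filter_upwards [(isOpen_extChartAt_target (I := 𝓡 m) x₀).mem_nhds hy] with y' hy'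
      exact (main x₀ y' hy').2.1 v
    refine ContDiffAt.congr_of_eventuallyEq ?_ h2
    exact contDiffAt_alternating_apply ((hΩ.1.contDiffAt_pb (hu 0)).comp y
      (contDiff_const.prodMk contDiff_id).contDiffAt) fun i => contDiffAt_const
  refine ⟨hsmooth, fun x₀ y hy => ?_⟩
  obtain ⟨hu, -, -⟩ := main x₀ y hy
  set u : ℝ × E → M := fun p => ψ (p.1, (extChartAt (𝓡 m) x₀).symm p.2) with hudef
  have hP := hΩ.1.contDiffAt_pb (hu 0)
  -- d(u*Ω) = 0 is evaluated on (∂_s, v₀, v₁). The s-derivative of u*Ω(v₀, v₁) vanishes by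
  -- invariance, and the two remaining terms make up d of the contraction.
  have hd : extDeriv (pb Ω u) (0, y) = 0 := by
    rw [hΩ.2.extDeriv_pb hΩ.1 (hu 0)]; rfl
  have hPd := hP.differentiableAt (by simp)
  rw [Form.inChart_zero]
  ext v
  rw [extDeriv_apply (hsmooth.differentiableAt x₀ hy), Fin.sum_univ_two]
  have h3 := congrArg (fun A => A ![(1, 0), (0, v 0), (0, v 1)]) hd
  simp only [extDeriv_apply hPd] at h3
  have h3' := (Fin.sum_univ_three _).symm.trans h3
  have r0 : Fin.removeNth 0 ![((1 : ℝ), (0 : E)), (0, v 0), (0, v 1)] = ![(0, v 0), (0, v 1)] := by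
    funext i; fin_cases i <;> rfl
  have r1 : Fin.removeNth 1 ![((1 : ℝ), (0 : E)), (0, v 0), (0, v 1)] = ![(1, 0), (0, v 1)] := by
    funext i; fin_cases i <;> rfl
  have r2 : Fin.removeNth 2 ![((1 : ℝ), (0 : E)), (0, v 0), (0, v 1)] = ![(1, 0), (0, v 0)] := by
    funext i; fin_cases i <;> rfl
  simp only [r0, r1, r2] at h3'
  have hPv : ∀ w, DifferentiableAt ℝ (fun p => pb Ω u p w) (0, y) := fun w =>
    (contDiffAt_alternating_apply hP (fun i => contDiffAt_const (c := w i))).differentiableAt (by simp)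
  have d0 : fderiv ℝ (fun p => pb Ω u p ![(0, v 0), (0, v 1)]) (0, y) (1, 0) = 0 := by
    have hl : HasFDerivAt (fun s : ℝ => (s, y)) (ContinuousLinearMap.inl ℝ ℝ E) 0 :=
      hasFDerivAt_prodMk_left 0 y
    have h4 := ((hPv ![(0, v 0), (0, v 1)]).hasFDerivAt.comp 0 hl)
    have h5 : ((fun p => pb Ω u p ![(0, v 0), (0, v 1)]) ∘ fun s : ℝ => (s, y)) =
        fun _ => Ω.inChart x₀ y ![v 0, v 1] := by
      funext s; exact (main x₀ y hy).2.2 s (v 0) (v 1)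
    rw [h5] at h4
    have h6 := h4.unique (hasFDerivAt_const _ _)
    simpa using congrArg (fun L : ℝ →L[ℝ] ℝ => L 1) h6
  have d1 : ∀ (i : Fin 2) (w : E), fderiv ℝ (fun y' => a.inChart x₀ y' (i.removeNth v)) y w =
      fderiv ℝ (fun p => pb Ω u p ![(1, 0), (0, (i.removeNth v) 0)]) (0, y) (0, w) := by
    intro i w
    have h4 : (fun y' => a.inChart x₀ y' (i.removeNth v)) =ᶠ[nhds y]
        (fun p => pb Ω u p ![(1, 0), (0, (i.removeNth v) 0)]) ∘ fun y' : E => ((0 : ℝ), y') := by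
      filter_upwards [(isOpen_extChartAt_target (I := 𝓡 m) x₀).mem_nhds hy] with y' hy'
      exact (main x₀ y' hy').2.1 _
    rw [h4.fderiv_eq, ((hPv _).hasFDerivAt.comp y (hasFDerivAt_prodMk_right (0 : ℝ) y)).fderiv]
    rfl
  rw [d1, d1]
  have q0 : Fin.removeNth (0 : Fin 2) v 0 = v 1 := rfl
  have q1 : Fin.removeNth (1 : Fin 2) v 0 = v 0 := rfl
  rw [q0, q1]
  simp at h3' ⊢
  linarith [h3', d0]

end Contraction

/-! ### Densities and quotients of top forms -/

section VolumeForm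

open MeasureTheory

variable {m : ℕ} {M : Type u} [TopologicalSpace M] [ChartedSpace (EuclideanSpace ℝ (Fin m)) M]

/-- The standard basis of Euclidean space. -/
def stdB (m : ℕ) : Module.Basis (Fin m) ℝ (EuclideanSpace ℝ (Fin m)) :=
  (EuclideanSpace.basisFun (Fin m) ℝ).toBasis

lemma top_eq_smul_det (A : (EuclideanSpace ℝ (Fin m)) [⋀^Fin m]→L[ℝ] ℝ) (v : Fin m → EuclideanSpace ℝ (Fin m)) :
    A v = A (stdB m) * (stdB m).det v :=
  congrArg (fun B => B v) (A.toAlternatingMap.eq_smul_basis_det (stdB m))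

lemma top_comp_stdB (A : (EuclideanSpace ℝ (Fin m)) [⋀^Fin m]→L[ℝ] ℝ)
    (L : EuclideanSpace ℝ (Fin m) →L[ℝ] EuclideanSpace ℝ (Fin m)) :
    A.compContinuousLinearMap L (stdB m) = L.det * A (stdB m) := by
  rw [ContinuousAlternatingMap.compContinuousLinearMap_apply, top_eq_smul_det]
  have := (stdB m).det_comp (L : EuclideanSpace ℝ (Fin m) →ₗ[ℝ] EuclideanSpace ℝ (Fin m)) (stdB m)
  rw [Module.Basis.det_self, mul_one] at this
  rw [mul_comm]
  exact congrArg (· * A (stdB m)) this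

lemma top_ne_zero_iff (A : (EuclideanSpace ℝ (Fin m)) [⋀^Fin m]→L[ℝ] ℝ) : A (stdB m) = 0 ↔ A = 0 :=
  ⟨fun h => by ext v; rw [top_eq_smul_det, h]; simp, fun h => by rw [h]; rfl⟩

/-- The density of a top form in a chart. -/
def Form.dens (τ : Form m M m) (x₀ : M) (y : EuclideanSpace ℝ (Fin m)) : ℝ := τ.inChart x₀ y (stdB m)

/-- The quotient of two top forms. -/
def Form.ratio (τ ν : Form m M m) (x : M) : ℝ :=
  (τ x : (EuclideanSpace ℝ (Fin m)) [⋀^Fin m]→L[ℝ] ℝ) (stdB m) /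
    (ν x : (EuclideanSpace ℝ (Fin m)) [⋀^Fin m]→L[ℝ] ℝ) (stdB m)

/-- A smooth top form without zeros. -/
structure IsVolumeForm (ν : Form m M m) : Prop where
  smooth : ν.IsSmooth
  ne_zero : ∀ x, (ν x : (EuclideanSpace ℝ (Fin m)) [⋀^Fin m]→L[ℝ] ℝ) ≠ 0

lemma Form.dens_eq (τ : Form m M m) (x₀ : M) (y : EuclideanSpace ℝ (Fin m)) :
    τ.dens x₀ y = ContinuousLinearMap.det (M := EuclideanSpace ℝ (Fin m))
        (mfderiv 𝓘(ℝ, EuclideanSpace ℝ (Fin m)) (𝓡 m) (extChartAt (𝓡 m) x₀).symm y) *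
      (τ ((extChartAt (𝓡 m) x₀).symm y) : (EuclideanSpace ℝ (Fin m)) [⋀^Fin m]→L[ℝ] ℝ) (stdB m) :=
  top_comp_stdB (τ ((extChartAt (𝓡 m) x₀).symm y)) _

/-- Both forms acquire the same Jacobian factor in the chart, so the quotient is independent of the
chart. -/
lemma IsVolumeForm.ratio_mul {ν : Form m M m} (hν : IsVolumeForm ν) (τ : Form m M m) (x₀ : M)
    (y : EuclideanSpace ℝ (Fin m)) :
    τ.ratio ν ((extChartAt (𝓡 m) x₀).symm y) * ν.dens x₀ y = τ.dens x₀ y := by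
  have h : (ν ((extChartAt (𝓡 m) x₀).symm y) : (EuclideanSpace ℝ (Fin m)) [⋀^Fin m]→L[ℝ] ℝ) (stdB m) ≠ 0 :=
    fun h => hν.ne_zero _ ((top_ne_zero_iff _).1 h)
  rw [Form.dens_eq, Form.dens_eq, Form.ratio]
  field_simp

variable [IsManifold (𝓡 m) ∞ M]

lemma Form.IsSmooth.contDiffAt_dens {τ : Form m M m} (hτ : τ.IsSmooth) {x₀ : M}
    {y : EuclideanSpace ℝ (Fin m)} (hy : y ∈ (extChartAt (𝓡 m) x₀).target) :
    ContDiffAt ℝ ∞ (τ.dens x₀) y :=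
  contDiffAt_alternating_apply (hτ.contDiffAt_inChart hy) fun _ => contDiffAt_const

lemma Form.IsSmooth.continuousOn_dens {τ : Form m M m} (hτ : τ.IsSmooth) (x₀ : M) :
    ContinuousOn (τ.dens x₀) (extChartAt (𝓡 m) x₀).target := fun _ hy =>
  (hτ.contDiffAt_dens hy).continuousAt.continuousWithinAt

/-- A map `f` preserving `ν` transforms the chart densities by the Jacobian of its chart expression. -/
lemma dens_change {ν : Form m M m} {f : M → M} (hf : ContMDiff (𝓡 m) (𝓡 m) ∞ f)
    (hfν : Form.pullback f ν = ν) {x₀ x₁ : M} {y : EuclideanSpace ℝ (Fin m)}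
    (hy : y ∈ (extChartAt (𝓡 m) x₀).target)
    (hy' : f ((extChartAt (𝓡 m) x₀).symm y) ∈ (extChartAt (𝓡 m) x₁).source) :
    ν.dens x₀ y = (fderiv ℝ (extChartAt (𝓡 m) x₁ ∘ f ∘ (extChartAt (𝓡 m) x₀).symm) y).det *
      ν.dens x₁ ((extChartAt (𝓡 m) x₁ ∘ f ∘ (extChartAt (𝓡 m) x₀).symm) y) := by
  have hu : ContMDiffAt 𝓘(ℝ, EuclideanSpace ℝ (Fin m)) (𝓡 m) ∞ (f ∘ (extChartAt (𝓡 m) x₀).symm) y :=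
    hf.contMDiffAt.comp y (contMDiffAt_extChartAt_symm hy)
  have h1 := pb_eq_inChart ν (hu.mdifferentiableAt (by simp)) hy'
  rw [pb_pullback ν (hf.mdifferentiable (by simp) _) (mdifferentiableAt_extChartAt_symm hy), hfν] at h1
  have h2 := congrArg (fun A => A (stdB m)) h1
  exact h2.trans (top_comp_stdB _ _)

lemma det_ne_zero_of_comp_eq_id {E : Type*} [NormedAddCommGroup E] [NormedSpace ℝ E] (L L' : E →L[ℝ] E)
    (h : L'.comp L = ContinuousLinearMap.id ℝ E) : L.det ≠ 0 := by
  intro h0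
  have h1 := LinearMap.det_comp (L' : E →ₗ[ℝ] E) (L : E →ₗ[ℝ] E)
  have h2 : ((L' : E →ₗ[ℝ] E).comp (L : E →ₗ[ℝ] E)) = LinearMap.id := by
    ext x; exact congrArg (fun B : E →L[ℝ] E => B x) h
  rw [h2, LinearMap.det_id] at h1
  have h3 : LinearMap.det (L : E →ₗ[ℝ] E) = 0 := h0
  rw [h3, mul_zero] at h1
  exact one_ne_zero h1

lemma IsVolumeForm.dens_ne_zero {ν : Form m M m} (hν : IsVolumeForm ν) {x₀ : M}
    {y : EuclideanSpace ℝ (Fin m)} (hy : y ∈ (extChartAt (𝓡 m) x₀).target) : ν.dens x₀ y ≠ 0 := by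
  intro h
  have hx := (extChartAt (𝓡 m) x₀).map_target hy
  have hid : MDifferentiableAt (𝓡 m) 𝓘(ℝ, EuclideanSpace ℝ (Fin m)) (extChartAt (𝓡 m) x₀)
      ((extChartAt (𝓡 m) x₀).symm y) := by
    rw [extChartAt_source] at hx
    exact mdifferentiableAt_extChartAt hx
  have h2 := (hid.hasMFDerivAt.comp y (mdifferentiableAt_extChartAt_symm hy).hasMFDerivAt)
  have h3 : (extChartAt (𝓡 m) x₀ ∘ (extChartAt (𝓡 m) x₀).symm) =ᶠ[nhds y] id := by
    filter_upwards [(isOpen_extChartAt_target x₀).mem_nhds hy] with z hz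
    exact (extChartAt (𝓡 m) x₀).right_inv hz
  let L : EuclideanSpace ℝ (Fin m) →L[ℝ] EuclideanSpace ℝ (Fin m) :=
    mfderiv 𝓘(ℝ, EuclideanSpace ℝ (Fin m)) (𝓡 m) (extChartAt (𝓡 m) x₀).symm y
  let L' : EuclideanSpace ℝ (Fin m) →L[ℝ] EuclideanSpace ℝ (Fin m) :=
    mfderiv (𝓡 m) 𝓘(ℝ, EuclideanSpace ℝ (Fin m)) (extChartAt (𝓡 m) x₀) ((extChartAt (𝓡 m) x₀).symm y)
  have h4 : HasFDerivAt (id : EuclideanSpace ℝ (Fin m) → EuclideanSpace ℝ (Fin m)) (L'.comp L) y :=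
    (HasMFDerivAt.hasFDerivAt h2).congr_of_eventuallyEq h3.symm
  rw [Form.dens_eq] at h
  rcases mul_eq_zero.1 h with h5 | h5
  · exact det_ne_zero_of_comp_eq_id L L' (h4.unique (hasFDerivAt_id y)) h5
  · exact hν.ne_zero _ ((top_ne_zero_iff _).1 h5)

end VolumeForm

/-! ### The measure of a volume form -/

section VolumeMeasure

open MeasureTheory

variable {m : ℕ} {M : Type u} [TopologicalSpace M] [ChartedSpace (EuclideanSpace ℝ (Fin m)) M]
  [IsManifold (𝓡 m) ∞ M] [MeasurableSpace M] [BorelSpace M]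

/-- The inverse of the chart at `x₀`, constant outside its domain. -/
def chartInv (x₀ : M) (y : EuclideanSpace ℝ (Fin m)) : M :=
  open Classical in
  (extChartAt (𝓡 m) x₀).target.piecewise (extChartAt (𝓡 m) x₀).symm (fun _ => x₀) y

lemma chartInv_eq {x₀ : M} {y : EuclideanSpace ℝ (Fin m)} (hy : y ∈ (extChartAt (𝓡 m) x₀).target) :
    chartInv x₀ y = (extChartAt (𝓡 m) x₀).symm y := by
  classical
  exact Set.piecewise_eq_of_mem _ _ _ hy

lemma measurable_chartInv (x₀ : M) : Measurable (chartInv (m := m) x₀) := by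
  classical
  exact ContinuousOn.measurable_piecewise (continuousOn_extChartAt_symm x₀) continuousOn_const
    (isOpen_extChartAt_target x₀).measurableSet

lemma image_chart_eq {x₀ : M} {A : Set M} (hA : A ⊆ (extChartAt (𝓡 m) x₀).source) :
    extChartAt (𝓡 m) x₀ '' A = (extChartAt (𝓡 m) x₀).target ∩ chartInv x₀ ⁻¹' A := by
  rw [(extChartAt (𝓡 m) x₀).image_eq_target_inter_inv_preimage hA]
  ext y
  constructor
  · rintro ⟨h1, h2⟩; exact ⟨h1, by rwa [Set.mem_preimage, chartInv_eq h1]⟩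
  · rintro ⟨h1, h2⟩; exact ⟨h1, by rwa [Set.mem_preimage, chartInv_eq h1] at h2⟩

/-- The measure on a chart domain defined by a top form. -/
def chartMeasure (ν : Form m M m) (x₀ : M) : Measure M :=
  ((volume.restrict (extChartAt (𝓡 m) x₀).target).withDensity
    fun y => ENNReal.ofReal |ν.dens x₀ y|).map (chartInv x₀)

lemma chartMeasure_apply (ν : Form m M m) {x₀ : M} {A : Set M} (hA : MeasurableSet A)
    (hAs : A ⊆ (extChartAt (𝓡 m) x₀).source) :
    chartMeasure ν x₀ A = ∫⁻ y in extChartAt (𝓡 m) x₀ '' A, ENNReal.ofReal |ν.dens x₀ y| := by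
  have hm := measurable_chartInv (m := m) x₀ hA
  rw [chartMeasure, Measure.map_apply (measurable_chartInv x₀) hA, withDensity_apply _ hm,
    Measure.restrict_restrict hm, image_chart_eq hAs, Set.inter_comm]

/-- Change of variables: the Jacobian of the chart expression of `f` is the quotient of the
densities. For the identity this compares two charts; for symplectomorphisms it gives invariance. -/
lemma chartMeasure_image {ν : Form m M m} (f : Diffeomorph (𝓡 m) (𝓡 m) M M ∞)
    (hfν : Form.pullback f ν = ν) {x₀ x₁ : M} {A : Set M} (hA : MeasurableSet A)
    (hA0 : A ⊆ (extChartAt (𝓡 m) x₀).source) (hA1 : f '' A ⊆ (extChartAt (𝓡 m) x₁).source) :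
    chartMeasure ν x₁ (f '' A) = chartMeasure ν x₀ A := by
  have hfA : MeasurableSet (f '' A) := f.toHomeomorph.measurableEmbedding.measurableSet_image.2 hA
  rw [chartMeasure_apply ν hA hA0, chartMeasure_apply ν hfA hA1]
  set g := extChartAt (𝓡 m) x₁ ∘ f ∘ (extChartAt (𝓡 m) x₀).symm
  have hB : MeasurableSet (extChartAt (𝓡 m) x₀ '' A) := by
    rw [image_chart_eq hA0]
    exact (isOpen_extChartAt_target x₀).measurableSet.inter (measurable_chartInv x₀ hA)
  have himg : extChartAt (𝓡 m) x₁ '' (f '' A) = g '' (extChartAt (𝓡 m) x₀ '' A) := by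
    rw [Set.image_image, Set.image_image]
    refine Set.image_congr fun x hx => ?_
    simp only [g, Function.comp_apply, (extChartAt (𝓡 m) x₀).left_inv (hA0 hx)]
  have hprop : ∀ y ∈ extChartAt (𝓡 m) x₀ '' A, y ∈ (extChartAt (𝓡 m) x₀).target ∧
      f ((extChartAt (𝓡 m) x₀).symm y) ∈ (extChartAt (𝓡 m) x₁).source := by
    rintro _ ⟨x, hx, rfl⟩
    refine ⟨(extChartAt (𝓡 m) x₀).map_source (hA0 hx), ?_⟩
    rw [(extChartAt (𝓡 m) x₀).left_inv (hA0 hx)]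
    exact hA1 ⟨x, hx, rfl⟩
  have hinj : Set.InjOn g (extChartAt (𝓡 m) x₀ '' A) := by
    rintro _ ⟨x, hx, rfl⟩ _ ⟨x', hx', rfl⟩ h
    simp only [g, Function.comp_apply, (extChartAt (𝓡 m) x₀).left_inv (hA0 hx),
      (extChartAt (𝓡 m) x₀).left_inv (hA0 hx')] at h
    rw [f.injective ((extChartAt (𝓡 m) x₁).injOn (hA1 ⟨x, hx, rfl⟩) (hA1 ⟨x', hx', rfl⟩) h)]
  have hder : ∀ y ∈ extChartAt (𝓡 m) x₀ '' A, HasFDerivWithinAt g (fderiv ℝ g y) (extChartAt (𝓡 m) x₀ '' A) y := by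
    intro y hy
    obtain ⟨h1, h2⟩ := hprop y hy
    have hu : ContMDiffAt 𝓘(ℝ, EuclideanSpace ℝ (Fin m)) (𝓡 m) ∞ (f ∘ (extChartAt (𝓡 m) x₀).symm) y :=
      f.contMDiff.contMDiffAt.comp y (contMDiffAt_extChartAt_symm h1)
    exact ((contDiffAt_chart_comp le_rfl hu h2).differentiableAt (by simp)).hasFDerivAt.hasFDerivWithinAt
  rw [himg, lintegral_image_eq_lintegral_abs_det_fderiv_mul volume hB hder hinj]
  refine setLIntegral_congr_fun hB fun y hy => ?_
  obtain ⟨h1, h2⟩ := hprop y hy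
  rw [← ENNReal.ofReal_mul (abs_nonneg _), ← abs_mul, dens_change f.contMDiff hfν h1 h2]

/-- `μ` is the finite measure defined by the top form `ν`. -/
structure IsVolumeMeasure (ν : Form m M m) (μ : Measure M) : Prop where
  finite : IsFiniteMeasure μ
  apply_eq : ∀ (x₀ : M) (A : Set M), MeasurableSet A → A ⊆ (extChartAt (𝓡 m) x₀).source →
    μ A = chartMeasure ν x₀ A

lemma measure_eq_sum_partition {X ι : Type*} [Fintype ι] [MeasurableSpace X] (μ : Measure X) {P : ι → Set X}
    (hP : ∀ i, MeasurableSet (P i)) (hd : Pairwise (Function.onFun Disjoint P)) (hu : ⋃ i, P i = Set.univ)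
    {A : Set X} (hA : MeasurableSet A) : μ A = ∑ i, μ (A ∩ P i) := by
  rw [← tsum_fintype (L := .unconditional ι), ← measure_iUnion (fun i j hij => (hd hij).mono Set.inter_subset_right Set.inter_subset_right)
    (fun i => hA.inter (hP i)), ← Set.inter_iUnion, hu, Set.inter_univ]

/-- A finite cover by chart balls made disjoint. The closed balls stay inside the chart targets, so
densities are bounded on the pieces. -/
lemma exists_adapted_partition [CompactSpace M] : ∃ (N : ℕ) (c : Fin N → M) (r : Fin N → ℝ) (P : Fin N → Set M),
    (∀ i, MeasurableSet (P i)) ∧ Pairwise (Function.onFun Disjoint P) ∧ ⋃ i, P i = Set.univ ∧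
    ∀ i, P i ⊆ (extChartAt (𝓡 m) (c i)).source ∧ Metric.closedBall (extChartAt (𝓡 m) (c i) (c i)) (r i) ⊆ (extChartAt (𝓡 m) (c i)).target ∧
      extChartAt (𝓡 m) (c i) '' P i ⊆ Metric.closedBall (extChartAt (𝓡 m) (c i) (c i)) (r i) := by
  have h1 : ∀ x : M, ∃ r > 0, Metric.closedBall (extChartAt (𝓡 m) x x) r ⊆ (extChartAt (𝓡 m) x).target := fun x =>
    Metric.nhds_basis_closedBall.mem_iff.1 (extChartAt_target_mem_nhds x)
  choose r hr hball using h1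
  let U : M → Set M := fun x => (extChartAt (𝓡 m) x).source ∩ extChartAt (𝓡 m) x ⁻¹' Metric.ball (extChartAt (𝓡 m) x x) (r x)
  have hU : ∀ x, IsOpen (U x) := fun x =>
    (continuousOn_extChartAt x).isOpen_inter_preimage (isOpen_extChartAt_source x) Metric.isOpen_ball
  obtain ⟨t, ht⟩ := isCompact_univ.elim_finite_subcover U hU (fun x _ => Set.mem_iUnion.2
    ⟨x, mem_extChartAt_source x, Metric.mem_ball_self (hr x)⟩)
  let c : Fin t.card → M := fun i => t.equivFin.symm i
  refine ⟨t.card, c, r ∘ c, disjointed (U ∘ c), fun i => ?_, disjoint_disjointed _, ?_, fun i => ⟨?_, hball _, ?_⟩⟩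
  · exact disjointedRec (fun _ _ h => h.diff (hU _).measurableSet) (hU (c i)).measurableSet
  · rw [iUnion_disjointed]
    refine Set.eq_univ_of_forall fun x => ?_
    obtain ⟨y, hy, hxy⟩ := Set.mem_iUnion₂.1 (ht (Set.mem_univ x))
    refine Set.mem_iUnion.2 ⟨t.equivFin ⟨y, hy⟩, ?_⟩
    simpa [c] using hxy
  · exact (disjointed_subset _ i).trans Set.inter_subset_left
  · rintro _ ⟨x, hx, rfl⟩
    exact Metric.ball_subset_closedBall (disjointed_subset _ i hx).2

/-- Add the chart measures restricted to the pieces of a partition; change of variables for the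
identity shows agreement with every chart. -/
lemma IsVolumeForm.exists_isVolumeMeasure [CompactSpace M] {ν : Form m M m} (hν : IsVolumeForm ν) :
    ∃ μ : Measure M, IsVolumeMeasure ν μ := by
  obtain ⟨N, c, r, P, hPm, hPd, hPu, hP⟩ := exists_adapted_partition (m := m) (M := M)
  refine ⟨∑ i, (chartMeasure ν (c i)).restrict (P i), ⟨?_⟩, fun x₀ A hA hAs => ?_⟩
  · rw [Measure.finsetSum_apply]
    refine ENNReal.sum_lt_top.2 fun i _ => ?_
    rw [Measure.restrict_apply MeasurableSet.univ, Set.univ_inter, chartMeasure_apply ν (hPm i) (hP i).1]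
    refine (lintegral_mono_set (hP i).2.2).trans_lt ?_
    have hc : IsCompact (Metric.closedBall (extChartAt (𝓡 m) (c i) (c i)) (r i)) := isCompact_closedBall _ _
    have hcont := (hν.smooth.continuousOn_dens (c i)).mono (hP i).2.1
    obtain ⟨C, hC⟩ := hc.exists_bound_of_continuousOn hcont
    refine (setLIntegral_mono measurable_const (g := fun _ => ENNReal.ofReal C) fun y hy => ENNReal.ofReal_le_ofReal (hC y hy)).trans_lt ?_
    rw [setLIntegral_const]
    exact ENNReal.mul_lt_top ENNReal.ofReal_lt_top hc.measure_lt_top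
  · rw [Measure.finsetSum_apply, measure_eq_sum_partition (chartMeasure ν x₀) hPm hPd hPu hA]
    refine Finset.sum_congr rfl fun i _ => ?_
    rw [Measure.restrict_apply hA]
    have := chartMeasure_image (ν := ν) (Diffeomorph.refl (𝓡 m) M ∞) (by
      funext x
      ext v
      simp only [Form.pullback]
      erw [Diffeomorph.coe_refl, mfderiv_id]
      rfl) (hA.inter (hPm i)) (Set.inter_subset_left.trans hAs) (x₁ := c i) (by
      simpa using Set.inter_subset_right.trans (hP i).1)
    simpa using this

/-- Cut a set so finely that each piece and its image lie in single chart domains, and apply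
`chartMeasure_image` to each. -/
lemma IsVolumeMeasure.measurePreserving [CompactSpace M] {ν : Form m M m} {μ : Measure M} (hμ : IsVolumeMeasure ν μ)
    (f : Diffeomorph (𝓡 m) (𝓡 m) M M ∞) (hfν : Form.pullback f ν = ν) : MeasurePreserving f μ μ := by
  obtain ⟨N, c, r, P, hPm, hPd, hPu, hP⟩ := exists_adapted_partition (m := m) (M := M)
  have hfe : MeasurableEmbedding f := f.toHomeomorph.measurableEmbedding
  have hfm : Measurable f := f.continuous.measurable
  refine ⟨hfm, Measure.ext fun A hA => ?_⟩
  rw [Measure.map_apply hfm hA]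
  rw [measure_eq_sum_partition μ (P := fun p : Fin N × Fin N => P p.1 ∩ f ⁻¹' P p.2)
    (fun p => (hPm _).inter (hfm (hPm _))) (fun p q hpq => ?_) (Set.eq_univ_of_forall fun x => ?_) (hfm hA),
    measure_eq_sum_partition μ (P := fun p : Fin N × Fin N => f '' (P p.1) ∩ P p.2)
    (fun p => (hfe.measurableSet_image.2 (hPm _)).inter (hPm _)) (fun p q hpq => ?_) (Set.eq_univ_of_forall fun x => ?_) hA]
  · refine Finset.sum_congr rfl fun p _ => ?_
    have hm : MeasurableSet (f ⁻¹' A ∩ (P p.1 ∩ f ⁻¹' P p.2)) := (hfm hA).inter ((hPm _).inter (hfm (hPm _)))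
    have himg : A ∩ (f '' P p.1 ∩ P p.2) = f '' (f ⁻¹' A ∩ (P p.1 ∩ f ⁻¹' P p.2)) := by
      ext x
      constructor
      · rintro ⟨h1, ⟨y, hy, rfl⟩, h3⟩; exact ⟨y, ⟨h1, hy, h3⟩, rfl⟩
      · rintro ⟨y, ⟨h1, h2, h3⟩, rfl⟩; exact ⟨h1, ⟨y, h2, rfl⟩, h3⟩
    have hs0 : f ⁻¹' A ∩ (P p.1 ∩ f ⁻¹' P p.2) ⊆ (extChartAt (𝓡 m) (c p.1)).source := fun x hx => (hP _).1 hx.2.1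
    have hs1 : f '' (f ⁻¹' A ∩ (P p.1 ∩ f ⁻¹' P p.2)) ⊆ (extChartAt (𝓡 m) (c p.2)).source := by
      rintro _ ⟨x, hx, rfl⟩; exact (hP _).1 hx.2.2
    rw [himg, hμ.apply_eq _ _ hm hs0, hμ.apply_eq _ _ (hfe.measurableSet_image.2 hm) hs1,
      chartMeasure_image f hfν hm hs0 hs1]
  · refine Set.disjoint_left.2 ?_
    rintro _ ⟨⟨x, hx, rfl⟩, h2⟩ ⟨⟨x', hx', hxx⟩, h2'⟩
    rw [f.injective hxx] at hx'
    apply hpq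
    ext1
    · by_contra h; exact Set.disjoint_left.1 (hPd h) hx hx'
    · by_contra h; exact Set.disjoint_left.1 (hPd h) h2 h2'
  · have h1 : f.symm x ∈ ⋃ i, P i := by rw [hPu]; trivial
    have h2 : x ∈ ⋃ i, P i := by rw [hPu]; trivial
    obtain ⟨i, hi⟩ := Set.mem_iUnion.1 h1
    obtain ⟨j, hj⟩ := Set.mem_iUnion.1 h2
    exact Set.mem_iUnion.2 ⟨(i, j), ⟨f.symm x, hi, by simp⟩, hj⟩
  · refine Set.disjoint_left.2 ?_
    rintro x ⟨hx, h2⟩ ⟨hx', h2'⟩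
    apply hpq
    ext1
    · by_contra h; exact Set.disjoint_left.1 (hPd h) hx hx'
    · by_contra h; exact Set.disjoint_left.1 (hPd h) h2 h2'
  · have h1 : x ∈ ⋃ i, P i := by rw [hPu]; trivial
    have h2 : f x ∈ ⋃ i, P i := by rw [hPu]; trivial
    obtain ⟨i, hi⟩ := Set.mem_iUnion.1 h1
    obtain ⟨j, hj⟩ := Set.mem_iUnion.1 h2
    exact Set.mem_iUnion.2 ⟨(i, j), hi, hj⟩

/-- Integration in a chart of a function supported in the chart domain. -/
lemma IsVolumeMeasure.integral_eq {ν : Form m M m} (hν : IsVolumeForm ν) {μ : Measure M} (hμ : IsVolumeMeasure ν μ) (x₀ : M) {F : M → ℝ}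
    (hF : Measurable F) (hF0 : ∀ x ∉ (extChartAt (𝓡 m) x₀).source, F x = 0) :
    ∫ x, F x ∂μ = ∫ y in (extChartAt (𝓡 m) x₀).target, |ν.dens x₀ y| * F ((extChartAt (𝓡 m) x₀).symm y) := by
  have hsm : MeasurableSet (extChartAt (𝓡 m) x₀).source := (isOpen_extChartAt_source x₀).measurableSet
  have htm : MeasurableSet (extChartAt (𝓡 m) x₀).target := (isOpen_extChartAt_target x₀).measurableSet
  have hres : μ.restrict (extChartAt (𝓡 m) x₀).source = (chartMeasure ν x₀).restrict (extChartAt (𝓡 m) x₀).source := by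
    ext A hA
    rw [Measure.restrict_apply hA, Measure.restrict_apply hA]
    exact hμ.apply_eq _ _ (hA.inter hsm) Set.inter_subset_right
  rw [← setIntegral_eq_integral_of_forall_compl_eq_zero (s := (extChartAt (𝓡 m) x₀).source) (fun x hx => hF0 x hx), hres,
    setIntegral_eq_integral_of_forall_compl_eq_zero (fun x hx => hF0 x hx), chartMeasure,
    integral_map (measurable_chartInv x₀).aemeasurable hF.aestronglyMeasurable,
    integral_withDensity_eq_integral_toReal_smul₀]
  · refine setIntegral_congr_fun htm fun y hy => ?_
    rw [ENNReal.toReal_ofReal (abs_nonneg _), smul_eq_mul, chartInv_eq hy]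
  · exact ENNReal.measurable_ofReal.comp_aemeasurable
      ((hν.smooth.continuousOn_dens x₀).abs.aemeasurable htm)
  · exact Filter.Eventually.of_forall fun _ => ENNReal.ofReal_lt_top

end VolumeMeasure

/-! ### Differentiation under the integral sign -/

section ParametricIntegral

open MeasureTheory

variable {X T : Type} [NormedAddCommGroup X] [NormedSpace ℝ X] [FiniteDimensional ℝ X]
  [NormedAddCommGroup T] [NormedSpace ℝ T] [FiniteDimensional ℝ T] [MeasurableSpace T] [BorelSpace T]
  {μ : Measure T} [IsFiniteMeasureOnCompacts μ]

/-- Domination is by a constant, a bound for the derivative on the compact product of a unit ball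
and `K`. -/
lemma hasFDerivAt_setIntegral_param {G : Type} [NormedAddCommGroup G] [NormedSpace ℝ G] {F : X × T → G}
    (hF : ContDiff ℝ ∞ F) {K : Set T} (hK : IsCompact K) (x : X) :
    HasFDerivAt (fun x => ∫ t in K, F (x, t) ∂μ)
      (∫ t in K, (fderiv ℝ F (x, t)).comp (ContinuousLinearMap.inl ℝ X T) ∂μ) x := by
  have hc : Continuous fun p : X × T => (fderiv ℝ F p).comp (ContinuousLinearMap.inl ℝ X T) :=
    ((hF.continuous_fderiv (by simp))).clm_comp continuous_const
  have : ProperSpace X := FiniteDimensional.proper ℝ X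
  obtain ⟨C, hC⟩ := ((isCompact_closedBall x 1).prod hK).exists_bound_of_continuousOn hc.continuousOn
  have hfin : IsFiniteMeasure (μ.restrict K) := ⟨by
    rw [Measure.restrict_apply_univ]; exact hK.measure_lt_top⟩
  refine hasFDerivAt_integral_of_dominated_of_fderiv_le (bound := fun _ => C) (s := Metric.ball x 1)
    (F' := fun x t => (fderiv ℝ F (x, t)).comp (ContinuousLinearMap.inl ℝ X T))
    (Metric.ball_mem_nhds x one_pos) ?_ ?_ ?_ ?_ (integrable_const C) ?_
  · exact Filter.Eventually.of_forall fun x' =>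
      (hF.continuous.comp (continuous_const.prodMk continuous_id)).aestronglyMeasurable
  · exact (hF.continuous.comp (continuous_const.prodMk continuous_id)).continuousOn.integrableOn_compact hK
  · exact (hc.comp (continuous_const.prodMk continuous_id)).aestronglyMeasurable
  · refine (ae_restrict_iff' hK.measurableSet).2 (Filter.Eventually.of_forall fun t ht x' hx' => ?_)
    exact hC (x', t) ⟨Metric.ball_subset_closedBall hx', ht⟩
  · refine Filter.Eventually.of_forall fun t x' _ => ?_
    have h1 : HasFDerivAt F (fderiv ℝ F (x', t)) (x', t) :=
      (hF.differentiable (by simp) _).hasFDerivAt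
    exact HasFDerivAt.comp (g := F) x' h1 (hasFDerivAt_prodMk_left x' t)

/-- Smoothness of integrals over a compact set which depend smoothly on a parameter. -/
lemma contDiff_setIntegral_param {G : Type} [NormedAddCommGroup G] [NormedSpace ℝ G] {F : X × T → G}
    (hF : ContDiff ℝ ∞ F) {K : Set T} (hK : IsCompact K) :
    ContDiff ℝ ∞ (fun x => ∫ t in K, F (x, t) ∂μ) := by
  refine contDiff_infty.2 fun n => ?_
  -- The target varies in the induction: the derivative is an integral of the same type with values
  -- in a space of linear maps.
  induction n generalizing G with
  | zero =>
    refine contDiff_zero.2 (continuous_iff_continuousAt.2 fun x => ?_)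
    exact (hasFDerivAt_setIntegral_param hF hK x).continuousAt
  | succ n ih =>
    push_cast
    refine contDiff_succ_iff_hasFDerivAt.2 ⟨_, ?_, hasFDerivAt_setIntegral_param hF hK⟩
    exact ih (F := fun p : X × T => (fderiv ℝ F p).comp (ContinuousLinearMap.inl ℝ X T))
      ((hF.fderiv_right (by simp)).clm_comp contDiff_const)

end ParametricIntegral

/-! ### The Leibniz rule and Stokes' theorem on Euclidean space -/

section FlatForms

open MeasureTheory

variable {W : Type*} [NormedAddCommGroup W] [NormedSpace ℝ W]

lemma extDeriv_fun_mul_apply {k : ℕ} {f : W → ℝ} {θ : W → W [⋀^Fin k]→L[ℝ] ℝ} {y : W}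
    (hf : DifferentiableAt ℝ f y) (hθ : DifferentiableAt ℝ θ y) (v : Fin (k + 1) → W) :
    extDeriv (fun y => f y • θ y) y v = f y * extDeriv θ y v +
      eps (fderiv ℝ f y : W →ₗ[ℝ] ℝ) (θ y).toAlternatingMap v := by
  have hd : DifferentiableAt ℝ (fun y => f y • θ y) y := hf.smul hθ
  rw [extDeriv_apply hd, extDeriv_apply hθ, eps_apply, Finset.mul_sum, ← Finset.sum_add_distrib]
  refine Finset.sum_congr rfl fun i _ => ?_
  have h1 : HasFDerivAt (fun y => θ y (i.removeNth v))
      (fderiv ℝ (fun y => θ y (i.removeNth v)) y) y := by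
    refine DifferentiableAt.hasFDerivAt ?_
    exact (ContinuousAlternatingMap.apply ℝ W ℝ (i.removeNth v)).differentiableAt.comp y hθ
  have h2 := (hf.hasFDerivAt.mul h1).fderiv
  have h3 : (fun y => (f y • θ y) (i.removeNth v)) = f * fun y => θ y (i.removeNth v) := rfl
  rw [h3, h2]
  simp
  ring

/-- Integration by parts against the constant function 1. -/
lemma integral_fderiv_eq_zero {m : ℕ} {g : EuclideanSpace ℝ (Fin m) → ℝ} (hg : ContDiff ℝ 1 g)
    (hs : HasCompactSupport g) (v : EuclideanSpace ℝ (Fin m)) : ∫ y, fderiv ℝ g y v = 0 := by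
  have h := integral_mul_fderiv_eq_neg_fderiv_mul_of_integrable (μ := volume) (f := fun _ : EuclideanSpace ℝ (Fin m) => (1 : ℝ))
    (g := g) (v := v) (by simp) ?_ ?_ (by fun_prop) (fun y _ => hg.differentiable one_ne_zero y)
  · simpa using h
  · simp only [one_mul]
    refine Continuous.integrable_of_hasCompactSupport
      ((hg.continuous_fderiv one_ne_zero).clm_apply continuous_const) ?_
    exact (hs.fderiv_apply (𝕜 := ℝ) v)
  · simpa using hg.continuous.integrable_of_hasCompactSupport hs

/-- Stokes' theorem for compactly supported forms on Euclidean space. -/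
lemma integral_extDeriv_eq_zero {d : ℕ}
    {Ξ : EuclideanSpace ℝ (Fin (d + 1)) → (EuclideanSpace ℝ (Fin (d + 1))) [⋀^Fin d]→L[ℝ] ℝ}
    (hΞ : ContDiff ℝ 1 Ξ) (hs : HasCompactSupport Ξ) :
    ∫ y, extDeriv Ξ y (stdB (d + 1)) = 0 := by
  have h1 : ∀ y, extDeriv Ξ y (stdB (d + 1)) = ∑ i : Fin (d + 1), (-1) ^ (i : ℕ) *
      fderiv ℝ (fun y => Ξ y (i.removeNth (stdB (d + 1)))) y (stdB (d + 1) i) := fun y => by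
    simpa only [smul_eq_mul, zsmul_eq_mul, Int.cast_pow, Int.cast_neg, Int.cast_one] using extDeriv_apply (hΞ.differentiable one_ne_zero y) (stdB (d + 1))
  have h2 : ∀ i : Fin (d + 1), ContDiff ℝ 1 fun y => Ξ y (i.removeNth (stdB (d + 1))) := fun i =>
    (ContinuousAlternatingMap.apply ℝ _ ℝ (i.removeNth (stdB (d + 1)))).contDiff.comp hΞ
  have h3 : ∀ i : Fin (d + 1), HasCompactSupport fun y => Ξ y (i.removeNth (stdB (d + 1))) := fun i =>
    hs.comp_left (g := fun A : (EuclideanSpace ℝ (Fin (d + 1))) [⋀^Fin d]→L[ℝ] ℝ => A (i.removeNth (stdB (d + 1)))) rfl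
  simp only [h1]
  rw [integral_finsetSum]
  · refine Finset.sum_eq_zero fun i _ => ?_
    rw [integral_const_mul, integral_fderiv_eq_zero (h2 i) (h3 i), mul_zero]
  · intro i _
    refine Integrable.const_mul (Continuous.integrable_of_hasCompactSupport
      (((h2 i).continuous_fderiv one_ne_zero).clm_apply continuous_const) ?_) _
    exact ((h3 i).fderiv_apply (𝕜 := ℝ) _)

end FlatForms

/-! ### Inverting the divergence with compact support -/

section CompactPoincare

open MeasureTheory

variable {m : ℕ}

local notation "𝔼" => EuclideanSpace ℝ (Fin m)

/-- An integral operator inverting the divergence up to a convolution. -/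
def radialField (χ h : 𝔼 → ℝ) (ρ : ℝ) (i : Fin m) (y : 𝔼) : ℝ :=
  ∫ q in Metric.closedBall (0 : 𝔼) ρ ×ˢ Set.Icc (0 : ℝ) 1, q.1 i * χ q.1 * h (y - q.2 • q.1)

lemma contDiff_radialKernel {χ h : 𝔼 → ℝ} (hχ : ContDiff ℝ ∞ χ) (hh : ContDiff ℝ ∞ h) (i : Fin m) :
    ContDiff ℝ ∞ fun x : 𝔼 × (𝔼 × ℝ) => x.2.1 i * χ x.2.1 * h (x.1 - x.2.2 • x.2.1) := by
  have h1 : ContDiff ℝ ∞ fun x : 𝔼 × (𝔼 × ℝ) => x.2.1 i :=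
    (EuclideanSpace.proj i : 𝔼 →L[ℝ] ℝ).contDiff.comp (contDiff_fst.comp contDiff_snd)
  exact (h1.mul (hχ.comp (contDiff_fst.comp contDiff_snd))).mul
    (hh.comp (contDiff_fst.sub ((contDiff_snd.comp contDiff_snd).smul (contDiff_fst.comp contDiff_snd))))

lemma contDiff_radialField {χ h : 𝔼 → ℝ} (hχ : ContDiff ℝ ∞ χ) (hh : ContDiff ℝ ∞ h) (ρ : ℝ) (i : Fin m) :
    ContDiff ℝ ∞ (radialField χ h ρ i) :=
  contDiff_setIntegral_param (contDiff_radialKernel hχ hh i) ((isCompact_closedBall _ _).prod isCompact_Icc)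

lemma radialField_eq_zero {χ h : 𝔼 → ℝ} {ρ : ℝ} (hh0 : ∀ y ∉ Metric.closedBall (0 : 𝔼) ρ, h y = 0) (i : Fin m)
    {y : 𝔼} (hy : y ∉ Metric.closedBall (0 : 𝔼) (2 * ρ)) : radialField χ h ρ i y = 0 := by
  refine setIntegral_eq_zero_of_forall_eq_zero fun q hq => ?_
  rw [hh0, mul_zero]
  intro h1
  apply hy
  obtain ⟨h2, h3, h4⟩ := hq
  rw [mem_closedBall_zero_iff] at *
  have : ‖y‖ ≤ ‖y - q.2 • q.1‖ + ‖q.2 • q.1‖ := by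
    simpa using norm_add_le (y - q.2 • q.1) (q.2 • q.1)
  rw [norm_smul, Real.norm_of_nonneg h3] at this
  nlinarith [norm_nonneg q.1]

/-- Under the integral, the divergence produces the derivative of h at y - r p in the direction p,
which is minus the r-derivative of h(y - r p). Integrating over r in [0, 1] leaves h(y) - h(y - p).
-/
lemma div_radialField {χ h : 𝔼 → ℝ} (hχ : ContDiff ℝ ∞ χ) (hh : ContDiff ℝ ∞ h) {ρ : ℝ}
    (hχ0 : ∀ y ∉ Metric.closedBall (0 : 𝔼) ρ, χ y = 0) (y : 𝔼) :
    ∑ i, fderiv ℝ (radialField χ h ρ i) y (stdB m i) = ∫ p, χ p * (h y - h (y - p)) := by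
  have hK : IsCompact (Metric.closedBall (0 : 𝔼) ρ ×ˢ Set.Icc (0 : ℝ) 1) := (isCompact_closedBall _ _).prod isCompact_Icc
  have hint : Continuous fun q : 𝔼 × ℝ => χ q.1 * fderiv ℝ h (y - q.2 • q.1) q.1 :=
    (hχ.continuous.comp continuous_fst).mul (((hh.continuous_fderiv (by simp)).comp (by fun_prop)).clm_apply continuous_fst)
  have h1 : ∀ i, fderiv ℝ (radialField χ h ρ i) y (stdB m i) =
      ∫ q in Metric.closedBall (0 : 𝔼) ρ ×ˢ Set.Icc (0 : ℝ) 1,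
        q.1 i * χ q.1 * fderiv ℝ h (y - q.2 • q.1) (stdB m i) := by
    intro i
    have hk := contDiff_radialKernel hχ hh i
    have h2 := (hasFDerivAt_setIntegral_param (μ := (volume : Measure (𝔼 × ℝ))) hk hK y).fderiv
    have h2' : fderiv ℝ (radialField χ h ρ i) y = _ := h2
    rw [h2', ContinuousLinearMap.integral_apply]
    · refine integral_congr_ae (Filter.Eventually.of_forall fun q => ?_)
      have h3 : HasFDerivAt (fun x : 𝔼 => q.1 i * χ q.1 * h (x - q.2 • q.1))
          ((q.1 i * χ q.1) • (fderiv ℝ h (y - q.2 • q.1)).comp (ContinuousLinearMap.id ℝ 𝔼)) y := by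
        refine HasFDerivAt.const_mul ?_ _
        exact ((hh.differentiable (by simp) (y - q.2 • q.1)).hasFDerivAt).comp y ((hasFDerivAt_id y).sub_const _)
      have h4 := HasFDerivAt.comp (f := fun e : 𝔼 => (e, q)) y (hk.differentiable (by simp) (y, q)).hasFDerivAt (hasFDerivAt_prodMk_left y q)
      have h5 := congrArg (fun L : 𝔼 →L[ℝ] ℝ => L (stdB m i)) (h4.unique h3)
      exact h5
    · refine ContinuousOn.integrableOn_compact hK (Continuous.continuousOn ?_)
      exact ((hk.continuous_fderiv (by simp)).comp (continuous_const.prodMk continuous_id)).clm_comp continuous_const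
  simp only [h1]
  rw [← integral_finsetSum]
  · have h2 : ∀ q : 𝔼 × ℝ, ∑ i, q.1 i * χ q.1 * fderiv ℝ h (y - q.2 • q.1) (stdB m i) =
        χ q.1 * fderiv ℝ h (y - q.2 • q.1) q.1 := by
      intro q
      have h3 : fderiv ℝ h (y - q.2 • q.1) q.1 = fderiv ℝ h (y - q.2 • q.1) (∑ i, q.1 i • stdB m i) := by
        congr 1
        exact ((stdB m).sum_repr q.1).symm
      rw [h3, map_sum, Finset.mul_sum]
      refine Finset.sum_congr rfl fun i _ => ?_
      rw [map_smul, smul_eq_mul]; ring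
    simp only [h2]
    rw [Measure.volume_eq_prod, setIntegral_prod _ (by
      rw [← Measure.volume_eq_prod]; exact hint.continuousOn.integrableOn_compact hK)]
    rw [← setIntegral_eq_integral_of_forall_compl_eq_zero (s := Metric.closedBall (0 : 𝔼) ρ)
      (f := fun p => χ p * (h y - h (y - p))) (fun p hp => by rw [hχ0 p hp, zero_mul])]
    refine setIntegral_congr_fun Metric.isClosed_closedBall.measurableSet fun p _ => ?_
    simp only
    rw [integral_const_mul, integral_Icc_eq_integral_Ioc, ← intervalIntegral.integral_of_le zero_le_one]
    congr 1
    have h6 : ∀ r ∈ Set.uIcc (0 : ℝ) 1, HasDerivAt (fun r : ℝ => -h (y - r • p)) (fderiv ℝ h (y - r • p) p) r := by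
      intro r _
      have h7 : HasDerivAt (fun r : ℝ => y - r • p) (-p) r := by
        simpa using ((hasDerivAt_id r).smul_const p).const_sub y
      have := ((hh.differentiable (by simp) (y - r • p)).hasFDerivAt.comp_hasDerivAt r h7).neg
      simp only [map_neg, neg_neg] at this
      exact this
    rw [intervalIntegral.integral_eq_sub_of_hasDerivAt h6 (Continuous.intervalIntegrable
      (((hh.continuous_fderiv (by simp)).comp (by fun_prop)).clm_apply continuous_const) _ _)]
    simp
    ring
  · intro i _
    refine ContinuousOn.integrableOn_compact hK (Continuous.continuousOn ?_)
    refine (((EuclideanSpace.proj i : 𝔼 →L[ℝ] ℝ).continuous.comp continuous_fst).mul (hχ.continuous.comp continuous_fst)).mul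
      (((hh.continuous_fderiv (by simp)).comp (by fun_prop)).clm_apply continuous_const)

/-- A function with integral zero, supported in a ball, is the divergence of a vector field
supported in the concentric ball of twice the radius. -/
lemma exists_div_eq {h : 𝔼 → ℝ} (hh : ContDiff ℝ ∞ h) {c : 𝔼} {ρ : ℝ} (hρ : 0 < ρ)
    (hh0 : ∀ y ∉ Metric.closedBall c ρ, h y = 0) (hint : ∫ y, h y = 0) :
    ∃ Y : Fin m → 𝔼 → ℝ, (∀ i, ContDiff ℝ ∞ (Y i)) ∧
      (∀ i, ∀ y ∉ Metric.closedBall c (2 * ρ), Y i y = 0) ∧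
      ∀ y, ∑ i, fderiv ℝ (Y i) y (stdB m i) = h y := by
  let k : 𝔼 → ℝ := fun y => h (y + c)
  have hk : ContDiff ℝ ∞ k := hh.comp (contDiff_id.add contDiff_const)
  have hk0 : ∀ y ∉ Metric.closedBall (0 : 𝔼) ρ, k y = 0 := fun y hy => hh0 _ (by simpa using hy)
  have hkint : ∫ y, k y = 0 := by rw [← hint]; exact integral_add_right_eq_self h c
  let b : ContDiffBump (0 : 𝔼) := ⟨ρ / 2, ρ, by positivity, by linarith⟩
  let χ : 𝔼 → ℝ := b.normed volume
  have hχ : ContDiff ℝ ∞ χ := b.contDiff_normed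
  have hχ0 : ∀ y ∉ Metric.closedBall (0 : 𝔼) ρ, χ y = 0 := fun y hy => by
    have := b.support_normed_eq (μ := volume)
    by_contra h1
    have h2 : y ∈ Function.support (b.normed volume) := h1
    rw [this] at h2
    exact hy (Metric.ball_subset_closedBall h2)
  have hχint : ∫ y, χ y = 1 := b.integral_normed
  have hcs : ∀ f : 𝔼 → ℝ, (∀ y ∉ Metric.closedBall (0 : 𝔼) ρ, f y = 0) → HasCompactSupport f := fun f hf =>
    HasCompactSupport.intro (isCompact_closedBall _ _) hf
  -- With * for convolution, the two fields have divergences (∫χ) k - χ * k and (∫k) χ - k * χ.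
  -- Convolution commutes, ∫χ = 1 and ∫k = 0, so their difference has divergence k.
  have hD : ∀ y, ∑ i, fderiv ℝ (fun y => radialField χ k ρ i y - radialField k χ ρ i y) y (stdB m i) = k y := by
    intro y
    have h1 : ∀ i, fderiv ℝ (fun y => radialField χ k ρ i y - radialField k χ ρ i y) y (stdB m i) =
        fderiv ℝ (radialField χ k ρ i) y (stdB m i) - fderiv ℝ (radialField k χ ρ i) y (stdB m i) := fun i => by
      rw [fderiv_fun_sub ((contDiff_radialField hχ hk ρ i).differentiable (by simp) y)
        ((contDiff_radialField hk hχ ρ i).differentiable (by simp) y)]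
      rfl
    simp only [h1]
    rw [Finset.sum_sub_distrib, div_radialField hχ hk hχ0, div_radialField hk hχ hk0]
    have i1 : ∀ f g : 𝔼 → ℝ, ContDiff ℝ ∞ f → ContDiff ℝ ∞ g → (∀ y ∉ Metric.closedBall (0 : 𝔼) ρ, f y = 0) →
        ∫ p, f p * (g y - g (y - p)) = (∫ p, f p) * g y - ∫ p, f p * g (y - p) := by
      intro f g hf hg hf0
      simp only [mul_sub]
      rw [integral_sub, integral_mul_const]
      · exact (hf.continuous.integrable_of_hasCompactSupport (hcs f hf0)).mul_const _
      · exact (hf.continuous.mul (hg.continuous.comp (by fun_prop))).integrable_of_hasCompactSupport (hcs f hf0).mul_right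
    rw [i1 χ k hχ hk hχ0, i1 k χ hk hχ hk0, hχint, hkint]
    have h2 : ∫ p, χ p * k (y - p) = ∫ p, k p * χ (y - p) := by
      rw [← integral_sub_left_eq_self _ volume y]
      refine integral_congr_ae (Filter.Eventually.of_forall fun p => ?_)
      simp [mul_comm]
    rw [h2]; ring
  refine ⟨fun i y => radialField χ k ρ i (y - c) - radialField k χ ρ i (y - c), fun i => ?_, fun i y hy => ?_, fun y => ?_⟩
  · exact ((contDiff_radialField hχ hk ρ i).comp (contDiff_id.sub contDiff_const)).sub
      ((contDiff_radialField hk hχ ρ i).comp (contDiff_id.sub contDiff_const))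
  · have : y - c ∉ Metric.closedBall (0 : 𝔼) (2 * ρ) := by
      rwa [mem_closedBall_zero_iff, ← dist_eq_norm]
    simp only
    rw [radialField_eq_zero hk0 i this, radialField_eq_zero hχ0 i this, sub_zero]
  · have h3 := hD (y - c)
    have h4 : ∀ i, fderiv ℝ (fun y => radialField χ k ρ i (y - c) - radialField k χ ρ i (y - c)) y =
        fderiv ℝ (fun y => radialField χ k ρ i y - radialField k χ ρ i y) (y - c) := fun i =>
      fderiv_comp_sub (f := fun y => radialField χ k ρ i y - radialField k χ ρ i y) (x := y) c
    simp only [h4, h3, k, sub_add_cancel]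

end CompactPoincare

/-! ### The compactly supported Poincaré lemma in top degree -/

section CompactPoincareForms

open MeasureTheory

variable {d : ℕ}

local notation "𝔼" => EuclideanSpace ℝ (Fin (d + 1))

/-- The standard volume form of Euclidean space. -/
def stdVol (m : ℕ) : (EuclideanSpace ℝ (Fin m)) [⋀^Fin m]→L[ℝ] ℝ :=
  { (stdB m).det with
    cont := by
      change Continuous fun v => Matrix.det ((stdB m).toMatrix v)
      refine Continuous.matrix_det (continuous_matrix fun i j => ?_)
      exact (EuclideanSpace.proj i : EuclideanSpace ℝ (Fin m) →L[ℝ] ℝ).continuous.comp (continuous_apply j) }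

lemma top_succ_eq_zero {m : ℕ} (A : (EuclideanSpace ℝ (Fin m)) [⋀^Fin (m + 1)]→ₗ[ℝ] ℝ) : A = 0 := by
  ext v
  refine A.map_linearDependent v fun h => ?_
  have := h.fintype_card_le_finrank
  simp at this

/-- Contract b ∧ vol, which is zero by degree, with `e`. Hence d(Y ⌟ vol) = div(Y) vol. -/
lemma eps_curryLeft_stdVol (b : 𝔼 →ₗ[ℝ] ℝ) (e : 𝔼) :
    eps b ((stdVol (d + 1)).curryLeft e).toAlternatingMap (stdB (d + 1)) = b e := by
  have h := curryLeft_eps b (stdVol (d + 1)).toAlternatingMap e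
  rw [top_succ_eq_zero (eps b (stdVol (d + 1)).toAlternatingMap)] at h
  have h2 := congrArg (fun A => A (stdB (d + 1))) h
  have h3 : (stdVol (d + 1)).toAlternatingMap (stdB (d + 1)) = 1 := (stdB (d + 1)).det_self
  simp only [AlternatingMap.sub_apply, AlternatingMap.smul_apply, h3] at h2
  have h4 : (0 : ℝ) = b e • 1 - eps b ((stdVol (d + 1)).curryLeft e).toAlternatingMap (stdB (d + 1)) := h2
  rw [smul_eq_mul, mul_one] at h4
  linarith

lemma exists_extDeriv_eq {h : 𝔼 → ℝ} (hh : ContDiff ℝ ∞ h) {c : 𝔼} {ρ : ℝ} (hρ : 0 < ρ)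
    (hh0 : ∀ y ∉ Metric.closedBall c ρ, h y = 0) (hint : ∫ y, h y = 0) :
    ∃ Z : 𝔼 → 𝔼 [⋀^Fin d]→L[ℝ] ℝ, ContDiff ℝ ∞ Z ∧ (∀ y ∉ Metric.closedBall c (2 * ρ), Z y = 0) ∧
      ∀ y, extDeriv Z y (stdB (d + 1)) = h y := by
  obtain ⟨Y, hY, hY0, hdiv⟩ := exists_div_eq hh hρ hh0 hint
  let ι : Fin (d + 1) → 𝔼 [⋀^Fin d]→L[ℝ] ℝ := fun i => (stdVol (d + 1)).curryLeft (stdB (d + 1) i)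
  have hterm : ∀ i, ContDiff ℝ ∞ fun y => Y i y • ι i := fun i => (hY i).smul contDiff_const
  refine ⟨fun y => ∑ i, Y i y • ι i, ContDiff.sum fun i _ => hterm i, fun y hy => ?_, fun y => ?_⟩
  · exact Finset.sum_eq_zero fun i _ => by rw [hY0 i y hy, zero_smul]
  · have h1 : extDeriv (fun y => ∑ i, Y i y • ι i) y = ∑ i, extDeriv (fun y => Y i y • ι i) y := by
      unfold extDeriv
      rw [fderiv_fun_sum fun i _ => (hterm i).differentiable (by simp) y]
      exact map_sum (ContinuousAlternatingMap.alternatizeUncurryFinCLM ℝ 𝔼 ℝ) _ _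
    rw [h1, ← hdiv y, ContinuousAlternatingMap.sum_apply]
    refine Finset.sum_congr rfl fun i _ => ?_
    rw [extDeriv_fun_mul_apply ((hY i).differentiable (by simp) y) (differentiableAt_const _)]
    have h2 : extDeriv (fun _ : 𝔼 => ι i) y = 0 := by
      ext v
      rw [extDeriv_apply (differentiableAt_const _)]
      simp
    rw [h2, show (0 : 𝔼 [⋀^Fin (d + 1)]→L[ℝ] ℝ) (stdB (d + 1)) = 0 from rfl, mul_zero, zero_add, eps_curryLeft_stdVol]
    rfl

end CompactPoincareForms

/-! ### Calculus of forms on a manifold, by charts -/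

section FormCalculus

variable {m : ℕ} {M : Type u} [TopologicalSpace M] [ChartedSpace (EuclideanSpace ℝ (Fin m)) M]
variable {k : ℕ}

local notation "𝔼" => EuclideanSpace ℝ (Fin m)

/-- The value of a form at a point, as an alternating form on Euclidean space. -/
def Form.ev (α : Form m M k) (x : M) : 𝔼 [⋀^Fin k]→L[ℝ] ℝ := α x

lemma Form.ext_ev {α β : Form m M k} (h : ∀ x, α.ev x = β.ev x) : α = β := funext h

/-- The derivative of the inverse of a chart. -/
def symmD (x₀ : M) (y : 𝔼) : 𝔼 →L[ℝ] 𝔼 := mfderiv 𝓘(ℝ, 𝔼) (𝓡 m) (extChartAt (𝓡 m) x₀).symm y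

/-- The derivative of a chart. -/
def chartD (x₀ : M) (x : M) : 𝔼 →L[ℝ] 𝔼 := mfderiv (𝓡 m) 𝓘(ℝ, 𝔼) (extChartAt (𝓡 m) x₀) x

lemma Form.inChart_apply (α : Form m M k) (x₀ : M) (y : 𝔼) (v : Fin k → 𝔼) :
    α.inChart x₀ y v = α.ev ((extChartAt (𝓡 m) x₀).symm y) fun i => symmD x₀ y (v i) := rfl

lemma Form.inChart_eq_zero {α : Form m M k} {x₀ : M} {y : 𝔼} (h : α.ev ((extChartAt (𝓡 m) x₀).symm y) = 0) :
    α.inChart x₀ y = 0 := by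
  ext v; rw [Form.inChart_apply, h]; rfl

/-- Multiplication of a form by a function. -/
def Form.fsmul (f : M → ℝ) (α : Form m M k) : Form m M k := fun x => f x • α x

lemma Form.ev_fsmul (f : M → ℝ) (α : Form m M k) (x : M) : (α.fsmul f).ev x = f x • α.ev x := rfl

lemma Form.inChart_fsmul (f : M → ℝ) (α : Form m M k) (x₀ : M) :
    (α.fsmul f).inChart x₀ = fun y => f ((extChartAt (𝓡 m) x₀).symm y) • α.inChart x₀ y := by
  ext y v; rfl

/-- The wedge product of a form with a `1`-form. -/
def Form.wedgeOne (η : Form m M k) (a : Form m M 1) : Form m M (k + 1) := fun x => wedge (η.ev x) (a.ev x)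

lemma Form.wedgeOne_apply (η : Form m M k) (a : Form m M 1) (x : M) (v : Fin (k + 1) → 𝔼) :
    (η.wedgeOne a).ev x v = (-1) ^ k * eps (lin (a.ev x)) (η.ev x).toAlternatingMap v :=
  wedge_one_apply _ _ _

lemma Form.inChart_wedgeOne (η : Form m M k) (a : Form m M 1) (x₀ : M) (y : 𝔼) (v : Fin (k + 1) → 𝔼) :
    (η.wedgeOne a).inChart x₀ y v =
      (-1) ^ k * eps (lin (a.inChart x₀ y)) (η.inChart x₀ y).toAlternatingMap v := by
  rw [Form.inChart_apply, Form.wedgeOne_apply, eps_apply, eps_apply]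
  refine congrArg _ (Finset.sum_congr rfl fun i _ => ?_)
  congr 2
  rw [lin_apply, lin_apply, Form.inChart_apply]
  congr 1
  funext j
  fin_cases j
  rfl

lemma Form.wedgeOne_add (η η' : Form m M k) (a : Form m M 1) :
    (η + η').wedgeOne a = η.wedgeOne a + η'.wedgeOne a := by
  refine Form.ext_ev fun x => ?_
  ext v
  change (Form.wedgeOne (η + η') a).ev x v = (η.wedgeOne a).ev x v + (η'.wedgeOne a).ev x v
  rw [Form.wedgeOne_apply, Form.wedgeOne_apply, Form.wedgeOne_apply, ← mul_add, ← AlternatingMap.add_apply, ← eps_add]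
  rfl

lemma Form.zero_wedgeOne (a : Form m M 1) : (0 : Form m M k).wedgeOne a = 0 := by
  have := Form.wedgeOne_add (0 : Form m M k) 0 a
  simpa using this

lemma Form.wedgeOne_sum {ι : Type*} (s : Finset ι) (η : ι → Form m M k) (a : Form m M 1) :
    (∑ i ∈ s, η i).wedgeOne a = ∑ i ∈ s, (η i).wedgeOne a := by
  classical
  induction s using Finset.induction_on with
  | empty => simp [Form.zero_wedgeOne]
  | insert i s hi ih => rw [Finset.sum_insert hi, Finset.sum_insert hi, Form.wedgeOne_add, ih]

lemma Form.IsSmooth.sum {ι : Type*} (s : Finset ι) {η : ι → Form m M k} (h : ∀ i ∈ s, (η i).IsSmooth) :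
    (∑ i ∈ s, η i).IsSmooth := by
  classical
  induction s using Finset.induction_on with
  | empty => simpa using Form.isSmooth_zero
  | insert i s hi ih =>
    rw [Finset.sum_insert hi]
    exact (h i (Finset.mem_insert_self _ _)).add (ih fun j hj => h j (Finset.mem_insert_of_mem hj))

lemma Form.IsExtDeriv.sum {ι : Type*} (s : Finset ι) {η : ι → Form m M k} {θ : ι → Form m M (k + 1)}
    (h : ∀ i ∈ s, (η i).IsSmooth) (h' : ∀ i ∈ s, (η i).IsExtDeriv (θ i)) :
    (∑ i ∈ s, η i).IsExtDeriv (∑ i ∈ s, θ i) := by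
  classical
  induction s using Finset.induction_on with
  | empty => simpa using Form.isExtDeriv_zero
  | insert i s hi ih =>
    rw [Finset.sum_insert hi, Finset.sum_insert hi]
    have hs : ∀ j ∈ s, j ∈ insert i s := fun j hj => Finset.mem_insert_of_mem hj
    exact Form.IsExtDeriv.add (h i (Finset.mem_insert_self _ _)) (Form.IsSmooth.sum s fun j hj => h j (hs j hj))
      (h' i (Finset.mem_insert_self _ _)) (ih (fun j hj => h j (hs j hj)) fun j hj => h' j (hs j hj))

lemma Form.isSmooth_of_contDiffAt {α : Form m M k}
    (h : ∀ x₀ : M, ∀ y ∈ (extChartAt (𝓡 m) x₀).target, ContDiffAt ℝ ∞ (α.inChart x₀) y) : α.IsSmooth :=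
  fun x₀ y hy => (h x₀ y hy).contDiffWithinAt

lemma eventually_symm {x₀ : M} {y : 𝔼} (hy : y ∈ (extChartAt (𝓡 m) x₀).target) {p : M → Prop}
    (h : ∀ᶠ x in nhds ((extChartAt (𝓡 m) x₀).symm y), p x) : ∀ᶠ y' in nhds y, p ((extChartAt (𝓡 m) x₀).symm y') :=
  (continuousAt_extChartAt_symm'' hy).eventually h

lemma Form.inChart_eventuallyEq {α β : Form m M k} {x₀ : M} {y : 𝔼} (hy : y ∈ (extChartAt (𝓡 m) x₀).target)
    (h : ∀ᶠ x in nhds ((extChartAt (𝓡 m) x₀).symm y), α.ev x = β.ev x) :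
    α.inChart x₀ =ᶠ[nhds y] β.inChart x₀ := by
  filter_upwards [eventually_symm hy h] with y' h'
  ext v
  rw [Form.inChart_apply, Form.inChart_apply, h']

variable [IsManifold (𝓡 m) ∞ M]

lemma chart_mfderiv_comp {x₀ x : M} (hx : x ∈ (extChartAt (𝓡 m) x₀).source) (v : 𝔼) :
    symmD x₀ (extChartAt (𝓡 m) x₀ x) (chartD x₀ x v) = v := by
  have hx' := hx
  rw [extChartAt_source] at hx'
  have h1 : HasMFDerivAt (𝓡 m) 𝓘(ℝ, 𝔼) (extChartAt (𝓡 m) x₀) x (mfderiv (𝓡 m) 𝓘(ℝ, 𝔼) (extChartAt (𝓡 m) x₀) x) :=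
    (mdifferentiableAt_extChartAt hx').hasMFDerivAt
  have h2 := ((mdifferentiableAt_extChartAt_symm ((extChartAt (𝓡 m) x₀).map_source hx)).hasMFDerivAt.comp x h1)
  have h3 : ((extChartAt (𝓡 m) x₀).symm ∘ extChartAt (𝓡 m) x₀) =ᶠ[nhds x] id := by
    filter_upwards [(isOpen_extChartAt_source x₀).mem_nhds hx] with z hz
    exact (extChartAt (𝓡 m) x₀).left_inv hz
  have h4 := hasMFDerivAt_unique (h2.congr_of_eventuallyEq h3.symm) (hasMFDerivAt_id x)
  exact congrArg (fun L : 𝔼 →L[ℝ] 𝔼 => L v) h4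

lemma chart_symm_mfderiv_comp {x₀ : M} {y : 𝔼} (hy : y ∈ (extChartAt (𝓡 m) x₀).target) (v : 𝔼) :
    chartD x₀ ((extChartAt (𝓡 m) x₀).symm y) (symmD x₀ y v) = v := by
  have hx' := (extChartAt (𝓡 m) x₀).map_target hy
  rw [extChartAt_source] at hx'
  have h2 := (mdifferentiableAt_extChartAt (I := 𝓡 m) hx').hasMFDerivAt.comp y
    (mdifferentiableAt_extChartAt_symm hy).hasMFDerivAt
  have h3 : (extChartAt (𝓡 m) x₀ ∘ (extChartAt (𝓡 m) x₀).symm) =ᶠ[nhds y] id := by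
    filter_upwards [(isOpen_extChartAt_target x₀).mem_nhds hy] with z hz
    exact (extChartAt (𝓡 m) x₀).right_inv hz
  have h4 := hasMFDerivAt_unique (h2.congr_of_eventuallyEq h3.symm) (hasMFDerivAt_id y)
  exact congrArg (fun L : 𝔼 →L[ℝ] 𝔼 => L v) h4

/-- The form on the domain of the chart at `x₀` with a given chart expression, extended by zero. -/
def chartForm (x₀ : M) (Z : 𝔼 → 𝔼 [⋀^Fin k]→L[ℝ] ℝ) : Form m M k := fun x =>
  open Classical in
  if x ∈ (extChartAt (𝓡 m) x₀).source then
    (Z (extChartAt (𝓡 m) x₀ x)).compContinuousLinearMap (chartD x₀ x)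
  else 0

lemma chartForm_ev {x₀ x : M} (hx : x ∈ (extChartAt (𝓡 m) x₀).source) (Z : 𝔼 → 𝔼 [⋀^Fin k]→L[ℝ] ℝ) (v : Fin k → 𝔼) :
    (chartForm x₀ Z).ev x v = Z (extChartAt (𝓡 m) x₀ x) fun i => chartD x₀ x (v i) := by
  unfold Form.ev chartForm
  rw [if_pos hx]
  rfl

lemma chartForm_ev_of_notMem {x₀ x : M} (hx : x ∉ (extChartAt (𝓡 m) x₀).source) (Z : 𝔼 → 𝔼 [⋀^Fin k]→L[ℝ] ℝ) :
    (chartForm x₀ Z).ev x = 0 := by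
  unfold Form.ev chartForm
  rw [if_neg hx]
  rfl

lemma chartForm_inChart {x₀ : M} {y : 𝔼} (hy : y ∈ (extChartAt (𝓡 m) x₀).target) (Z : 𝔼 → 𝔼 [⋀^Fin k]→L[ℝ] ℝ) :
    (chartForm x₀ Z).inChart x₀ y = Z y := by
  ext v
  rw [Form.inChart_apply, chartForm_ev ((extChartAt (𝓡 m) x₀).map_target hy), (extChartAt (𝓡 m) x₀).right_inv hy]
  congr 1
  funext i
  exact chart_symm_mfderiv_comp hy (v i)

lemma Form.eq_of_inChart_eq {α β : Form m M k} {x₀ x : M} (hx : x ∈ (extChartAt (𝓡 m) x₀).source)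
    (h : α.inChart x₀ (extChartAt (𝓡 m) x₀ x) = β.inChart x₀ (extChartAt (𝓡 m) x₀ x)) : α.ev x = β.ev x := by
  ext v
  have h1 := congrArg (fun A => A fun i => chartD x₀ x (v i)) h
  simp only [Form.inChart_apply] at h1
  have h2 : (fun i => symmD x₀ (extChartAt (𝓡 m) x₀ x) (chartD x₀ x (v i))) = v := funext fun i => chart_mfderiv_comp hx (v i)
  have key : ∀ (x' : M), x' = x → ∀ w : Fin k → 𝔼, w = v → α.ev x' w = β.ev x' w → α.ev x v = β.ev x v := by
    rintro _ rfl _ rfl h; exact h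
  exact key _ ((extChartAt (𝓡 m) x₀).left_inv hx) _ h2 h1

lemma Form.IsExtDeriv.unique {α : Form m M k} {β β' : Form m M (k + 1)} (h : α.IsExtDeriv β) (h' : α.IsExtDeriv β') :
    β = β' := Form.ext_ev fun x => Form.eq_of_inChart_eq (mem_extChartAt_source x)
  ((h x _ (mem_extChartAt_target x)).symm.trans (h' x _ (mem_extChartAt_target x)))

/-- Transition between the expressions of a form in two charts. -/
lemma Form.inChart_eventuallyEq_change (α : Form m M k) {x₀ x₁ : M} {y : 𝔼} (hy : y ∈ (extChartAt (𝓡 m) x₀).target)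
    (hx : (extChartAt (𝓡 m) x₀).symm y ∈ (extChartAt (𝓡 m) x₁).source) :
    α.inChart x₀ =ᶠ[nhds y] fun y' => (α.inChart x₁ ((extChartAt (𝓡 m) x₁ ∘ (extChartAt (𝓡 m) x₀).symm) y')).compContinuousLinearMap
      (fderiv ℝ (extChartAt (𝓡 m) x₁ ∘ (extChartAt (𝓡 m) x₀).symm) y') :=
  pb_eventuallyEq_inChart α (contMDiffAt_extChartAt_symm hy) hx

lemma Form.contDiffAt_inChart_change {α : Form m M k} {x₀ x₁ : M} {y : 𝔼} (hy : y ∈ (extChartAt (𝓡 m) x₀).target)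
    (hx : (extChartAt (𝓡 m) x₀).symm y ∈ (extChartAt (𝓡 m) x₁).source)
    (h : ContDiffAt ℝ ∞ (α.inChart x₁) (extChartAt (𝓡 m) x₁ ((extChartAt (𝓡 m) x₀).symm y))) :
    ContDiffAt ℝ ∞ (α.inChart x₀) y := by
  have h1 := contDiffAt_chart_comp le_rfl (contMDiffAt_extChartAt_symm hy) hx
  refine ContDiffAt.congr_of_eventuallyEq ?_ (α.inChart_eventuallyEq_change hy hx)
  exact contDiffAt_alternating_comp (F := α.inChart x₁ ∘ (extChartAt (𝓡 m) x₁ ∘ (extChartAt (𝓡 m) x₀).symm))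
    (ContDiffAt.comp y h h1) (h1.fderiv_right (m := ∞) (by simp))

/-- Naturality of d under transition maps: to compute d at a point, any one chart around it will do.
-/
lemma Form.extDeriv_inChart_change {α : Form m M k} {β : Form m M (k + 1)} {x₀ x₁ : M} {y : 𝔼}
    (hy : y ∈ (extChartAt (𝓡 m) x₀).target)
    (hx : (extChartAt (𝓡 m) x₀).symm y ∈ (extChartAt (𝓡 m) x₁).source)
    (hα : DifferentiableAt ℝ (α.inChart x₁) (extChartAt (𝓡 m) x₁ ((extChartAt (𝓡 m) x₀).symm y)))
    (h : extDeriv (α.inChart x₁) (extChartAt (𝓡 m) x₁ ((extChartAt (𝓡 m) x₀).symm y)) =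
      β.inChart x₁ (extChartAt (𝓡 m) x₁ ((extChartAt (𝓡 m) x₀).symm y))) :
    extDeriv (α.inChart x₀) y = β.inChart x₀ y := by
  rw [(α.inChart_eventuallyEq_change hy hx).extDeriv_eq, (β.inChart_eventuallyEq_change hy hx).eq_of_nhds]
  refine (extDeriv_pullback (r := ∞) (f := extChartAt (𝓡 m) x₁ ∘ (extChartAt (𝓡 m) x₀).symm) hα (contDiffAt_chart_comp le_rfl (contMDiffAt_extChartAt_symm hy) hx) ?_).trans ?_
  · rw [minSmoothness_of_isRCLikeNormedField]; exact two_le_infty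
  · exact congrArg (fun A => A.compContinuousLinearMap (fderiv ℝ (extChartAt (𝓡 m) x₁ ∘ (extChartAt (𝓡 m) x₀).symm) y)) h

lemma contDiffAt_extDeriv {W : Type*} [NormedAddCommGroup W] [NormedSpace ℝ W] {θ : W → W [⋀^Fin k]→L[ℝ] ℝ} {y : W}
    (h : ContDiffAt ℝ ∞ θ y) : ContDiffAt ℝ ∞ (extDeriv θ) y :=
  ContDiffAt.comp (g := ContinuousAlternatingMap.alternatizeUncurryFinCLM ℝ W ℝ) y
    (ContinuousLinearMap.contDiff _).contDiffAt (h.fderiv_right (m := ∞) (by simp))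

/-- Every smooth form has an exterior derivative. -/
lemma Form.IsSmooth.exists_isExtDeriv {α : Form m M k} (hα : α.IsSmooth) : ∃ β : Form m M (k + 1), α.IsExtDeriv β := by
  -- The derivative at x is computed in the chart at x itself; the transition rule then gives it in
  -- all charts.
  refine ⟨fun x => (chartForm x (extDeriv (α.inChart x))).ev x, fun x₀ y hy => ?_⟩
  set x := (extChartAt (𝓡 m) x₀).symm y with hx
  have hx' := mem_extChartAt_source (I := 𝓡 m) x
  have h1 := Form.extDeriv_inChart_change (α := α) (β := chartForm x (extDeriv (α.inChart x))) hy hx'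
    (hα.differentiableAt x (mem_extChartAt_target x)) (chartForm_inChart (mem_extChartAt_target x) _).symm
  rw [h1]
  ext v
  rw [Form.inChart_apply, ← hx]
  rfl

lemma Form.IsExtDeriv.isSmooth {α : Form m M k} {β : Form m M (k + 1)} (hα : α.IsSmooth) (h : α.IsExtDeriv β) :
    β.IsSmooth := Form.isSmooth_of_contDiffAt fun x₀ y hy => by
  refine (contDiffAt_extDeriv (hα.contDiffAt_inChart hy)).congr_of_eventuallyEq ?_
  filter_upwards [(isOpen_extChartAt_target x₀).mem_nhds hy] with y' hy'
  exact (h x₀ y' hy').symm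

lemma Form.IsExtDeriv.isClosed {α : Form m M k} {β : Form m M (k + 1)} (hα : α.IsSmooth) (h : α.IsExtDeriv β) :
    β.IsClosed := ⟨h.isSmooth hα, fun x₀ y hy => by
  have h1 : β.inChart x₀ =ᶠ[nhds y] extDeriv (α.inChart x₀) := by
    filter_upwards [(isOpen_extChartAt_target x₀).mem_nhds hy] with y' hy'
    exact (h x₀ y' hy').symm
  rw [h1.extDeriv_eq, Form.inChart_zero]
  exact extDeriv_extDeriv_apply (r := ∞) (hα.contDiffAt_inChart hy) (by
    rw [minSmoothness_of_isRCLikeNormedField]; exact two_le_infty)⟩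

lemma Form.IsExtDeriv.ev_eq_zero {α : Form m M k} {β : Form m M (k + 1)} (h : α.IsExtDeriv β) {x : M}
    (hx : ∀ᶠ x' in nhds x, α.ev x' = 0) : β.ev x = 0 := by
  refine Form.eq_of_inChart_eq (β := 0) (mem_extChartAt_source (I := 𝓡 m) x) ?_
  have hy := mem_extChartAt_target (I := 𝓡 m) x
  rw [← h x _ hy, ← Form.isExtDeriv_zero x _ hy]
  refine Filter.EventuallyEq.extDeriv_eq (Form.inChart_eventuallyEq hy ?_)
  rw [(extChartAt (𝓡 m) x).left_inv (mem_extChartAt_source (I := 𝓡 m) x)]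
  exact hx

/-- The form with a given compactly supported expression in one chart is smooth. -/
lemma chartForm_isSmooth [T2Space M] [CompactSpace M] {x₀ : M} {Z : 𝔼 → 𝔼 [⋀^Fin k]→L[ℝ] ℝ} (hZ : ContDiff ℝ ∞ Z) {K : Set 𝔼}
    (hK : IsCompact K) (hKt : K ⊆ (extChartAt (𝓡 m) x₀).target) (hZ0 : ∀ y ∉ K, Z y = 0) :
    (∀ x ∉ (extChartAt (𝓡 m) x₀).symm '' K, (chartForm x₀ Z).ev x = 0) ∧ _root_.IsClosed ((extChartAt (𝓡 m) x₀).symm '' K) ∧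
    (chartForm x₀ Z).IsSmooth ∧ ∀ θ : Form m M (k + 1),
      (∀ y ∈ (extChartAt (𝓡 m) x₀).target, θ.inChart x₀ y = extDeriv Z y) →
      (∀ x ∉ (extChartAt (𝓡 m) x₀).source, θ.ev x = 0) → (chartForm x₀ Z).IsExtDeriv θ := by
  have hL : _root_.IsClosed ((extChartAt (𝓡 m) x₀).symm '' K) :=
    (hK.image_of_continuousOn ((continuousOn_extChartAt_symm x₀).mono hKt)).isClosed
  have h0 : ∀ x ∉ (extChartAt (𝓡 m) x₀).symm '' K, (chartForm x₀ Z).ev x = 0 := by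
    intro x hx
    by_cases hs : x ∈ (extChartAt (𝓡 m) x₀).source
    · ext v
      rw [chartForm_ev hs, hZ0]
      · rfl
      · exact fun h => hx ⟨_, h, (extChartAt (𝓡 m) x₀).left_inv hs⟩
    · exact chartForm_ev_of_notMem hs Z
  have hloc : ∀ y ∈ (extChartAt (𝓡 m) x₀).target, (chartForm x₀ Z).inChart x₀ =ᶠ[nhds y] Z := fun y hy => by
    filter_upwards [(isOpen_extChartAt_target x₀).mem_nhds hy] with y' hy'
    exact chartForm_inChart hy' Z
  -- The image of K is closed, so a point outside the chart domain has a neighbourhood on which the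
  -- form is zero. Extension by zero is therefore harmless.
  have hout : ∀ x ∉ (extChartAt (𝓡 m) x₀).source, ∀ᶠ x' in nhds x, (chartForm x₀ Z).ev x' = (0 : Form m M k).ev x' := by
    intro x hx
    have hxL : x ∉ (extChartAt (𝓡 m) x₀).symm '' K := by
      rintro ⟨y, hy, rfl⟩; exact hx ((extChartAt (𝓡 m) x₀).map_target (hKt hy))
    filter_upwards [hL.isOpen_compl.mem_nhds hxL] with x' hx'
    exact h0 x' hx'
  refine ⟨h0, hL, Form.isSmooth_of_contDiffAt fun x₁ y hy => ?_, fun θ hθ hθ0 x₁ y hy => ?_⟩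
  · by_cases hs : (extChartAt (𝓡 m) x₁).symm y ∈ (extChartAt (𝓡 m) x₀).source
    · exact Form.contDiffAt_inChart_change hy hs
        (hZ.contDiffAt.congr_of_eventuallyEq (hloc _ ((extChartAt (𝓡 m) x₀).map_source hs)))
    · refine ContDiffAt.congr_of_eventuallyEq ?_ (Form.inChart_eventuallyEq hy (hout _ hs))
      rw [Form.inChart_zero]; exact contDiffAt_const
  · by_cases hs : (extChartAt (𝓡 m) x₁).symm y ∈ (extChartAt (𝓡 m) x₀).source
    · have ht := (extChartAt (𝓡 m) x₀).map_source hs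
      refine Form.extDeriv_inChart_change hy hs ?_ ?_
      · exact (hZ.contDiffAt.congr_of_eventuallyEq (hloc _ ht)).differentiableAt (by simp)
      · rw [(hloc _ ht).extDeriv_eq, hθ _ ht]
    · rw [(Form.inChart_eventuallyEq hy (hout _ hs)).extDeriv_eq, Form.isExtDeriv_zero x₁ y hy,
        Form.inChart_eq_zero (hθ0 _ hs), Form.inChart_zero]
      rfl

/-- The Leibniz rule for a function which is only differentiable near the support of the form. -/
lemma Form.fsmul_isSmooth_isExtDeriv {f : M → ℝ} {a : Form m M 1} (ha : a.IsSmooth) {N : Set M} (hf : IsPrimitiveOn a f N)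
    {η : Form m M k} {θ : Form m M (k + 1)} (hη : η.IsSmooth) (hηθ : η.IsExtDeriv θ) {K : Set M} (hK : _root_.IsClosed K)
    (hKN : K ⊆ N) (hη0 : ∀ x ∉ K, η.ev x = 0) :
    (η.fsmul f).IsSmooth ∧ (η.fsmul f).IsExtDeriv ((-1 : ℝ) ^ k • η.wedgeOne a + θ.fsmul f) := by
  have hder : ∀ x₀ : M, ∀ y ∈ (extChartAt (𝓡 m) x₀).target, (extChartAt (𝓡 m) x₀).symm y ∈ N →
      HasFDerivAt (f ∘ (extChartAt (𝓡 m) x₀).symm) (linL 𝔼 (a.inChart x₀ y)) y := fun x₀ y hy hN =>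
    hf.hasFDerivAt_comp (mdifferentiableAt_extChartAt_symm hy) hN
  have hsm : ∀ x₀ : M, ∀ y ∈ (extChartAt (𝓡 m) x₀).target, (extChartAt (𝓡 m) x₀).symm y ∈ N →
      ContDiffAt ℝ ∞ (f ∘ (extChartAt (𝓡 m) x₀).symm) y := by
    intro x₀ y hy hN
    have hev : ∀ᶠ y' in nhds y, y' ∈ (extChartAt (𝓡 m) x₀).target ∧ (extChartAt (𝓡 m) x₀).symm y' ∈ N :=
      Filter.Eventually.and ((isOpen_extChartAt_target x₀).mem_nhds hy) (eventually_symm hy (hf.1.mem_nhds hN))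
    -- Near y the derivative of f is the chart expression of the smooth form `a`, so f is smooth
    -- there.
    refine contDiffAt_infty.2 fun n => ContDiffAt.of_le (m := (n : WithTop ℕ∞)) (n := ((n : WithTop ℕ∞) + 1)) ?_ (by exact_mod_cast Nat.le_succ n)
    refine contDiffAt_succ_iff_hasFDerivAt.2 ⟨fun y => linL 𝔼 (a.inChart x₀ y), ⟨_, hev, fun y' hy' => hder x₀ y' hy'.1 hy'.2⟩, ?_⟩
    exact ((linL 𝔼).contDiff.contDiffAt.comp y (ha.contDiffAt_inChart hy)).of_le (by exact_mod_cast le_top)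
  -- Off N the form η vanishes near the point, and the behaviour of f there does not matter.
  have hout : ∀ x ∉ N, ∀ᶠ x' in nhds x, η.ev x' = 0 := fun x hx => by
    filter_upwards [hK.isOpen_compl.mem_nhds fun h => hx (hKN h)] with x' hx' using hη0 x' hx'
  have hout2 : ∀ x ∉ N, ∀ᶠ x' in nhds x, (η.fsmul f).ev x' = (0 : Form m M k).ev x' := fun x hx => by
    filter_upwards [hout x hx] with x' hx'
    rw [Form.ev_fsmul, hx', smul_zero]; rfl
  refine ⟨Form.isSmooth_of_contDiffAt fun x₀ y hy => ?_, fun x₀ y hy => ?_⟩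
  · by_cases hN : (extChartAt (𝓡 m) x₀).symm y ∈ N
    · rw [Form.inChart_fsmul]
      exact (hsm x₀ y hy hN).smul (hη.contDiffAt_inChart hy)
    · refine ContDiffAt.congr_of_eventuallyEq ?_ (Form.inChart_eventuallyEq hy (hout2 _ hN))
      rw [Form.inChart_zero]; exact contDiffAt_const
  · by_cases hN : (extChartAt (𝓡 m) x₀).symm y ∈ N
    · ext v
      rw [Form.inChart_fsmul]
      have h1 := extDeriv_fun_mul_apply (f := f ∘ (extChartAt (𝓡 m) x₀).symm) (hder x₀ y hy hN).differentiableAt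
        (hη.differentiableAt x₀ hy) v
      refine h1.trans ?_
      rw [(hder x₀ y hy hN).fderiv, hηθ x₀ y hy, Form.inChart_add, Form.inChart_smul, Form.inChart_fsmul]
      have h2 := Form.inChart_wedgeOne η a x₀ y v
      have h3 : ((linL 𝔼 (a.inChart x₀ y) : 𝔼 →L[ℝ] ℝ) : 𝔼 →ₗ[ℝ] ℝ) = lin (a.inChart x₀ y) := by
        ext x; exact linL_apply _ _
      rw [h3]
      change _ = (-1 : ℝ) ^ k * (η.wedgeOne a).inChart x₀ y v + f ((extChartAt (𝓡 m) x₀).symm y) * θ.inChart x₀ y v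
      rw [h2, ← mul_assoc, ← pow_add, Even.neg_one_pow ⟨k, rfl⟩, one_mul, add_comm]
      rfl
    · rw [(Form.inChart_eventuallyEq hy (hout2 _ hN)).extDeriv_eq, Form.isExtDeriv_zero x₀ y hy, Form.inChart_zero]
      have h1 : η.ev ((extChartAt (𝓡 m) x₀).symm y) = 0 := (hout _ hN).self_of_nhds
      have h2 : θ.ev ((extChartAt (𝓡 m) x₀).symm y) = 0 := hηθ.ev_eq_zero (hout _ hN)
      refine (Form.inChart_eq_zero ?_).symm
      ext v
      change (-1 : ℝ) ^ k * (η.wedgeOne a).ev _ v + f _ * θ.ev _ v = 0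
      rw [Form.wedgeOne_apply, h1, h2, eps_apply]
      simp

end FormCalculus

/-! ### Quotients by a volume form -/

section Ratio

variable {m : ℕ} {M : Type u} [TopologicalSpace M] [ChartedSpace (EuclideanSpace ℝ (Fin m)) M]

lemma Form.ratio_add (τ τ' ν : Form m M m) (x : M) : (τ + τ').ratio ν x = τ.ratio ν x + τ'.ratio ν x := add_div _ _ _

lemma Form.ratio_smul (c : ℝ) (τ ν : Form m M m) (x : M) : (c • τ).ratio ν x = c * τ.ratio ν x := mul_div_assoc _ _ _

lemma Form.ratio_fsmul (f : M → ℝ) (τ ν : Form m M m) (x : M) : (τ.fsmul f).ratio ν x = f x * τ.ratio ν x :=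
  mul_div_assoc _ _ _

lemma Form.ratio_zero (ν : Form m M m) (x : M) : (0 : Form m M m).ratio ν x = 0 := zero_div _

lemma Form.ratio_sum {ι : Type*} (s : Finset ι) (τ : ι → Form m M m) (ν : Form m M m) (x : M) :
    (∑ i ∈ s, τ i).ratio ν x = ∑ i ∈ s, (τ i).ratio ν x := by
  classical
  induction s using Finset.induction_on with
  | empty => exact Form.ratio_zero ν x
  | insert i s hi ih => rw [Finset.sum_insert hi, Finset.sum_insert hi, Form.ratio_add, ih]

lemma Form.ratio_eq_zero {τ ν : Form m M m} {x : M} (h : τ.ev x = 0) : τ.ratio ν x = 0 := by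
  have : (τ.ev x (stdB m)) / (ν.ev x (stdB m)) = 0 := by rw [h]; exact zero_div _
  exact this

lemma IsVolumeForm.ratio_self {ν : Form m M m} (hν : IsVolumeForm ν) (x : M) : ν.ratio ν x = 1 :=
  div_self fun h => hν.ne_zero x ((top_ne_zero_iff _).1 h)

variable [IsManifold (𝓡 m) ∞ M]

lemma IsVolumeForm.continuous_ratio {ν τ : Form m M m} (hν : IsVolumeForm ν) (hτ : τ.IsSmooth) :
    Continuous (τ.ratio ν) := continuous_iff_continuousAt.2 fun x => by
  have hy := mem_extChartAt_target (I := 𝓡 m) x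
  have h1 : τ.ratio ν =ᶠ[nhds x] fun x' => τ.dens x (extChartAt (𝓡 m) x x') / ν.dens x (extChartAt (𝓡 m) x x') := by
    filter_upwards [extChartAt_source_mem_nhds (I := 𝓡 m) x] with x' hx'
    have h2 := hν.ratio_mul τ x (extChartAt (𝓡 m) x x')
    rw [(extChartAt (𝓡 m) x).left_inv hx'] at h2
    rw [← h2, mul_div_cancel_right₀ _ (hν.dens_ne_zero ((extChartAt (𝓡 m) x).map_source hx'))]
  refine ContinuousAt.congr ?_ h1.symm
  exact ((hτ.contDiffAt_dens hy).continuousAt.comp (f := extChartAt (𝓡 m) x) (continuousAt_extChartAt x)).div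
    ((hν.smooth.contDiffAt_dens hy).continuousAt.comp (f := extChartAt (𝓡 m) x) (continuousAt_extChartAt x)) (hν.dens_ne_zero hy)

/-- A density without zeros has constant sign on a ball, by connectedness. This turns the absolute
value in the measure into a constant factor, so integrals against μ become integrals of forms. -/
lemma IsVolumeForm.exists_sign {ν : Form m M m} (hν : IsVolumeForm ν) {x₀ : M} {c : EuclideanSpace ℝ (Fin m)} {r : ℝ}
    (hr : Metric.ball c r ⊆ (extChartAt (𝓡 m) x₀).target) :
    ∃ s : ℝ, s ≠ 0 ∧ ∀ y ∈ Metric.ball c r, |ν.dens x₀ y| = s * ν.dens x₀ y := by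
  by_cases h : ∀ y ∈ Metric.ball c r, 0 < ν.dens x₀ y
  · exact ⟨1, one_ne_zero, fun y hy => by rw [one_mul, abs_of_pos (h y hy)]⟩
  · push Not at h
    obtain ⟨y₀, hy₀, h0⟩ := h
    refine ⟨-1, by norm_num, fun y hy => ?_⟩
    rw [abs_of_nonpos, neg_one_mul]
    by_contra! h1
    obtain ⟨z, hz, hz0⟩ := (convex_ball c r).isPreconnected.intermediate_value hy₀ hy
      ((hν.smooth.continuousOn_dens x₀).mono hr) ⟨h0, h1.le⟩
    exact hν.dens_ne_zero (hr hz) hz0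

lemma Form.IsSmooth.wedgeOne {k : ℕ} {η : Form m M k} {a : Form m M 1} (hη : η.IsSmooth) (ha : a.IsSmooth) :
    (η.wedgeOne a).IsSmooth := Form.isSmooth_of_contDiffAt fun x₀ y hy => by
  refine contDiffAt_alternating_of_apply fun v => ?_
  simp only [Form.inChart_wedgeOne, eps_apply, lin_apply]
  refine contDiffAt_const.mul (ContDiffAt.sum fun i _ => contDiffAt_const.mul (ContDiffAt.mul ?_ ?_))
  · exact contDiffAt_alternating_apply (ha.contDiffAt_inChart hy) fun _ => contDiffAt_const
  · exact contDiffAt_alternating_apply (hη.contDiffAt_inChart hy) fun _ => contDiffAt_const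

end Ratio

/-! ### Stokes' theorem and exact forms -/

section Stokes

open MeasureTheory

variable {d : ℕ} {M : Type u} [TopologicalSpace M] [ChartedSpace (EuclideanSpace ℝ (Fin (d + 1))) M]
  [IsManifold (𝓡 (d + 1)) ∞ M] [MeasurableSpace M] [BorelSpace M] [T2Space M] [CompactSpace M]

local notation "𝔼" => EuclideanSpace ℝ (Fin (d + 1))

variable {ν : Form (d + 1) M (d + 1)} {μ : Measure M}

lemma IsVolumeMeasure.integrable (hμ : IsVolumeMeasure ν μ) {f : M → ℝ} (hf : Continuous f) : Integrable f μ := by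
  have := hμ.finite
  obtain ⟨C, hC⟩ := isCompact_univ.exists_bound_of_continuousOn hf.continuousOn
  exact Integrable.of_bound hf.aestronglyMeasurable C (Filter.Eventually.of_forall fun x => hC x trivial)

lemma contDiff_extend {F : Type*} [NormedAddCommGroup F] [NormedSpace ℝ F] {g : 𝔼 → F} {U K : Set 𝔼} (hU : IsOpen U)
    (hK : _root_.IsClosed K) (hKU : K ⊆ U) (hg : ∀ y ∈ U, ContDiffAt ℝ ∞ g y) (hg0 : ∀ y ∈ U, y ∉ K → g y = 0) :
    ContDiff ℝ ∞ (U.indicator g) ∧ ∀ y ∉ K, U.indicator g y = 0 := by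
  have h0 : ∀ y ∉ K, U.indicator g y = 0 := fun y hy => by
    by_cases hyU : y ∈ U
    · rw [Set.indicator_of_mem hyU, hg0 y hyU hy]
    · exact Set.indicator_of_notMem hyU _
  refine ⟨contDiff_iff_contDiffAt.2 fun y => ?_, h0⟩
  by_cases hyU : y ∈ U
  · refine (hg y hyU).congr_of_eventuallyEq ?_
    filter_upwards [hU.mem_nhds hyU] with y' hy' using Set.indicator_of_mem hy' _
  · refine contDiffAt_const (c := (0 : F)) |>.congr_of_eventuallyEq ?_
    filter_upwards [hK.isOpen_compl.mem_nhds fun h => hyU (hKU h)] with y' hy' using h0 y' hy'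

/-- Stokes' theorem for a form supported in a chart ball. -/
lemma integral_ratio_eq_zero_of_chartBall (hν : IsVolumeForm ν) (hμ : IsVolumeMeasure ν μ) {x₀ : M} {r : ℝ}
    (hr : Metric.ball (extChartAt (𝓡 (d + 1)) x₀ x₀) r ⊆ (extChartAt (𝓡 (d + 1)) x₀).target)
    {ξ : Form (d + 1) M d} {τ : Form (d + 1) M (d + 1)} (hξ : ξ.IsSmooth) (hτ : ξ.IsExtDeriv τ) {K : Set M}
    (hK : _root_.IsClosed K) (hKr : K ⊆ chartBall (m := d + 1) x₀ r) (hξ0 : ∀ x ∉ K, ξ.ev x = 0) :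
    ∫ x, τ.ratio ν x ∂μ = 0 := by
  set e := extChartAt (𝓡 (d + 1)) x₀
  have hτ0 : ∀ x ∉ K, τ.ev x = 0 := fun x hx => hτ.ev_eq_zero (by
    filter_upwards [hK.isOpen_compl.mem_nhds hx] with x' hx' using hξ0 x' hx')
  rw [hμ.integral_eq hν x₀ (hν.continuous_ratio (hτ.isSmooth hξ)).measurable
    fun x hx => Form.ratio_eq_zero (hτ0 x fun h => hx (hKr h).1)]
  obtain ⟨s, -, hs⟩ := hν.exists_sign hr
  have hKe : IsCompact (e '' K) := hK.isCompact.image_of_continuousOn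
    ((continuousOn_extChartAt x₀).mono fun x hx => (hKr hx).1)
  have hKt : e '' K ⊆ e.target := by rintro _ ⟨x, hx, rfl⟩; exact e.map_source (hKr hx).1
  have hnot : ∀ y ∈ e.target, y ∉ e '' K → e.symm y ∉ K := fun y hy h h' => h ⟨_, h', e.right_inv hy⟩
  obtain ⟨hΞ, hΞ0⟩ := contDiff_extend (g := ξ.inChart x₀) (isOpen_extChartAt_target x₀) hKe.isClosed hKt
    (fun y hy => hξ.contDiffAt_inChart hy) (fun y hy h => Form.inChart_eq_zero (hξ0 _ (hnot y hy h)))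
  -- Where ξ lives, |ν| times the quotient is a constant sign times the density of dξ; elsewhere
  -- both sides vanish.
  have h1 : ∀ y ∈ e.target, |ν.dens x₀ y| * τ.ratio ν (e.symm y) =
      s * extDeriv (e.target.indicator (ξ.inChart x₀)) y (stdB (d + 1)) := by
    intro y hy
    have h2 : extDeriv (e.target.indicator (ξ.inChart x₀)) y = τ.inChart x₀ y := by
      rw [← hτ x₀ y hy]
      refine Filter.EventuallyEq.extDeriv_eq ?_
      filter_upwards [(isOpen_extChartAt_target x₀).mem_nhds hy] with y' hy' using Set.indicator_of_mem hy' _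
    rw [h2]
    by_cases hyK : y ∈ e '' K
    · obtain ⟨x, hx, rfl⟩ := hyK
      rw [hs _ (hKr hx).2, mul_assoc, mul_comm (ν.dens _ _), hν.ratio_mul]
      rfl
    · rw [Form.ratio_eq_zero (hτ0 _ (hnot y hy hyK)), Form.inChart_eq_zero (hτ0 _ (hnot y hy hyK))]
      simp
  rw [setIntegral_congr_fun (isOpen_extChartAt_target x₀).measurableSet h1,
    setIntegral_eq_integral_of_forall_compl_eq_zero, integral_const_mul,
    integral_extDeriv_eq_zero (hΞ.of_le (by exact_mod_cast le_top)) (HasCompactSupport.intro hKe hΞ0), mul_zero]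
  intro y hy
  have h3 : e.target.indicator (ξ.inChart x₀) =ᶠ[nhds y] fun _ => (0 : 𝔼 [⋀^Fin d]→L[ℝ] ℝ) := by
    filter_upwards [hKe.isClosed.isOpen_compl.mem_nhds fun h => hy (hKt h)] with y' hy' using hΞ0 y' hy'
  rw [h3.extDeriv_eq, extDeriv_apply (differentiableAt_const _)]
  simp

/-- The wedge product of a closed `1`-form and an exact form has integral zero. -/
lemma integral_ratio_wedgeOne_exact {d : ℕ} {M : Type u} [TopologicalSpace M]
    [ChartedSpace (EuclideanSpace ℝ (Fin (d + 1 + 1))) M]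
    [IsManifold (𝓡 (d + 1 + 1)) ∞ M] [MeasurableSpace M] [BorelSpace M] [T2Space M] [CompactSpace M]
    {ν : Form (d + 1 + 1) M (d + 1 + 1)} {μ : Measure M} (hν : IsVolumeForm ν) (hμ : IsVolumeMeasure ν μ)
    {ζ : Form (d + 1 + 1) M d} {η : Form (d + 1 + 1) M (d + 1)} (hζ : ζ.IsSmooth) (hη : ζ.IsExtDeriv η)
    {a : Form (d + 1 + 1) M 1} (ha : a.IsClosed) : ∫ x, (η.wedgeOne a).ratio ν x ∂μ = 0 := by
  have h1 : ∀ x : M, ∃ r > 0, Metric.ball (extChartAt (𝓡 (d + 1 + 1)) x x) r ⊆ (extChartAt (𝓡 (d + 1 + 1)) x).target := fun x =>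
    Metric.nhds_basis_ball.mem_iff.1 (extChartAt_target_mem_nhds x)
  choose r hr hball using h1
  obtain ⟨t, ht⟩ := isCompact_univ.elim_finite_subcover (fun x => chartBall (m := d + 1 + 1) x (r x))
    (fun x => isOpen_chartBall x _) (fun x _ => Set.mem_iUnion.2 ⟨x, mem_chartBall_self x (hr x)⟩)
  -- Splitting ζ rather than η keeps every piece exact: each θ_i = d(ρ_i ζ) is closed and supported
  -- in a chart ball, where `a` = df.
  obtain ⟨ρ, hρ⟩ := SmoothPartitionOfUnity.exists_isSubordinate (ι := t) (𝓡 (d + 1 + 1)) (s := (Set.univ : Set M)) isClosed_univ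
    (fun x => chartBall (m := d + 1 + 1) x.1 (r x.1)) (fun x => isOpen_chartBall _ _) (fun x hx => by
      obtain ⟨y, hy, hxy⟩ := Set.mem_iUnion₂.1 (ht hx)
      exact Set.mem_iUnion.2 ⟨⟨y, hy⟩, hxy⟩)
  have hsum : ∑ i, ζ.fsmul (ρ i) = ζ := by
    refine Form.ext_ev fun x => ?_
    have h2 : ∑ i, ρ i x = 1 := by
      have := ρ.sum_eq_one (Set.mem_univ x)
      rwa [finsum_eq_sum_of_fintype] at this
    have h3 : (∑ i, ζ.fsmul (ρ i)).ev x = ∑ i, (ζ.fsmul (ρ i)).ev x := by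
      exact Finset.sum_apply x Finset.univ fun i => ζ.fsmul (ρ i)
    rw [h3]
    simp only [Form.ev_fsmul]
    rw [← Finset.sum_smul, h2, one_smul]
  have hsm : ∀ i, (ζ.fsmul (ρ i)).IsSmooth := fun i => Form.isSmooth_of_contDiffAt fun x₀ y hy => by
    rw [Form.inChart_fsmul]
    have h2 : ContDiffAt ℝ ∞ (fun y => ρ i ((extChartAt (𝓡 (d + 1 + 1)) x₀).symm y)) y :=
      contMDiffAt_iff_contDiffAt.1 ((ρ i).contMDiff.contMDiffAt.comp y (contMDiffAt_extChartAt_symm hy))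
    exact h2.smul (hζ.contDiffAt_inChart hy)
  choose θ hθ using fun i => (hsm i).exists_isExtDeriv
  have hηsum : η = ∑ i, θ i := by
    refine hη.unique ?_
    have := Form.IsExtDeriv.sum Finset.univ (fun i _ => hsm i) (fun i _ => hθ i)
    rwa [hsum] at this
  have hθs : ∀ i, (θ i).IsSmooth := fun i => (hθ i).isSmooth (hsm i)
  rw [hηsum, Form.wedgeOne_sum]
  simp only [Form.ratio_sum]
  rw [integral_finsetSum _ fun i _ => hμ.integrable (hν.continuous_ratio ((hθs i).wedgeOne ha.1))]
  refine Finset.sum_eq_zero fun i _ => ?_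
  have hζ0 : ∀ x ∉ tsupport (ρ i), (ζ.fsmul (ρ i)).ev x = 0 := fun x hx => by
    rw [Form.ev_fsmul, image_eq_zero_of_notMem_tsupport hx, zero_smul]
  have hθ0 : ∀ x ∉ tsupport (ρ i), (θ i).ev x = 0 := fun x hx => (hθ i).ev_eq_zero (by
    filter_upwards [(isClosed_tsupport (ρ i)).isOpen_compl.mem_nhds hx] with x' hx' using hζ0 x' hx')
  obtain ⟨f, hf⟩ := ha.exists_isPrimitiveOn_chartBall i.1 (hball i.1)
  -- As θ_i is closed, d(f θ_i) = ± θ_i ∧ a, and Stokes applies in the ball.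
  obtain ⟨h4, h5⟩ := Form.fsmul_isSmooth_isExtDeriv ha.1 hf (hθs i) ((hθ i).isClosed (hsm i)).2
    (isClosed_tsupport (ρ i)) (hρ i) hθ0
  have h6 := integral_ratio_eq_zero_of_chartBall hν hμ (hball i.1) h4 h5 (isClosed_tsupport (ρ i)) (hρ i) (fun x hx => by
    rw [Form.ev_fsmul, hθ0 x hx, smul_zero])
  have h7 : ∀ x, Form.ratio ((-1 : ℝ) ^ (d + 1) • (θ i).wedgeOne a + Form.fsmul f 0) ν x =
      (-1) ^ (d + 1) * ((θ i).wedgeOne a).ratio ν x := fun x => by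
    rw [Form.ratio_add, Form.ratio_smul, Form.ratio_fsmul, Form.ratio_zero, mul_zero, add_zero]
  simp only [h7] at h6
  rw [integral_const_mul] at h6
  exact (mul_eq_zero.1 h6).resolve_left (pow_ne_zero _ (by norm_num))

end Stokes

/-! ### The Poincaré dual of a loop -/

section PoincareDual

open MeasureTheory

variable {d : ℕ} {M : Type u} [TopologicalSpace M] [ChartedSpace (EuclideanSpace ℝ (Fin (d + 1))) M]
  [IsManifold (𝓡 (d + 1)) ∞ M] [MeasurableSpace M] [BorelSpace M] [T2Space M] [CompactSpace M]

local notation "𝔼" => EuclideanSpace ℝ (Fin (d + 1))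

variable {ν : Form (d + 1) M (d + 1)} {μ : Measure M}

/-- The preimage of a closed ball under the chart at `p`, centred at `p`. -/
def chartClosedBall (p : M) (r : ℝ) : Set M :=
  (extChartAt (𝓡 (d + 1)) p).symm '' Metric.closedBall (extChartAt (𝓡 (d + 1)) p p) r

lemma isClosed_chartClosedBall {p : M} {r : ℝ}
    (h : Metric.closedBall (extChartAt (𝓡 (d + 1)) p p) r ⊆ (extChartAt (𝓡 (d + 1)) p).target) :
    _root_.IsClosed (chartClosedBall (d := d) p r) :=
  ((isCompact_closedBall _ _).image_of_continuousOn ((continuousOn_extChartAt_symm p).mono h)).isClosed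

lemma chartClosedBall_subset {p : M} {r r' : ℝ} (hr : r < r')
    (h : Metric.ball (extChartAt (𝓡 (d + 1)) p p) r' ⊆ (extChartAt (𝓡 (d + 1)) p).target) :
    chartClosedBall (d := d) p r ⊆ chartBall (m := d + 1) p r' := by
  rintro _ ⟨y, hy, rfl⟩
  have hy' := Metric.closedBall_subset_ball hr hy
  refine ⟨(extChartAt _ p).map_target (h hy'), ?_⟩
  rwa [Set.mem_preimage, (extChartAt _ p).right_inv (h hy')]

lemma chartBall_subset_closedBall (p : M) (r : ℝ) : chartBall (m := d + 1) p r ⊆ chartClosedBall (d := d) p r :=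
  fun _ hx => ⟨_, Metric.ball_subset_closedBall hx.2, (extChartAt _ p).left_inv hx.1⟩

/-- The compact Poincaré lemma in a chart, and its pairing with closed `1`-forms. -/
lemma exists_primitive_fsmul (hν : IsVolumeForm ν) (hμ : IsVolumeMeasure ν μ) {x₀ : M} {ρ : ℝ} (hρ : 0 < ρ)
    (hb : Metric.ball (extChartAt (𝓡 (d + 1)) x₀ x₀) (3 * ρ) ⊆ (extChartAt (𝓡 (d + 1)) x₀).target) {g : M → ℝ}
    (hg : ContMDiff (𝓡 (d + 1)) 𝓘(ℝ, ℝ) ∞ g) (hg0 : ∀ x ∉ chartClosedBall (d := d) x₀ ρ, g x = 0) (hint : ∫ x, g x ∂μ = 0) :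
    ∃ η : Form (d + 1) M d, η.IsSmooth ∧ η.IsExtDeriv (ν.fsmul g) ∧
      ∀ (a : Form (d + 1) M 1) (f : M → ℝ), a.IsClosed → IsPrimitiveOn a f (chartBall (m := d + 1) x₀ (3 * ρ)) →
        (-1) ^ d * ∫ x, (η.wedgeOne a).ratio ν x ∂μ = -∫ x, f x * g x ∂μ := by
  set e := extChartAt (𝓡 (d + 1)) x₀
  have hc1 : Metric.closedBall (e x₀) ρ ⊆ e.target := (Metric.closedBall_subset_ball (by linarith)).trans hb
  have hc2 : Metric.closedBall (e x₀) (2 * ρ) ⊆ e.target := (Metric.closedBall_subset_ball (by linarith)).trans hb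
  have hcs1 : chartClosedBall (d := d) x₀ ρ ⊆ chartBall (m := d + 1) x₀ (3 * ρ) := chartClosedBall_subset (by linarith) hb
  have hcs2 : chartClosedBall (d := d) x₀ (2 * ρ) ⊆ chartBall (m := d + 1) x₀ (3 * ρ) := chartClosedBall_subset (by linarith) hb
  have hnot : ∀ y ∈ e.target, y ∉ Metric.closedBall (e x₀) ρ → e.symm y ∉ chartClosedBall (d := d) x₀ ρ := by
    rintro y hy h ⟨y', hy', h'⟩
    exact h (e.symm.injOn (hc1 hy') hy h' ▸ hy')
  -- The density of g ν in the chart, extended by zero. Its Lebesgue integral vanishes because `g`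
  -- has μ-integral zero and the sign of ν is constant.
  obtain ⟨hh, hh0⟩ := contDiff_extend (g := fun y => g (e.symm y) * ν.dens x₀ y) (isOpen_extChartAt_target x₀)
    Metric.isClosed_closedBall hc1 (fun y hy => (contMDiffAt_iff_contDiffAt.1
      (hg.contMDiffAt.comp y (contMDiffAt_extChartAt_symm hy))).mul (hν.smooth.contDiffAt_dens hy))
    (fun y hy h => by rw [hg0 _ (hnot y hy h), zero_mul])
  obtain ⟨s, hs0, hs⟩ := hν.exists_sign hb
  have hhint : ∫ y, e.target.indicator (fun y => g (e.symm y) * ν.dens x₀ y) y = 0 := by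
    have h1 := hμ.integral_eq hν x₀ hg.continuous.measurable fun x hx => hg0 x fun h => hx (hcs1 h).1
    have h2 : ∀ y ∈ e.target, |ν.dens x₀ y| * g (e.symm y) = s * (g (e.symm y) * ν.dens x₀ y) := by
      intro y hy
      by_cases h : y ∈ Metric.closedBall (e x₀) ρ
      · rw [hs y (Metric.closedBall_subset_ball (by linarith) h)]; ring
      · rw [hg0 _ (hnot y hy h)]; ring
    rw [hint, setIntegral_congr_fun (isOpen_extChartAt_target x₀).measurableSet h2, integral_const_mul] at h1
    rw [integral_indicator (isOpen_extChartAt_target x₀).measurableSet]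
    exact (mul_eq_zero.1 h1.symm).resolve_left hs0
  obtain ⟨Z, hZ, hZ0, hdZ⟩ := exists_extDeriv_eq hh hρ hh0 hhint
  obtain ⟨h1, h2, h3, h4⟩ := chartForm_isSmooth (x₀ := x₀) hZ (isCompact_closedBall _ _) hc2 hZ0
  have h5 := h4 (ν.fsmul g) (fun y hy => by
    rw [← sub_eq_zero, ← top_ne_zero_iff]
    change (ν.fsmul g).inChart x₀ y (stdB (d + 1)) - extDeriv Z y (stdB (d + 1)) = 0
    rw [hdZ, Set.indicator_of_mem hy, Form.inChart_fsmul, sub_eq_zero]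
    rfl) (fun x hx => by rw [Form.ev_fsmul, hg0 x fun h => hx (hcs1 h).1, zero_smul])
  refine ⟨_, h3, h5, fun a f ha hf => ?_⟩
  -- Stokes for f η, where d(f η) = (-1)^d η ∧ a + f g ν, gives the pairing.
  obtain ⟨h6, h7⟩ := Form.fsmul_isSmooth_isExtDeriv ha.1 hf h3 h5 h2 hcs2 h1
  have h8 := integral_ratio_eq_zero_of_chartBall hν hμ hb h6 h7 h2 hcs2 fun x hx => by
    rw [Form.ev_fsmul, h1 x hx, smul_zero]
  have h9 := hν.continuous_ratio (h3.wedgeOne ha.1)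
  have h10 : ∀ x, Form.ratio ((-1 : ℝ) ^ d • (chartForm x₀ Z).wedgeOne a + Form.fsmul f (ν.fsmul g)) ν x =
      (-1) ^ d * ((chartForm x₀ Z).wedgeOne a).ratio ν x + f x * g x := fun x => by
    rw [Form.ratio_add, Form.ratio_smul, Form.ratio_fsmul, Form.ratio_fsmul, hν.ratio_self, mul_one]
  have h11 : Continuous fun x => f x * g x := by
    have := (hν.continuous_ratio (h7.isSmooth h6)).sub (continuous_const.mul h9 : Continuous fun x => (-1) ^ d * ((chartForm x₀ Z).wedgeOne a).ratio ν x)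
    refine this.congr fun x => ?_
    rw [Pi.sub_apply, h10]
    exact add_sub_cancel_left _ _
  simp only [h10] at h8
  rw [integral_add ((hμ.integrable h9).const_mul _) (hμ.integrable h11), integral_const_mul] at h8
  linarith

lemma IsVolumeMeasure.pos_of_isOpen (hν : IsVolumeForm ν) (hμ : IsVolumeMeasure ν μ) {U : Set M} (hU : IsOpen U)
    {x : M} (hx : x ∈ U) : 0 < μ U := by
  set e := extChartAt (𝓡 (d + 1)) x
  have hUs : IsOpen (U ∩ e.source) := hU.inter (isOpen_extChartAt_source x)
  have hxs : x ∈ U ∩ e.source := ⟨hx, mem_extChartAt_source x⟩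
  refine lt_of_lt_of_le ?_ (measure_mono (Set.inter_subset_left (t := e.source)))
  rw [hμ.apply_eq x _ hUs.measurableSet Set.inter_subset_right, chartMeasure_apply ν hUs.measurableSet Set.inter_subset_right]
  have himg : IsOpen (e '' (U ∩ e.source)) := by
    rw [e.image_eq_target_inter_inv_preimage Set.inter_subset_right]
    exact (continuousOn_extChartAt_symm x).isOpen_inter_preimage (isOpen_extChartAt_target x) hUs
  have hsub : e '' (U ∩ e.source) ⊆ e.target := by rintro _ ⟨z, hz, rfl⟩; exact e.map_source hz.2
  refine pos_iff_ne_zero.2 fun h => ?_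
  have hae : AEMeasurable (fun y => ENNReal.ofReal |ν.dens x y|) (volume.restrict (e '' (U ∩ e.source))) :=
    ENNReal.measurable_ofReal.comp_aemeasurable
      (((hν.smooth.continuousOn_dens x).mono hsub).abs.aemeasurable himg.measurableSet)
  rw [lintegral_eq_zero_iff' hae] at h
  have h1 : ∀ᵐ y ∂(volume.restrict (e '' (U ∩ e.source))), False := by
    filter_upwards [h, ae_restrict_mem himg.measurableSet] with y hy hy'
    have h2 : ENNReal.ofReal |ν.dens x y| = 0 := hy
    exact hν.dens_ne_zero (hsub hy') (by simpa using h2)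
  rw [Filter.eventually_false_iff_eq_bot, ae_eq_bot, Measure.restrict_eq_zero] at h1
  exact (himg.measure_pos volume ⟨_, x, hxs, rfl⟩).ne' h1

/-- A smooth bump function of integral one. -/
lemma exists_bump (hν : IsVolumeForm ν) (hμ : IsVolumeMeasure ν μ) {U : Set M} (hU : IsOpen U) {x : M} (hx : x ∈ U) :
    ∃ χ : M → ℝ, ContMDiff (𝓡 (d + 1)) 𝓘(ℝ, ℝ) ∞ χ ∧ (∀ x ∉ U, χ x = 0) ∧ ∫ x, χ x ∂μ = 1 := by
  obtain ⟨f, hf, hfs, hf0⟩ := hU.exists_contMDiff_support_eq (n := (⊤ : ℕ∞)) (𝓡 (d + 1))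
  have hpos : 0 < ∫ x, f x ∂μ := by
    rw [integral_pos_iff_support_of_nonneg hf0 (hμ.integrable hfs.continuous), hf]
    exact hμ.pos_of_isOpen hν hU hx
  refine ⟨fun x => (∫ x, f x ∂μ)⁻¹ * f x, contMDiff_const.mul hfs, fun x hx => ?_, ?_⟩
  · rw [← hf, Function.notMem_support] at hx
    change _ * f x = 0
    rw [hx, mul_zero]
  · rw [integral_const_mul, inv_mul_cancel₀ hpos.ne']

lemma exists_isOpen_isPreconnected {X : Type*} [TopologicalSpace X] [LocallyConnectedSpace X] {U : Set X}
    (hU : IsOpen U) {x : X} (hx : x ∈ U) : ∃ B, IsOpen B ∧ IsPreconnected B ∧ x ∈ B ∧ B ⊆ U :=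
  ⟨connectedComponentIn U x, hU.connectedComponentIn, isPreconnected_connectedComponentIn,
    mem_connectedComponentIn hx, connectedComponentIn_subset U x⟩

lemma IsPrimitiveOn.sub_eq_sub {a : Form (d + 1) M 1} {f f' : M → ℝ} {N N' B : Set M} (h : IsPrimitiveOn a f N)
    (h' : IsPrimitiveOn a f' N') (hB : IsPreconnected B) (hBN : B ⊆ N) (hBN' : B ⊆ N') {x y : M} (hx : x ∈ B) (hy : y ∈ B) :
    f y - f x = f' y - f' x := by
  have := IsPreconnected.eq_of_eventually_eq hB (g := fun z => f z - f' z) (fun z hz => by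
    filter_upwards [(h.eventually_sub_eq h' (hBN hz) (hBN' hz)).filter_mono nhdsWithin_le_nhds] with z' hz'
    linarith) hx hy
  linarith

/-- Poincaré dual of a loop. -/
lemma exists_poincare_dual (hν : IsVolumeForm ν) (hμ : IsVolumeMeasure ν μ) {γ : ℝ → M} (hγ : IsSmoothLoop (m := d + 1) γ) :
    ∃ η : Form (d + 1) M d, η.IsClosed ∧ ∀ a : Form (d + 1) M 1, a.IsClosed →
      (-1) ^ d * ∫ x, (η.wedgeOne a).ratio ν x ∂μ = -loopIntegral a γ := by
  -- Cut γ into short arcs with division points p_j. A bump χ_j of integral one near p_j is a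
  -- smeared point mass, and a primitive η_j of (χ_{j+1} - χ_j) ν is a smeared arc from p_j to
  -- p_{j+1}. The sum of the η_j is the dual form.
  have : LocallyConnectedSpace M := ChartedSpace.locallyConnectedSpace 𝔼 M
  -- The factor 3 leaves room for η_j, which is supported in the chart ball of twice the radius.
  have hr : ∀ x : M, ∃ r > 0, Metric.ball (extChartAt (𝓡 (d + 1)) x x) (3 * r) ⊆ (extChartAt (𝓡 (d + 1)) x).target := fun x => by
    obtain ⟨r, hr, h⟩ := Metric.nhds_basis_ball.mem_iff.1 (extChartAt_target_mem_nhds (I := 𝓡 (d + 1)) x)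
    exact ⟨r / 3, by positivity, by rwa [mul_div_cancel₀ _ (by norm_num)]⟩
  choose r hr hball using hr
  have hball1 : ∀ x, Metric.ball (extChartAt (𝓡 (d + 1)) x x) (r x) ⊆ (extChartAt (𝓡 (d + 1)) x).target := fun x =>
    (Metric.ball_subset_ball (by linarith [hr x])).trans (hball x)
  obtain ⟨δ, hδ, hLeb⟩ := lebesgue_number_lemma_of_metric (isCompact_Icc (a := (0 : ℝ)) (b := 1))
    (c := fun x => γ ⁻¹' chartBall (m := d + 1) x (r x))
    (fun x => (isOpen_chartBall x _).preimage hγ.smooth.continuous)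
    (fun s _ => Set.mem_iUnion.2 ⟨γ s, mem_chartBall_self _ (hr _)⟩)
  obtain ⟨N, hN⟩ := exists_nat_one_div_lt hδ
  have hN0 : (0 : ℝ) < N + 1 := by positivity
  have hx : ∀ j : Fin (N + 1), ∃ x : M, ∀ s ∈ Set.Icc ((j : ℝ) / (N + 1)) ((j + 1 : ℝ) / (N + 1)), γ s ∈ chartBall (m := d + 1) x (r x) := by
    intro j
    have hj : (j : ℝ) + 1 ≤ N + 1 := by exact_mod_cast j.2
    obtain ⟨x, hx⟩ := hLeb ((j : ℝ) / (N + 1)) ⟨by positivity, by rw [div_le_one hN0]; linarith⟩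
    refine ⟨x, fun s hs => hx ?_⟩
    rw [Metric.mem_ball, Real.dist_eq, abs_of_nonneg (by linarith [hs.1])]
    have := hs.2
    rw [add_div] at this
    linarith
  choose x hx using hx
  let p : Fin (N + 1) → M := fun j => γ ((j : ℝ) / (N + 1))
  -- Addition in `Fin (N + 1)` is cyclic, so after the last arc comes p_0; periodicity of γ makes
  -- this correct.
  have hp1 : ∀ j, p (j + 1) = γ ((j + 1 : ℝ) / (N + 1)) := by
    intro j
    simp only [p]
    by_cases hj : j = Fin.last N
    · subst hj
      have := hγ.periodic 0
      simp only [Fin.last_add_one, Fin.val_last, Fin.val_zero, Nat.cast_zero, zero_div, div_self hN0.ne']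
      rw [zero_add] at this
      exact this.symm
    · rw [Fin.val_add_one_of_lt (Fin.lt_last_iff_ne_last.2 hj)]
      push_cast
      rfl
  have hin : ∀ j : Fin (N + 1), (j : ℝ) / (N + 1) ≤ (j + 1 : ℝ) / (N + 1) := fun j => by
    rw [div_le_div_iff_of_pos_right hN0]; linarith
  have hpx : ∀ j, p j ∈ chartBall (m := d + 1) (x j) (r (x j)) := fun j => hx j _ ⟨le_rfl, hin j⟩
  have hpx' : ∀ j, p (j + 1) ∈ chartBall (m := d + 1) (x j) (r (x j)) := fun j => by
    rw [hp1]; exact hx j _ ⟨hin j, le_rfl⟩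
  -- A connected neighbourhood of p_j inside both adjacent balls, so that the two primitives of a
  -- closed form differ by a constant on it.
  have hB : ∀ j, ∃ B, IsOpen B ∧ IsPreconnected B ∧ p j ∈ B ∧ B ⊆ chartBall (m := d + 1) (x j) (r (x j)) ∩
      chartBall (m := d + 1) (x (j - 1)) (r (x (j - 1))) := fun j =>
    exists_isOpen_isPreconnected ((isOpen_chartBall _ _).inter (isOpen_chartBall _ _)) ⟨hpx j, by
      have := hpx' (j - 1)
      rwa [sub_add_cancel] at this⟩
  have hrot : ∀ F : Fin (N + 1) → ℝ, ∑ j, F (j + 1) = ∑ j, F j := fun F => Equiv.sum_comp (Equiv.addRight 1) F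
  choose B hBo hBc hpB hBs using hB
  choose χ hχ hχ0 hχ1 using fun j => exists_bump hν hμ (hBo j) (hpB j)
  have hBs' : ∀ j, B (j + 1) ⊆ chartBall (m := d + 1) (x j) (r (x j)) := fun j => by
    have := (hBs (j + 1)).trans Set.inter_subset_right
    rwa [add_sub_cancel_right] at this
  have hBs0 : ∀ j, B j ⊆ chartBall (m := d + 1) (x j) (r (x j)) := fun j => (hBs j).trans Set.inter_subset_left
  have hχint : ∀ j, Integrable (χ j) μ := fun j => hμ.integrable (hχ j).continuous
  choose η hη hdη hpair using fun j => exists_primitive_fsmul hν hμ (hr (x j)) (hball (x j)) (g := fun z => χ (j + 1) z - χ j z)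
    ((hχ _).sub (hχ _)) (fun z hz => by
      have h := fun h => hz (chartBall_subset_closedBall (x j) (r (x j)) h)
      rw [hχ0 _ z fun h' => h (hBs' j h'), hχ0 _ z fun h' => h (hBs0 j h'), sub_zero])
    (by rw [integral_sub (hχint _) (hχint _), hχ1, hχ1, sub_self])
  refine ⟨∑ j, η j, ⟨Form.IsSmooth.sum _ fun j _ => hη j, ?_⟩, fun a ha => ?_⟩
  · have h1 := Form.IsExtDeriv.sum Finset.univ (fun j _ => hη j) (fun j _ => hdη j)
    have h2 : ∑ j, ν.fsmul (fun z => χ (j + 1) z - χ j z) = 0 := by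
      refine Form.ext_ev fun z => ?_
      have h3 : (∑ j, ν.fsmul (fun z => χ (j + 1) z - χ j z)).ev z = ∑ j, (ν.fsmul (fun z => χ (j + 1) z - χ j z)).ev z :=
        Finset.sum_apply z Finset.univ fun j => ν.fsmul (fun z => χ (j + 1) z - χ j z)
      rw [h3]
      simp only [Form.ev_fsmul]
      rw [← Finset.sum_smul, Finset.sum_sub_distrib, hrot fun j => χ j z, sub_self, zero_smul]
      rfl
    rwa [h2] at h1
  · choose f hf using fun j => ha.exists_isPrimitiveOn_chartBall (x j) (hball (x j))
    have hsub : ∀ j, chartBall (m := d + 1) (x j) (r (x j)) ⊆ chartBall (m := d + 1) (x j) (3 * r (x j)) := fun j z hz =>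
      ⟨hz.1, Metric.ball_subset_ball (by linarith [hr (x j)]) hz.2⟩
    have hcont : ∀ j (g : M → ℝ), Continuous g → (∀ z ∉ chartBall (m := d + 1) (x j) (r (x j)), g z = 0) →
        Continuous fun z => f j z * g z := by
      intro j g hg hg0
      have hcl : _root_.IsClosed (chartClosedBall (d := d) (x j) (r (x j))) :=
        isClosed_chartClosedBall ((Metric.closedBall_subset_ball (by linarith [hr (x j)])).trans (hball (x j)))
      refine continuous_iff_continuousAt.2 fun z => ?_
      by_cases hz : z ∈ chartClosedBall (d := d) (x j) (r (x j))
      · have hz' := chartClosedBall_subset (by linarith [hr (x j)]) (hball (x j)) hz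
        exact (((hf j).2 z hz').continuousAt).mul hg.continuousAt
      · refine (continuousAt_const (y := (0 : ℝ))).congr ?_
        filter_upwards [hcl.isOpen_compl.mem_nhds hz] with z' hz'
        rw [hg0 z' fun h => hz' (chartBall_subset_closedBall _ _ h), mul_zero]
    have hfi : ∀ j, Integrable (fun z => f j z * χ j z) μ := fun j => hμ.integrable (hcont j _ (hχ j).continuous
      fun z hz => hχ0 j z fun h => hz (hBs0 j h))
    have hfi' : ∀ j, Integrable (fun z => f j z * χ (j + 1) z) μ := fun j => hμ.integrable (hcont j _ (hχ _).continuous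
      fun z hz => hχ0 _ z fun h => hz (hBs' j h))
    -- The error made by averaging f_j with χ_j instead of evaluating at p_j. On B_{j+1} the
    -- functions f_j and f_{j+1} differ by a constant, so both see the same error and the errors
    -- cancel cyclically.
    let A : Fin (N + 1) → ℝ := fun j => ∫ z, (f j z - f j (p j)) * χ j z ∂μ
    have hA : ∀ j, ∫ z, f j z * χ j z ∂μ = f j (p j) + A j := by
      intro j
      simp only [A, sub_mul]
      rw [integral_sub (hfi j) ((hχint j).const_mul _), integral_const_mul, hχ1]; ring
    have hA' : ∀ j, ∫ z, f j z * χ (j + 1) z ∂μ = f j (p (j + 1)) + A (j + 1) := by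
      intro j
      have h1 : A (j + 1) = ∫ z, (f j z - f j (p (j + 1))) * χ (j + 1) z ∂μ := by
        refine integral_congr_ae (Filter.Eventually.of_forall fun z => ?_)
        by_cases hz : z ∈ B (j + 1)
        · simp only
          rw [(hf (j + 1)).sub_eq_sub (hf j) (hBc (j + 1)) ((hBs0 _).trans (hsub _)) ((hBs' j).trans (hsub j)) (hpB (j + 1)) hz]
        · simp only
          rw [hχ0 _ z hz, mul_zero, mul_zero]
      rw [h1]
      simp only [sub_mul]
      rw [integral_sub (hfi' j) ((hχint _).const_mul _), integral_const_mul, hχ1]; ring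
    have hloop : loopIntegral a γ = ∑ j : Fin (N + 1), (f j (p (j + 1)) - f j (p j)) := by
      obtain ⟨g, hg⟩ := ha.exists_isLocalPrimitive isCompact_Icc (convex_Icc (0 : ℝ) 1) hγ.smooth.continuous.continuousOn
      rw [hg.integral_eq ha.1 hγ.smooth]
      have h1 : ∀ j : Fin (N + 1), f j (p (j + 1)) - f j (p j) = g ((j + 1 : ℝ) / (N + 1)) - g ((j : ℝ) / (N + 1)) := by
        intro j
        rw [hp1]
        have hj : (j : ℝ) + 1 ≤ N + 1 := by exact_mod_cast j.2
        have hsubI : Set.Icc ((j : ℝ) / (N + 1)) ((j + 1 : ℝ) / (N + 1)) ⊆ Set.Icc 0 1 :=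
          Set.Icc_subset_Icc (by positivity) (by rw [div_le_one hN0]; exact hj)
        have h2 : IsLocalPrimitive a (Set.Icc ((j : ℝ) / (N + 1)) ((j + 1 : ℝ) / (N + 1))) γ (f j ∘ γ) := fun s hs =>
          ⟨f j, _, hf j, hsub j (hx j s hs), Filter.Eventually.of_forall fun _ => rfl⟩
        have h3 : IsLocalPrimitive a (Set.Icc ((j : ℝ) / (N + 1)) ((j + 1 : ℝ) / (N + 1))) γ g :=
          hg.comp (q := id) continuousOn_id fun s hs => hsubI hs
        exact h2.sub_eq_sub h3 (fun _ _ => rfl) hγ.smooth.continuous.continuousOn isPreconnected_Icc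
          ⟨le_rfl, hin j⟩ ⟨hin j, le_rfl⟩
      simp only [h1]
      have h4 := Finset.sum_range_sub (fun i : ℕ => g ((i : ℝ) / (N + 1))) (N + 1)
      rw [Finset.sum_range] at h4
      push_cast at h4
      rw [h4, div_self hN0.ne', zero_div]
    rw [Form.wedgeOne_sum]
    simp only [Form.ratio_sum]
    rw [integral_finsetSum _ fun j _ => hμ.integrable (hν.continuous_ratio ((hη j).wedgeOne ha.1)), Finset.mul_sum, hloop,
      ← Finset.sum_neg_distrib]
    have h5 : ∀ j, (-1) ^ d * ∫ z, ((η j).wedgeOne a).ratio ν z ∂μ =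
        -(f j (p (j + 1)) - f j (p j)) + (A j - A (j + 1)) := by
      intro j
      rw [hpair j a (f j) ha (hf j)]
      simp only [mul_sub]
      rw [integral_sub (hfi' j) (hfi j), hA, hA']; ring
    simp only [h5]
    rw [Finset.sum_add_distrib, Finset.sum_sub_distrib, hrot A, sub_self, add_zero]

end PoincareDual

/-! ### Powers of a skew form under linear maps -/

section Powers

variable {E E' : Type*} [AddCommGroup E] [Module ℝ E] [AddCommGroup E'] [Module ℝ E']

lemma eps_comp {k : ℕ} (b : E →ₗ[ℝ] ℝ) (A : E [⋀^Fin k]→ₗ[ℝ] ℝ) (L : E' →ₗ[ℝ] E) :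
    eps (b ∘ₗ L) (A.compLinearMap L) = (eps b A).compLinearMap L := by
  ext v
  rw [AlternatingMap.compLinearMap_apply, eps_apply, eps_apply]
  rfl

lemma eps₂_comp {k : ℕ} (w : E →ₗ[ℝ] E →ₗ[ℝ] ℝ) (A : E [⋀^Fin k]→ₗ[ℝ] ℝ) (L : E' →ₗ[ℝ] E) :
    eps₂ (w.compl₁₂ L L) (A.compLinearMap L) = (eps₂ w A).compLinearMap L := by
  ext v
  rw [AlternatingMap.compLinearMap_apply, eps₂_apply, eps₂_apply]
  refine Finset.sum_congr rfl fun i _ => ?_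
  have h : (w.compl₁₂ L L) (v i) = w (L (v i)) ∘ₗ L := rfl
  rw [h, eps_comp]
  rfl

lemma epsPow_comp (w : E →ₗ[ℝ] E →ₗ[ℝ] ℝ) (L : E' →ₗ[ℝ] E) (j : ℕ) :
    epsPow (w.compl₁₂ L L) j = (epsPow w j).compLinearMap L := by
  induction j with
  | zero => rfl
  | succ j ih =>
    change (1 / 2 : ℝ) • eps₂ (w.compl₁₂ L L) (epsPow (w.compl₁₂ L L) j) = _
    rw [ih, eps₂_comp]
    rfl

end Powers

/-! ### Powers of the symplectic form -/

section FormPowers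

variable {m : ℕ} {M : Type u} [TopologicalSpace M] [ChartedSpace (EuclideanSpace ℝ (Fin m)) M]

local notation "𝔼" => EuclideanSpace ℝ (Fin m)

lemma wedgePow_apply (w : 𝔼 [⋀^Fin 2]→L[ℝ] ℝ) (j : ℕ) (v : Fin (2 * j) → 𝔼) : wedgePow w j v = epsPow (bilin w) j v :=
  congrArg (fun A => A v) (wedgePow_toAlternatingMap w j)

lemma wedgePow_comp (w : 𝔼 [⋀^Fin 2]→L[ℝ] ℝ) (L : 𝔼 →L[ℝ] 𝔼) (j : ℕ) :
    wedgePow (w.compContinuousLinearMap L) j = (wedgePow w j).compContinuousLinearMap L := by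
  ext v
  rw [ContinuousAlternatingMap.compContinuousLinearMap_apply, wedgePow_apply, wedgePow_apply]
  have h : bilin (w.compContinuousLinearMap L) = (bilin w).compl₁₂ (L : 𝔼 →ₗ[ℝ] 𝔼) (L : 𝔼 →ₗ[ℝ] 𝔼) := by
    ext x y
    rw [bilin_apply, ContinuousAlternatingMap.compContinuousLinearMap_apply]
    change _ = w ![L x, L y]
    congr 1
    funext i
    fin_cases i <;> rfl
  rw [h, epsPow_comp]
  rfl

/-- The powers of a `2`-form. -/
def Form.pow (Ω : Form m M 2) (j : ℕ) : Form m M (2 * j) := fun x => wedgePow (Ω.ev x) j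

lemma Form.inChart_pow (Ω : Form m M 2) (j : ℕ) (x₀ : M) (y : 𝔼) :
    (Ω.pow j).inChart x₀ y = wedgePow (Ω.inChart x₀ y) j :=
  (wedgePow_comp _ (symmD x₀ y) j).symm

lemma Form.pullback_pow (Ω : Form m M 2) (j : ℕ) (f : M → M) :
    Form.pullback f (Ω.pow j) = (Form.pullback f Ω).pow j := by
  refine Form.ext_ev fun x => ?_
  exact (wedgePow_comp (Ω.ev (f x)) (mfderiv (𝓡 m) (𝓡 m) f x : 𝔼 →L[ℝ] 𝔼) j).symm

lemma contDiffAt_wedgePow {X : Type*} [NormedAddCommGroup X] [NormedSpace ℝ X] {F : X → 𝔼 [⋀^Fin 2]→L[ℝ] ℝ} {x : X}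
    (hF : ContDiffAt ℝ ∞ F x) (j : ℕ) : ContDiffAt ℝ ∞ (fun x => wedgePow (F x) j) x := by
  induction j with
  | zero => exact contDiffAt_const
  | succ j ih =>
    refine contDiffAt_alternating_of_apply fun v => ?_
    have h : ∀ x, wedgePow (F x) (j + 1) v = 1 / 2 * eps₂ (bilin (F x)) (wedgePow (F x) j).toAlternatingMap v := fun x =>
      wedge_two_apply (wedgePow (F x) j) (F x) v
    simp only [h, eps₂_apply, eps_apply, bilin_apply]
    refine contDiffAt_const.mul (ContDiffAt.sum fun i _ => contDiffAt_const.mul (ContDiffAt.sum fun l _ =>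
      contDiffAt_const.mul (ContDiffAt.mul ?_ ?_)))
    · exact contDiffAt_alternating_apply hF fun _ => contDiffAt_const
    · exact contDiffAt_alternating_apply ih fun _ => contDiffAt_const

lemma Form.IsSmooth.pow [IsManifold (𝓡 m) ∞ M] {Ω : Form m M 2} (hΩ : Ω.IsSmooth) (j : ℕ) : (Ω.pow j).IsSmooth :=
  Form.isSmooth_of_contDiffAt fun x₀ y hy => by
    have h : (Ω.pow j).inChart x₀ = fun y => wedgePow (Ω.inChart x₀ y) j := funext fun y => Ω.inChart_pow j x₀ y
    rw [h]
    exact contDiffAt_wedgePow (hΩ.contDiffAt_inChart hy) j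

lemma IsSymplectic.pow_ne_zero {Ω : Form m M 2} (hΩ : IsSymplectic Ω) {j : ℕ} (hj : 2 * j ≤ m) (x : M) :
    (Ω.pow j).ev x ≠ 0 := by
  obtain ⟨v, -, hv⟩ := exists_epsPow_ne_zero (bilin (Ω.ev x)) (bilin_skew _) j (⊤ : Submodule ℝ 𝔼) (by simpa using hj)
    (fun v _ h => hΩ.nondegenerate x v fun w => h w trivial)
  intro h
  apply hv
  rw [← wedgePow_apply]
  exact congrArg (fun A : 𝔼 [⋀^Fin (2 * j)]→L[ℝ] ℝ => A v) h

end FormPowers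

/-! ### The Lefschetz condition on representatives -/

section Lefschetz

variable {m : ℕ} {M : Type u} [TopologicalSpace M] [ChartedSpace (EuclideanSpace ℝ (Fin m)) M]

/-- Surjectivity of the Lefschetz map, read on representing forms. -/
lemma IsLefschetz.exists_sub_mem_exactForms {n : ℕ} {Ω : Form m M 2} (h : IsLefschetz n Ω)
    {η : Form m M (2 * (n - 1) + 1)} (hη : η.IsClosed) :
    ∃ β : Form m M 1, β.IsClosed ∧ η - (Ω.pow (n - 1)).wedgeOne β ∈ exactForms m M (2 * (n - 1) + 1) := by
  obtain ⟨L, hL⟩ := h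
  obtain ⟨c, hc⟩ := L.surjective (deRhamClass ⟨η, hη⟩)
  obtain ⟨β, rfl⟩ := Submodule.Quotient.mk_surjective _ c
  obtain ⟨w, hw, hLw⟩ := hL β
  refine ⟨β, β.2, ?_⟩
  have h1 : deRhamClass ⟨η, hη⟩ = deRhamClass w := hc.symm.trans hLw
  have h2 := (Submodule.Quotient.eq _).1 h1
  have h3 : (Ω.pow (n - 1)).wedgeOne β = (w : Form m M _) := funext fun x => (hw x).symm
  rw [h3]
  exact h2

end Lefschetz

/-! ### Velocities of curves and area integrands -/

section Velocity

variable {m : ℕ} {M : Type u} [TopologicalSpace M] [ChartedSpace (EuclideanSpace ℝ (Fin m)) M]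

local notation "𝔼" => EuclideanSpace ℝ (Fin m)

/-- The velocity of a curve. -/
def velocity (c : ℝ → M) (t : ℝ) : 𝔼 := mfderiv 𝓘(ℝ, ℝ) (𝓡 m) c t (1 : ℝ)

lemma mfderiv_left_eq {W : Type*} [NormedAddCommGroup W] [NormedSpace ℝ W] {u : ℝ × W → M} {t : ℝ} {y : W}
    (hu : MDifferentiableAt 𝓘(ℝ, ℝ × W) (𝓡 m) u (t, y)) :
    velocity (m := m) (fun s => u (s, y)) t = (mfderiv 𝓘(ℝ, ℝ × W) (𝓡 m) u (t, y) ((1 : ℝ), (0 : W)) : 𝔼) := by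
  have hl : HasFDerivAt (fun s : ℝ => (s, y)) (ContinuousLinearMap.inl ℝ ℝ W) t := hasFDerivAt_prodMk_left t y
  have h2 := mfderiv_comp t hu hl.differentiableAt.mdifferentiableAt
  rw [mfderiv_eq_fderiv, hl.fderiv] at h2
  exact congrArg (fun L : ℝ →L[ℝ] 𝔼 => L 1) h2

lemma mfderiv_right_eq {u : ℝ × ℝ → M} {t s : ℝ} (hu : MDifferentiableAt 𝓘(ℝ, ℝ × ℝ) (𝓡 m) u (t, s)) :
    velocity (m := m) (fun s => u (t, s)) s = (mfderiv 𝓘(ℝ, ℝ × ℝ) (𝓡 m) u (t, s) ((0 : ℝ), (1 : ℝ)) : 𝔼) := by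
  have hl : HasFDerivAt (fun s : ℝ => (t, s)) (ContinuousLinearMap.inr ℝ ℝ ℝ) s := hasFDerivAt_prodMk_right t s
  have h2 := mfderiv_comp s hu hl.differentiableAt.mdifferentiableAt
  rw [mfderiv_eq_fderiv, hl.fderiv] at h2
  exact congrArg (fun L : ℝ →L[ℝ] 𝔼 => L 1) h2

lemma loopIntegral_eq (a : Form m M 1) (c : ℝ → M) :
    loopIntegral a c = ∫ s in (0 : ℝ)..1, a.ev (c s) ![velocity c s] := rfl

lemma area_eq (Ω : Form m M 2) {u : ℝ × ℝ → M} (hu : MDifferentiable 𝓘(ℝ, ℝ × ℝ) (𝓡 m) u) :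
    area Ω u = ∫ t in (0 : ℝ)..1, ∫ s in (0 : ℝ)..1,
      Ω.ev (u (t, s)) ![velocity (fun t => u (t, s)) t, velocity (fun s => u (t, s)) s] := by
  simp only [mfderiv_left_eq (hu _), mfderiv_right_eq (hu _)]
  rfl

end Velocity

/-! ### The area swept under a loop of symplectomorphisms -/

section SymplecticLoops

variable {m : ℕ} {M : Type u} [TopologicalSpace M] [ChartedSpace (EuclideanSpace ℝ (Fin m)) M]
  [IsManifold (𝓡 m) ∞ M]

local notation "𝔼" => EuclideanSpace ℝ (Fin m)

lemma Form.pullback_comp {k : ℕ} (α : Form m M k) {f g : M → M} (hf : MDifferentiable (𝓡 m) (𝓡 m) f)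
    (hg : MDifferentiable (𝓡 m) (𝓡 m) g) : Form.pullback (f ∘ g) α = Form.pullback g (Form.pullback f α) := by
  funext x
  unfold Form.pullback
  rw [mfderiv_comp x (hf _) (hg _)]
  rfl

lemma Form.pullback_id {k : ℕ} (α : Form m M k) : Form.pullback id α = α := by
  funext x
  unfold Form.pullback
  rw [mfderiv_id]
  rfl

lemma Symp.symm_mem {Ω : Form m M 2} {f : Diffeomorph (𝓡 m) (𝓡 m) M M ∞} (hf : f ∈ Symp Ω) :
    Form.pullback f.symm Ω = Ω := by
  have hf' : Form.pullback f Ω = Ω := hf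
  have h1 := Form.pullback_comp Ω (f.contMDiff.mdifferentiable (by simp)) (f.symm.contMDiff.mdifferentiable (by simp))
  have h2 : f ∘ f.symm = id := funext fun x => f.apply_symm_apply x
  rw [h2, hf', Form.pullback_id] at h1
  exact h1.symm

variable {Ω : Form m M 2} {φ : ℝ → Diffeomorph (𝓡 m) (𝓡 m) M M ∞}

/-- The velocity field of a smooth family of diffeomorphisms. -/
def velocityField (φ : ℝ → Diffeomorph (𝓡 m) (𝓡 m) M M ∞) (t : ℝ) (x : M) : 𝔼 :=
  velocity (fun s => φ (t + s) ((φ t).symm x)) 0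

lemma IsSympLoop.velocity_eq (hφ : IsSympLoop Ω φ) (t : ℝ) (x : M) :
    velocityField φ t (φ t x) = velocity (fun s => φ s x) t := by
  unfold velocityField
  rw [(φ t).symm_apply_apply]
  have hc : ContMDiff 𝓘(ℝ, ℝ) (𝓡 m) ∞ fun s => φ s x := hφ.smooth.comp (contMDiff_id.prodMk contMDiff_const)
  have hl : HasFDerivAt (fun s : ℝ => t + s) (ContinuousLinearMap.id ℝ ℝ) 0 := (hasFDerivAt_id 0).const_add t
  have h2 := mfderiv_comp (0 : ℝ) (g := fun s => φ s x) (f := fun s => t + s) (I' := 𝓘(ℝ, ℝ)) (I'' := 𝓡 m)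
    (hc.mdifferentiable (by simp) _) hl.differentiableAt.mdifferentiableAt
  rw [mfderiv_eq_fderiv, hl.fderiv] at h2
  have h3 := congrArg (fun L : ℝ →L[ℝ] 𝔼 => L 1) h2
  have key : ∀ t' : ℝ, t' = t → velocity (fun s => φ s x) t' = velocity (m := m) (fun s => φ s x) t := by
    rintro _ rfl; rfl
  exact h3.trans (key (t + 0) (add_zero t))

/-- The field is the velocity at s = 0 of the family φ_{t+s} ∘ φ_t⁻¹, which preserves Ω and starts
at the identity. -/
lemma IsSympLoop.isClosed_contract (hΩ : Ω.IsClosed) (hφ : IsSympLoop Ω φ) (t : ℝ) :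
    (Ω.contract (velocityField φ t)).IsClosed := by
  refine hΩ.contract_velocity (ψ := fun p => φ (t + p.1) ((φ t).symm p.2)) ?_ (fun s => ?_) (fun x => ?_)
  · refine hφ.smooth.comp (ContMDiff.prodMk ?_ ?_)
    · exact (contDiff_const.add contDiff_id).contMDiff.comp contMDiff_fst
    · exact (φ t).symm.contMDiff.comp contMDiff_snd
  · have h1 := Form.pullback_comp Ω ((φ (t + s)).contMDiff.mdifferentiable (by simp))
      ((φ t).symm.contMDiff.mdifferentiable (by simp))
    have h2 : Form.pullback (φ (t + s)) Ω = Ω := hφ.mem _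
    rw [h2, Symp.symm_mem (hφ.mem t)] at h1
    exact h1
  · simp

lemma IsSympLoop.contMDiff_sweep (hφ : IsSympLoop Ω φ) {γ : ℝ → M} (hγ : ContMDiff 𝓘(ℝ, ℝ) (𝓡 m) ∞ γ) :
    ContMDiff 𝓘(ℝ, ℝ × ℝ) (𝓡 m) ∞ fun z : ℝ × ℝ => φ z.1 (γ z.2) := by
  refine hφ.smooth.comp (ContMDiff.prodMk ?_ ?_)
  · exact contDiff_fst.contMDiff
  · exact hγ.comp contDiff_snd.contMDiff

/-- The area swept by a loop, as an integral of the fluxes of the velocity fields through a fixed loop. -/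
lemma IsSympLoop.area_sweep (hΩ : Ω.IsClosed) (hφ : IsSympLoop Ω φ) {γ : ℝ → M} (hγ : IsSmoothLoop (m := m) γ) :
    area Ω (fun z => φ z.1 (γ z.2)) =
      ∫ t in (0 : ℝ)..1, loopIntegral (Ω.contract (velocityField φ t)) (φ 0 ∘ γ) := by
  have hu := hφ.contMDiff_sweep hγ.smooth
  rw [area_eq Ω (hu.mdifferentiable (by simp))]
  refine intervalIntegral.integral_congr fun t ht => ?_
  rw [Set.uIcc_of_le zero_le_one] at ht
  -- The loops φ_t ∘ γ and φ_0 ∘ γ are homotopic through the sweep itself, so a closed form has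
  -- equal integrals over them.
  have h1 := (hφ.isClosed_contract hΩ t).loopIntegral_eq_of_homotopy hu (fun t => by
    have := hγ.periodic 0
    rw [zero_add] at this
    simp only [this]) ht
  refine Eq.trans ?_ h1
  rw [loopIntegral_eq]
  refine intervalIntegral.integral_congr fun s _ => ?_
  have h2 := Form.contract_apply Ω (velocityField φ t) (φ t (γ s)) ![velocity (fun s => φ t (γ s)) s]
  rw [hφ.velocity_eq] at h2
  exact h2.symm

/-- Joint continuity in time and point provides the integrability needed for Fubini. -/
lemma IsSympLoop.continuous_velocity_pairing (hφ : IsSympLoop Ω φ) {β : Form m M 1} (hβ : β.IsSmooth) :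
    Continuous fun p : ℝ × M => β.ev (φ p.1 p.2) ![velocity (fun s => φ s p.2) p.1] := by
  refine continuous_iff_continuousAt.2 fun ⟨t, x⟩ => ?_
  set e := extChartAt (𝓡 m) x
  let u : ℝ × 𝔼 → M := fun p => φ p.1 (e.symm p.2)
  have hu : ∀ t, ∀ y ∈ e.target, ContMDiffAt 𝓘(ℝ, ℝ × 𝔼) (𝓡 m) ∞ u (t, y) := fun t y hy => by
    refine ContMDiffAt.comp (t, y) (g := fun p : ℝ × M => φ p.1 p.2) (f := fun p : ℝ × 𝔼 => (p.1, e.symm p.2)) hφ.smooth.contMDiffAt (ContMDiffAt.prodMk ?_ ?_)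
    · exact contDiff_fst.contMDiff.contMDiffAt
    · exact (contMDiffAt_extChartAt_symm hy).comp (t, y) contDiff_snd.contMDiff.contMDiffAt
  have h1 : (fun p : ℝ × M => β.ev (φ p.1 p.2) ![velocity (fun s => φ s p.2) p.1]) =ᶠ[nhds (t, x)]
      (fun q : ℝ × 𝔼 => pb β u q ![((1 : ℝ), (0 : 𝔼))]) ∘ fun p : ℝ × M => (p.1, e p.2) := by
    have hs : ∀ᶠ p : ℝ × M in nhds (t, x), p.2 ∈ e.source :=
      continuousAt_snd.eventually (extChartAt_source_mem_nhds (I := 𝓡 m) x)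
    filter_upwards [hs] with p hp
    have h2 := mfderiv_left_eq ((hu p.1 (e p.2) (e.map_source hp)).mdifferentiableAt (by simp))
    have h3 : (fun s => u (s, e p.2)) = fun s => φ s p.2 := by
      funext s; exact congrArg (φ s) (e.left_inv hp)
    rw [h3] at h2
    refine Form.congr_apply β (congrArg (φ p.1) (e.left_inv hp).symm) ?_
    funext i
    fin_cases i
    exact h2
  refine ContinuousAt.congr ?_ h1.symm
  have h4 : ContinuousAt (fun q : ℝ × 𝔼 => pb β u q ![((1 : ℝ), (0 : 𝔼))]) (t, e x) :=
    (contDiffAt_alternating_apply (v := fun _ => ![((1 : ℝ), (0 : 𝔼))])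
      (hβ.contDiffAt_pb (hu t (e x) (mem_extChartAt_target x))) fun _ => contDiffAt_const).continuousAt
  exact ContinuousAt.comp (f := fun p : ℝ × M => (p.1, e p.2)) (x := (t, x)) h4
    (continuousAt_fst.prodMk ((continuousAt_extChartAt (I := 𝓡 m) x).comp (f := Prod.snd) (x := (t, x)) continuousAt_snd))

end SymplecticLoops

/-! ### Vanishing of the flux in the Lefschetz case -/

section LefschetzFlux

open MeasureTheory

variable {k : ℕ} {M : Type u} [TopologicalSpace M] [ChartedSpace (EuclideanSpace ℝ (Fin (2 * k + 1 + 1))) M]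
  [IsManifold (𝓡 (2 * k + 1 + 1)) ∞ M] [T2Space M] [CompactSpace M]

local notation "𝔼" => EuclideanSpace ℝ (Fin (2 * k + 1 + 1))

/-- Contracting β ∧ Ω^{k+1}, which is zero by degree, with X gives (k+1) Ω^k ∧ β ∧ ι_XΩ = β(X)
Ω^{k+1}; this is divided by the volume form. -/
lemma ratio_wedge_pow_contract (Ω : Form (2 * k + 1 + 1) M 2) (β : Form (2 * k + 1 + 1) M 1) (X : M → 𝔼) (x : M)
    (h0 : (Ω.pow (k + 1)).ev x ≠ 0) :
    ((k : ℝ) + 1) * (((Ω.pow k).wedgeOne β).wedgeOne (Ω.contract X)).ratio (Ω.pow (k + 1)) x = β.ev x ![X x] := by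
  have h1 : (Ω.pow (k + 1)).ev x (stdB (2 * k + 1 + 1)) ≠ 0 := fun h => h0 ((top_ne_zero_iff _).1 h)
  have h2 : ∀ v : Fin (2 * k + 1 + 1) → 𝔼, (((Ω.pow k).wedgeOne β).wedgeOne (Ω.contract X)).ev x v =
      -eps (bilin (Ω.ev x) (X x)) (eps (lin (β.ev x)) (epsPow (bilin (Ω.ev x)) k)) v := by
    intro v
    rw [Form.wedgeOne_apply]
    have h3 : ((Ω.pow k).wedgeOne β |>.ev x).toAlternatingMap = eps (lin (β.ev x)) (epsPow (bilin (Ω.ev x)) k) := by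
      ext v
      have := Form.wedgeOne_apply (Ω.pow k) β x v
      rw [Even.neg_one_pow ⟨k, two_mul k⟩, one_mul] at this
      refine this.trans ?_
      have h4 : ((Ω.pow k).ev x).toAlternatingMap = epsPow (bilin (Ω.ev x)) k := wedgePow_toAlternatingMap _ _
      rw [h4]
    have h5 : lin ((Ω.contract X).ev x) = bilin (Ω.ev x) (X x) := by
      ext y
      exact Form.contract_apply Ω X x ![y]
    rw [h3, h5, pow_succ, Even.neg_one_pow ⟨k, two_mul k⟩]
    ring
  have h6 := congrArg (fun A => A (stdB (2 * k + 1 + 1)))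
    (eps_eps_epsPow (bilin (Ω.ev x)) (bilin_skew _) k (fun A => top_succ_eq_zero A) (X x) (lin (β.ev x)))
  have h7 : (Ω.pow (k + 1)).ev x (stdB (2 * k + 1 + 1)) = epsPow (bilin (Ω.ev x)) (k + 1) (stdB (2 * k + 1 + 1)) :=
    wedgePow_apply (Ω.ev x) (k + 1) (stdB (2 * k + 1 + 1))
  have h8 : ((k : ℝ) + 1) * eps (bilin (Ω.ev x) (X x)) (eps (lin (β.ev x)) (epsPow (bilin (Ω.ev x)) k)) (stdB (2 * k + 1 + 1)) =
      -(lin (β.ev x) (X x) * epsPow (bilin (Ω.ev x)) (k + 1) (stdB (2 * k + 1 + 1))) := h6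
  change ((k : ℝ) + 1) * ((((Ω.pow k).wedgeOne β).wedgeOne (Ω.contract X)).ev x (stdB (2 * k + 1 + 1)) /
    (Ω.pow (k + 1)).ev x (stdB (2 * k + 1 + 1))) = _
  rw [h2, ← mul_div_assoc, mul_neg, h8, neg_neg, ← h7, mul_div_cancel_right₀ _ h1, lin_apply]

/-- Here the dimension is 2(k+1). Duality and the Lefschetz condition turn the flux through a loop
into an average over all orbits of periods of β, and each of these vanishes. -/
theorem area_sweep_eq_zero_of_lefschetz {Ω : Form (2 * k + 1 + 1) M 2} (hΩ : IsSymplectic Ω)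
    (hL : ∀ η : Form (2 * k + 1 + 1) M (2 * k + 1), η.IsClosed → ∃ β : Form (2 * k + 1 + 1) M 1, β.IsClosed ∧
      η - (Ω.pow k).wedgeOne β ∈ exactForms (2 * k + 1 + 1) M (2 * k + 1))
    {φ : ℝ → Diffeomorph (𝓡 (2 * k + 1 + 1)) (𝓡 (2 * k + 1 + 1)) M M ∞} (hφ : IsSympLoop Ω φ)
    (h0 : ∀ x, IsNullHomologous (orbit hφ x)) {γ : ℝ → M} (hγ : IsSmoothLoop (m := 2 * k + 1 + 1) γ) :
    area Ω (fun z => φ z.1 (γ z.2)) = 0 := by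
  let _ : MeasurableSpace M := borel M
  have : BorelSpace M := ⟨rfl⟩
  have : SecondCountableTopology M := ChartedSpace.secondCountable_of_sigmaCompact 𝔼 M
  let ν : Form (2 * k + 1 + 1) M (2 * k + 1 + 1) := Ω.pow (k + 1)
  have hν : IsVolumeForm ν := ⟨hΩ.closed.1.pow (k + 1), hΩ.pow_ne_zero (j := k + 1) le_rfl⟩
  obtain ⟨μ, hμ⟩ := hν.exists_isVolumeMeasure
  have hfin := hμ.finite
  have hφγ : IsSmoothLoop (m := 2 * k + 1 + 1) (φ 0 ∘ γ) :=
    ⟨fun s => congrArg (φ 0) (hγ.periodic s), (φ 0).contMDiff.comp hγ.smooth⟩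
  obtain ⟨η, hη, hdual⟩ := exists_poincare_dual hν hμ hφγ
  obtain ⟨β, hβ, ζ, hζ, hdζ⟩ := hL η hη
  have hflux : ∀ t, ((k : ℝ) + 1) * loopIntegral (Ω.contract (velocityField φ t)) (φ 0 ∘ γ) =
      ∫ x, β.ev (φ t x) ![velocity (fun s => φ s x) t] ∂μ := by
    intro t
    have ha := hφ.isClosed_contract hΩ.closed t
    set a := Ω.contract (velocityField φ t)
    have h1 := hdual a ha
    rw [pow_succ, Even.neg_one_pow ⟨k, two_mul k⟩, one_mul, neg_one_mul, neg_inj] at h1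
    have hs1 : ((Ω.pow k).wedgeOne β).IsSmooth := (hΩ.closed.1.pow k).wedgeOne hβ.1
    -- Only the Lefschetz part of η survives, as the exact part pairs to zero with the closed form
    -- `a`.
    have h2 : η = (η - (Ω.pow k).wedgeOne β) + (Ω.pow k).wedgeOne β := (sub_add_cancel _ _).symm
    rw [h2, Form.wedgeOne_add] at h1
    simp only [Form.ratio_add] at h1
    rw [integral_add (hμ.integrable (hν.continuous_ratio ((hdζ.isSmooth hζ).wedgeOne ha.1)))
      (hμ.integrable (hν.continuous_ratio (hs1.wedgeOne ha.1))), integral_ratio_wedgeOne_exact hν hμ hζ hdζ ha, zero_add] at h1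
    rw [← h1, ← integral_const_mul]
    have h3 : ∀ x, ((k : ℝ) + 1) * (((Ω.pow k).wedgeOne β).wedgeOne a).ratio ν x = β.ev x ![velocityField φ t x] := fun x =>
      ratio_wedge_pow_contract Ω β (velocityField φ t) x (hν.ne_zero x)
    simp only [h3]
    have hpres : Form.pullback (φ t) ν = ν := by
      have h4 := Form.pullback_pow Ω (k + 1) (φ t)
      rw [show Form.pullback (φ t) Ω = Ω from hφ.mem t] at h4
      exact h4
    have hmp := hμ.measurePreserving (φ t) hpres
    -- Substituting φ_t(x) for x replaces the field X_t by the velocity of the orbit of x.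
    rw [← hmp.integral_comp (φ t).toHomeomorph.measurableEmbedding fun x => β.ev x ![velocityField φ t x]]
    simp only [hφ.velocity_eq]
  rw [hφ.area_sweep hΩ.closed hγ]
  have hk : ((k : ℝ) + 1) ≠ 0 := by positivity
  refine (mul_eq_zero.1 ?_).resolve_left hk
  rw [← intervalIntegral.integral_const_mul]
  simp only [hflux]
  have hcont := hφ.continuous_velocity_pairing hβ.1
  -- With the order exchanged, the inner integral is that of β along the orbit of x.
  rw [intervalIntegral.integral_of_le zero_le_one, integral_integral_swap]
  · refine integral_eq_zero_of_ae (Filter.Eventually.of_forall fun x => ?_)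
    simp only
    rw [← intervalIntegral.integral_of_le zero_le_one]
    exact hβ.loopIntegral_eq_zero (c := fun t => φ t x) (hφ.smooth.comp (contMDiff_id.prodMk contMDiff_const))
      (orbit hφ x) (fun t => rfl) (h0 x)
  · obtain ⟨C, hC⟩ := (isCompact_Icc (a := (0 : ℝ)) (b := 1)).prod (isCompact_univ (X := M)) |>.exists_bound_of_continuousOn hcont.continuousOn
    refine Integrable.of_bound (hcont.aestronglyMeasurable) C ?_
    have h5 : ∀ᵐ p : ℝ × M ∂((volume.restrict (Set.Ioc 0 1)).prod μ), p.1 ∈ Set.Ioc (0 : ℝ) 1 :=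
      Measure.quasiMeasurePreserving_fst.ae (ae_restrict_mem measurableSet_Ioc)
    filter_upwards [h5] with p hp
    exact hC p ⟨Set.Ioc_subset_Icc_self hp, trivial⟩

end LefschetzFlux

/-! ### Smoothing continuous maps into a manifold -/

section Smoothing

open Filter

variable {m : ℕ} {M : Type u} [TopologicalSpace M] [ChartedSpace (EuclideanSpace ℝ (Fin m)) M]
  [IsManifold (𝓡 m) ∞ M]
variable {W : Type*} [NormedAddCommGroup W] [NormedSpace ℝ W] [FiniteDimensional ℝ W]

local notation "𝔼" => EuclideanSpace ℝ (Fin m)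

/-- Small perturbations of `H` in the chart around `p` map a compact set to a prescribed open set. -/
lemma eventually_chart_perturbation {H : W → M} (hH : Continuous H) (p : M) {C : Set W} (hC : IsCompact C)
    (hp : ∀ w ∈ C, H w ∈ (extChartAt (𝓡 m) p).source) {U : Set M} (hU : IsOpen U) (hCU : ∀ w ∈ C, H w ∈ U) :
    ∀ᶠ ε in nhdsWithin (0 : ℝ) (Set.Ioi 0), ∀ w ∈ C, ∀ v : 𝔼, ‖v‖ < ε →
      extChartAt (𝓡 m) p (H w) + v ∈ (extChartAt (𝓡 m) p).target ∧
      (extChartAt (𝓡 m) p).symm (extChartAt (𝓡 m) p (H w) + v) ∈ U := by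
  set e := extChartAt (𝓡 m) p
  have ho : IsOpen (e.target ∩ e.symm ⁻¹' U) :=
    (continuousOn_extChartAt_symm p).isOpen_inter_preimage (isOpen_extChartAt_target p) hU
  have hK : IsCompact ((e ∘ H) '' C) :=
    hC.image_of_continuousOn ((continuousOn_extChartAt p).comp hH.continuousOn hp)
  have hsub : (e ∘ H) '' C ⊆ e.target ∩ e.symm ⁻¹' U := by
    rintro _ ⟨w, hw, rfl⟩
    refine ⟨e.map_source (hp w hw), ?_⟩
    change e.symm (e (H w)) ∈ U
    rw [e.left_inv (hp w hw)]
    exact hCU w hw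
  obtain ⟨δ, hδ, hsub⟩ := hK.exists_thickening_subset_open ho hsub
  filter_upwards [Ioo_mem_nhdsGT hδ] with ε hε w hw v hv
  refine hsub (Metric.mem_thickening_iff.2 ⟨e (H w), ⟨w, hw, rfl⟩, ?_⟩)
  rw [dist_eq_norm, add_sub_cancel_left]
  exact hv.trans hε.2

/-- In the chart, H is corrected by the difference between χ·H and a smooth approximation g of it.
Where χ = 1 the result is g; off the ball nothing changes; where H was smooth the correction is
smooth. The pairs (C i, U i) record finitely many constraints that must survive, so that the step
can be repeated in other charts. -/
lemma exists_smooth_on_ball {H : W → M} (hH : Continuous H) {z : W} (χ : ContDiffBump z)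
    (p : M) (hp : ∀ w ∈ Metric.closedBall z χ.rOut, H w ∈ (extChartAt (𝓡 m) p).source)
    {ι : Type*} [Finite ι] {C : ι → Set W} {U : ι → Set M} (hC : ∀ i, IsCompact (C i)) (hU : ∀ i, IsOpen (U i))
    (hCU : ∀ i, ∀ w ∈ C i, H w ∈ U i) :
    ∃ H' : W → M, Continuous H' ∧ (∀ w ∉ Metric.closedBall z χ.rOut, H' w = H w) ∧
      (∀ w, ContMDiffAt 𝓘(ℝ, W) (𝓡 m) ∞ H w → ContMDiffAt 𝓘(ℝ, W) (𝓡 m) ∞ H' w) ∧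
      (∀ w ∈ Metric.ball z χ.rIn, ContMDiffAt 𝓘(ℝ, W) (𝓡 m) ∞ H' w) ∧ ∀ i, ∀ w ∈ C i, H' w ∈ U i := by
  set e := extChartAt (𝓡 m) p with he
  have hB : IsCompact (Metric.closedBall z χ.rOut) := isCompact_closedBall z χ.rOut
  have hev := (eventually_chart_perturbation (m := m) hH p hB hp isOpen_univ fun _ _ => Set.mem_univ _).and
    (eventually_all.2 fun i => eventually_chart_perturbation (m := m) hH p ((hC i).inter_right hB.isClosed)
      (fun w hw => hp w hw.2) (hU i) fun w hw => hCU i w hw.1)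
  obtain ⟨ε, ⟨h1, h2⟩, hε⟩ := (hev.and self_mem_nhdsWithin).exists
  have hsrc : ∀ w, H w ∈ e.source → ContinuousAt (fun w => e (H w)) w := fun w hw =>
    (continuousAt_extChartAt' hw).comp hH.continuousAt
  let f : W → 𝔼 := fun w => χ w • e (H w)
  have hf0 : ∀ w ∉ Metric.closedBall z χ.rOut, f w = 0 := fun w hw => by
    have : χ w = 0 := χ.zero_of_le_dist (le_of_lt (by simpa using hw))
    simp only [f, this, zero_smul]
  have hout : ∀ w ∉ Metric.closedBall z χ.rOut, ∀ᶠ w' in nhds w, w' ∉ Metric.closedBall z χ.rOut :=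
    fun w hw => Metric.isClosed_closedBall.isOpen_compl.mem_nhds hw
  have hf : Continuous f := continuous_iff_continuousAt.2 fun w => by
    by_cases hw : w ∈ Metric.closedBall z χ.rOut
    · exact χ.continuous.continuousAt.smul (hsrc w (hp w hw))
    · refine (continuousAt_const (y := (0 : 𝔼))).congr ?_
      filter_upwards [hout w hw] with w' hw' using (hf0 w' hw').symm
  -- The approximation is supported where f is, so the correction g - f vanishes off the ball.
  obtain ⟨g, hg, hgf, hsupp⟩ := hf.exists_contDiff_approx ⊤ (ε := fun _ => ε) continuous_const fun _ => hε
  have hg0 : ∀ w ∉ Metric.closedBall z χ.rOut, g w = 0 := fun w hw => by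
    by_contra h
    exact hsupp h (hf0 w hw)
  let v : W → 𝔼 := fun w => g w - f w
  have hv : ∀ w, ‖v w‖ < ε := fun w => by simpa [v, dist_eq_norm] using hgf w
  let H' : W → M := fun w => open scoped Classical in
    if H w ∈ e.source then e.symm (e (H w) + v w) else H w
  have hH'in : ∀ w, H w ∈ e.source → H' =ᶠ[nhds w] fun w => e.symm (e (H w) + v w) := fun w hw => by
    filter_upwards [hH.continuousAt ((isOpen_extChartAt_source (I := 𝓡 m) p).mem_nhds hw)] with w' hw'
    exact if_pos hw'
  have hH'out : ∀ w ∉ Metric.closedBall z χ.rOut, H' w = H w := fun w hw => by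
    by_cases h : H w ∈ e.source
    · refine (if_pos h).trans ?_
      simp only [v, hf0 w hw, hg0 w hw, sub_zero, add_zero]
      exact e.left_inv h
    · exact if_neg h
  have hH'ev : ∀ w ∉ Metric.closedBall z χ.rOut, H' =ᶠ[nhds w] H := fun w hw => by
    filter_upwards [hout w hw] with w' hw' using hH'out w' hw'
  have htar : ∀ w ∈ Metric.closedBall z χ.rOut, e (H w) + v w ∈ e.target := fun w hw => (h1 w hw _ (hv w)).1
  refine ⟨H', ?_, hH'out, fun w hw => ?_, fun w hw => ?_, fun i w hw => ?_⟩
  · refine continuous_iff_continuousAt.2 fun w => ?_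
    by_cases hw : w ∈ Metric.closedBall z χ.rOut
    · refine ContinuousAt.congr ?_ (hH'in w (hp w hw)).symm
      exact ((contMDiffAt_extChartAt_symm (htar w hw)).continuousAt).comp (f := fun w => e (H w) + v w)
        ((hsrc w (hp w hw)).add (hg.continuous.sub hf).continuousAt)
    · exact hH.continuousAt.congr (hH'ev w hw).symm
  · by_cases hwB : w ∈ Metric.closedBall z χ.rOut
    · refine ContMDiffAt.congr_of_eventuallyEq ?_ (hH'in w (hp w hwB))
      have h3 : ContDiffAt ℝ ∞ (fun w => e (H w)) w := contDiffAt_chart_comp le_rfl hw (hp w hwB)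
      have h4 : ContDiffAt ℝ ∞ (fun w => e (H w) + v w) w :=
        h3.add (hg.contDiffAt.sub (χ.contDiff.contDiffAt.smul h3))
      exact (contMDiffAt_extChartAt_symm (htar w hwB)).comp w h4.contMDiffAt
    · exact hw.congr_of_eventuallyEq (hH'ev w hwB)
  · have hwB : w ∈ Metric.closedBall z χ.rOut :=
      Metric.ball_subset_closedBall (Metric.ball_subset_ball χ.rIn_lt_rOut.le hw)
    have h5 : H' =ᶠ[nhds w] fun w => e.symm (g w) := by
      filter_upwards [hH'in w (hp w hwB), Metric.isOpen_ball.mem_nhds hw] with w' h6 h7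
      have h8 : χ w' = 1 := χ.one_of_mem_closedBall (Metric.ball_subset_closedBall h7)
      rw [h6]
      simp only [v, f, h8, one_smul, add_sub_cancel]
    refine ContMDiffAt.congr_of_eventuallyEq ?_ h5
    have h9 : g w ∈ e.target := by
      have h8 : χ w = 1 := χ.one_of_mem_closedBall (Metric.ball_subset_closedBall hw)
      have := htar w hwB
      simpa only [v, f, h8, one_smul, add_sub_cancel] using this
    exact (contMDiffAt_extChartAt_symm h9).comp w hg.contDiffAt.contMDiffAt
  · by_cases hwB : w ∈ Metric.closedBall z χ.rOut
    · have : H' w = e.symm (e (H w) + v w) := if_pos (hp w hwB)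
      rw [this]
      exact (h2 i w ⟨hw, hwB⟩ _ (hv w)).2
    · rw [hH'out w hwB]
      exact hCU i w hw

/-- A continuous map to a manifold which is smooth off a compact set can be made smooth by changing
it in a neighbourhood of that set. -/
theorem exists_contMDiff_eqOn_compl {H : W → M} (hH : Continuous H) {K O : Set W} (hK : IsCompact K)
    (hO : IsOpen O) (hKO : K ⊆ O) (hs : ∀ w ∉ K, ContMDiffAt 𝓘(ℝ, W) (𝓡 m) ∞ H w) :
    ∃ D : W → M, ContMDiff 𝓘(ℝ, W) (𝓡 m) ∞ D ∧ ∀ w ∉ O, D w = H w := by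
  have h1 : ∀ z : K, ∃ r > 0, Metric.closedBall (z : W) r ⊆ O ∩ H ⁻¹' (extChartAt (𝓡 m) (H z)).source := fun z =>
    Metric.nhds_basis_closedBall.mem_iff.1 (inter_mem (hO.mem_nhds (hKO z.2))
      (hH.continuousAt ((isOpen_extChartAt_source (I := 𝓡 m) (H z)).mem_nhds (mem_extChartAt_source _))))
  choose r hr hsub using h1
  obtain ⟨t, ht⟩ := hK.elim_finite_subcover (fun z : K => Metric.ball (z : W) (r z / 2)) (fun _ => Metric.isOpen_ball)
    fun z hz => Set.mem_iUnion.2 ⟨⟨z, hz⟩, Metric.mem_ball_self (half_pos (hr _))⟩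
  let C : t → Set W := fun i => Metric.closedBall (i : W) (r i)
  let U : t → Set M := fun i => (extChartAt (𝓡 m) (H i)).source
  -- Balls are treated one at a time. The invariant D(C i) ⊆ U i keeps every later ball inside its
  -- chart domain.
  have key : ∀ s : Finset t, ∃ D : W → M, Continuous D ∧ (∀ w ∉ O, D w = H w) ∧
      (∀ w ∉ K, ContMDiffAt 𝓘(ℝ, W) (𝓡 m) ∞ D w) ∧
      (∀ i ∈ s, ∀ w ∈ Metric.ball (i : W) (r i / 2), ContMDiffAt 𝓘(ℝ, W) (𝓡 m) ∞ D w) ∧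
      ∀ i, ∀ w ∈ C i, D w ∈ U i := by
    classical
    intro s
    induction s using Finset.induction with
    | empty => exact ⟨H, hH, fun _ _ => rfl, hs, by simp, fun i w hw => (hsub i hw).2⟩
    | insert i s his ih =>
      obtain ⟨D, hD, hDO, hDs, hDi, hDU⟩ := ih
      let χ : ContDiffBump ((i : K) : W) := ⟨r i / 2, r i, half_pos (hr _), half_lt_self (hr _)⟩
      obtain ⟨D', hD', h2, h3, h4, h5⟩ := exists_smooth_on_ball (m := m) hD χ (H i) (hDU i)
        (fun j : t => isCompact_closedBall (j : W) (r j)) (fun j : t => isOpen_extChartAt_source (I := 𝓡 m) (H j)) hDU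
      refine ⟨D', hD', fun w hw => ?_, fun w hw => h3 w (hDs w hw), fun j hj w hw => ?_, h5⟩
      · rw [h2 w fun h => hw (hsub i h).1, hDO w hw]
      · rcases Finset.mem_insert.1 hj with rfl | hj
        · exact h4 w hw
        · exact h3 w (hDi j hj w hw)
  obtain ⟨D, hD, hDO, hDs, hDi, -⟩ := key Finset.univ
  refine ⟨D, fun w => ?_, hDO⟩
  by_cases hw : w ∈ K
  · obtain ⟨i, hi, hwi⟩ := Set.mem_iUnion₂.1 (ht hw)
    exact hDi ⟨i, hi⟩ (Finset.mem_univ _) w hwi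
  · exact hDs w hw

end Smoothing

/-! ### The area integrand under reparametrization -/

section AreaDensity

variable {m : ℕ} {M : Type u} [TopologicalSpace M] [ChartedSpace (EuclideanSpace ℝ (Fin m)) M]

/-- The integrand of the area of a map from the plane. -/
def areaDensity (Ω : Form m M 2) (u : ℝ × ℝ → M) (z : ℝ × ℝ) : ℝ :=
  pb Ω u z ![((1 : ℝ), (0 : ℝ)), ((0 : ℝ), (1 : ℝ))]

lemma area_eq_areaDensity (Ω : Form m M 2) (u : ℝ × ℝ → M) :
    area Ω u = ∫ t in (0 : ℝ)..1, ∫ s in (0 : ℝ)..1, areaDensity Ω u (t, s) := by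
  refine intervalIntegral.integral_congr fun t _ => intervalIntegral.integral_congr fun s _ => ?_
  refine congrArg (Ω (u (t, s))) ?_
  funext i
  fin_cases i <;> rfl

lemma areaDensity_congr (Ω : Form m M 2) {u u' : ℝ × ℝ → M} {z : ℝ × ℝ} (h : u =ᶠ[nhds z] u') :
    areaDensity Ω u z = areaDensity Ω u' z := by
  rw [areaDensity, pb_congr Ω h, areaDensity]

/-- The reparametrization (τ(t), ρ(t) κ(s)) has a triangular Jacobian matrix, so the derivative of ρ
drops out of its determinant. -/
lemma areaDensity_comp (Ω : Form m M 2) {u : ℝ × ℝ → M} (hu : ContMDiff 𝓘(ℝ, ℝ × ℝ) (𝓡 m) ∞ u) {τ ρ κ : ℝ → ℝ}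
    {t s τ' ρ' κ' : ℝ} (hτ : HasDerivAt τ τ' t) (hρ : HasDerivAt ρ ρ' t) (hκ : HasDerivAt κ κ' s) :
    areaDensity Ω (fun z => u (τ z.1, ρ z.1 * κ z.2)) (t, s) =
      areaDensity Ω u (τ t, ρ t * κ s) * (τ' * (ρ t * κ')) := by
  have h1 : HasFDerivAt (fun z : ℝ × ℝ => τ z.1) (τ' • ContinuousLinearMap.fst ℝ ℝ ℝ) (t, s) :=
    hτ.comp_hasFDerivAt (t, s) hasFDerivAt_fst
  have h2 : HasFDerivAt (fun z : ℝ × ℝ => ρ z.1) (ρ' • ContinuousLinearMap.fst ℝ ℝ ℝ) (t, s) :=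
    hρ.comp_hasFDerivAt (t, s) hasFDerivAt_fst
  have h3 : HasFDerivAt (fun z : ℝ × ℝ => κ z.2) (κ' • ContinuousLinearMap.snd ℝ ℝ ℝ) (t, s) :=
    hκ.comp_hasFDerivAt (t, s) hasFDerivAt_snd
  have h4 : HasFDerivAt (fun z : ℝ × ℝ => (τ z.1, ρ z.1 * κ z.2))
      ((τ' • ContinuousLinearMap.fst ℝ ℝ ℝ).prod
        (ρ t • κ' • ContinuousLinearMap.snd ℝ ℝ ℝ + κ s • ρ' • ContinuousLinearMap.fst ℝ ℝ ℝ)) (t, s) :=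
    h1.prodMk (h2.mul h3)
  have h5 := pb_comp Ω (u := u) (f := fun z : ℝ × ℝ => (τ z.1, ρ z.1 * κ z.2)) (z := (t, s))
    (hu.mdifferentiableAt (by simp)) h4.differentiableAt
  have h6 : areaDensity Ω (fun z => u (τ z.1, ρ z.1 * κ z.2)) (t, s) =
      bilin (pb Ω u (τ t, ρ t * κ s)) (τ', ρ' * κ s) (0, ρ t * κ') := by
    rw [areaDensity]
    refine (congrArg (fun A => A ![((1 : ℝ), (0 : ℝ)), ((0 : ℝ), (1 : ℝ))]) h5).trans ?_
    rw [h4.fderiv, ContinuousAlternatingMap.compContinuousLinearMap_apply, bilin_apply]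
    congr 1
    funext i
    fin_cases i <;> simp [mul_comm]
  set B := bilin (pb Ω u (τ t, ρ t * κ s)) with hB
  have h7 : B (0, 1) (0, 1) = 0 := by
    have := bilin_skew (pb Ω u (τ t, ρ t * κ s)) (0, 1) (0, 1)
    rw [← hB] at this
    linarith
  have h8 : ((τ', ρ' * κ s) : ℝ × ℝ) = τ' • ((1, 0) : ℝ × ℝ) + (ρ' * κ s) • ((0, 1) : ℝ × ℝ) := by simp
  have h9 : ((0, ρ t * κ') : ℝ × ℝ) = (ρ t * κ') • ((0, 1) : ℝ × ℝ) := by simp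
  rw [h6, h8, h9]
  simp only [map_add, map_smul, LinearMap.add_apply, LinearMap.smul_apply, smul_eq_mul, h7]
  change _ = B (1, 0) (0, 1) * _
  ring

lemma areaDensity_prodMap (Ω : Form m M 2) {u : ℝ × ℝ → M} (hu : ContMDiff 𝓘(ℝ, ℝ × ℝ) (𝓡 m) ∞ u) {τ κ : ℝ → ℝ}
    {t s τ' κ' : ℝ} (hτ : HasDerivAt τ τ' t) (hκ : HasDerivAt κ κ' s) :
    areaDensity Ω (fun z => u (τ z.1, κ z.2)) (t, s) = areaDensity Ω u (τ t, κ s) * (τ' * κ') := by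
  simpa using areaDensity_comp Ω hu hτ (hasDerivAt_const t (1 : ℝ)) hκ

lemma continuous_areaDensity [IsManifold (𝓡 m) ∞ M] {Ω : Form m M 2} (hΩ : Ω.IsSmooth) {u : ℝ × ℝ → M}
    (hu : ContMDiff 𝓘(ℝ, ℝ × ℝ) (𝓡 m) ∞ u) : Continuous (areaDensity Ω u) :=
  continuous_iff_continuousAt.2 fun z =>
    (contDiffAt_alternating_apply (v := fun _ => ![((1 : ℝ), (0 : ℝ)), ((0 : ℝ), (1 : ℝ))])
      (hΩ.contDiffAt_pb (hu z)) fun _ => contDiffAt_const).continuousAt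

end AreaDensity

/-! ### Substitution and splitting in double integrals -/

section Integrals

lemma integral_comp_prodMap_mul_deriv {g : ℝ × ℝ → ℝ} (hg : Continuous g) {τ κ : ℝ → ℝ} (hτ : ContDiff ℝ ∞ τ)
    (hκ : ContDiff ℝ ∞ κ) (a b c d : ℝ) :
    ∫ t in a..b, ∫ s in c..d, g (τ t, κ s) * (deriv τ t * deriv κ s) =
      ∫ t in τ a..τ b, ∫ s in κ c..κ d, g (t, s) := by
  have h1 : ∀ t, ∫ s in c..d, g (τ t, κ s) * (deriv τ t * deriv κ s) =
      (∫ s in κ c..κ d, g (τ t, s)) * deriv τ t := fun t => by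
    rw [← intervalIntegral.integral_comp_mul_deriv (f := κ) (f' := deriv κ) (g := fun s => g (τ t, s))
      (fun s _ => (hκ.differentiable (by simp) s).hasDerivAt) (hκ.continuous_deriv (by simp)).continuousOn
      (hg.comp (by fun_prop : Continuous fun s => (τ t, s))), ← intervalIntegral.integral_mul_const]
    refine intervalIntegral.integral_congr fun s _ => ?_
    simp only [Function.comp]
    ring
  simp only [h1]
  exact intervalIntegral.integral_comp_mul_deriv (f := τ) (f' := deriv τ) (g := fun t => ∫ s in κ c..κ d, g (t, s))
    (fun s _ => (hτ.differentiable (by simp) s).hasDerivAt) (hτ.continuous_deriv (by simp)).continuousOn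
    (intervalIntegral.continuous_parametric_intervalIntegral_of_continuous' (f := fun t s => g (t, s)) hg _ _)

lemma integral_integral_split {f : ℝ × ℝ → ℝ} (hf : Continuous f) (a b c d e : ℝ) :
    ∫ t in a..b, ∫ s in c..e, f (t, s) = (∫ t in a..b, ∫ s in c..d, f (t, s)) + ∫ t in a..b, ∫ s in d..e, f (t, s) := by
  have h1 : ∀ t, Continuous fun s => f (t, s) := fun t => hf.comp (by fun_prop)
  have h2 : ∀ c d : ℝ, Continuous fun t => ∫ s in c..d, f (t, s) := fun c d =>
    intervalIntegral.continuous_parametric_intervalIntegral_of_continuous' (f := fun t s => f (t, s)) hf _ _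
  rw [← intervalIntegral.integral_add ((h2 _ _).intervalIntegrable _ _) ((h2 _ _).intervalIntegrable _ _)]
  refine intervalIntegral.integral_congr fun t _ => ?_
  exact (intervalIntegral.integral_add_adjacent_intervals ((h1 t).intervalIntegrable _ _)
    ((h1 t).intervalIntegrable _ _)).symm

end Integrals

/-! ### Cut-off functions -/

section Step

/-- A smooth step, equal to `0` on `(-∞, 1/3]` and to `1` on `[2/3, ∞)`. -/
def step (x : ℝ) : ℝ := Real.smoothTransition (3 * x - 1)

lemma step_eq_zero {x : ℝ} (h : x ≤ 1 / 3) : step x = 0 := Real.smoothTransition.zero_of_nonpos (by linarith)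

lemma step_eq_one {x : ℝ} (h : 2 / 3 ≤ x) : step x = 1 := Real.smoothTransition.one_of_one_le (by linarith)

lemma contDiff_step : ContDiff ℝ ∞ step :=
  Real.smoothTransition.contDiff.comp ((contDiff_const.mul contDiff_id).sub contDiff_const)

lemma step_mem (x : ℝ) : step x ∈ Set.Icc (0 : ℝ) 1 :=
  ⟨Real.smoothTransition.nonneg _, Real.smoothTransition.le_one _⟩

lemma contDiff_step_comp (a b : ℝ) : ContDiff ℝ ∞ fun x => step (a * x + b) :=
  contDiff_step.comp ((contDiff_const.mul contDiff_id).add contDiff_const)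

lemma deriv_step_eq_zero {x : ℝ} (h : x < 1 / 3 ∨ 2 / 3 < x) : deriv step x = 0 := by
  rcases h with h | h
  · have : step =ᶠ[nhds x] fun _ => 0 := by
      filter_upwards [gt_mem_nhds h] with y hy using step_eq_zero hy.le
    rw [this.deriv_eq, deriv_const]
  · have : step =ᶠ[nhds x] fun _ => 1 := by
      filter_upwards [lt_mem_nhds h] with y hy using step_eq_one hy.le
    rw [this.deriv_eq, deriv_const]

/-- A smooth plateau, vanishing at `0` and `1` and equal to `1` on `[1/3, 2/3]`. -/
def plateau (x : ℝ) : ℝ := Real.smoothTransition (3 * x) * Real.smoothTransition (3 - 3 * x)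

lemma plateau_zero : plateau 0 = 0 := by simp [plateau]

lemma plateau_one : plateau 1 = 0 := by simp [plateau]

lemma plateau_eq_one {x : ℝ} (h : 1 / 3 ≤ x) (h' : x ≤ 2 / 3) : plateau x = 1 := by
  rw [plateau, Real.smoothTransition.one_of_one_le (by linarith), Real.smoothTransition.one_of_one_le (by linarith), one_mul]

lemma contDiff_plateau : ContDiff ℝ ∞ plateau :=
  (Real.smoothTransition.contDiff.comp (contDiff_const.mul contDiff_id)).mul
    (Real.smoothTransition.contDiff.comp (contDiff_const.sub (contDiff_const.mul contDiff_id)))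

/-- The plateau covers the interval on which `step` moves. So a path can run out along one side,
move across, and run back, smoothly. -/
lemma step_or_plateau (x : ℝ) : step x = 0 ∨ step x = 1 ∨ plateau x = 1 := by
  rcases le_total x (1 / 3) with h | h
  · exact Or.inl (step_eq_zero h)
  rcases le_total x (2 / 3) with h' | h'
  · exact Or.inr (Or.inr (plateau_eq_one h h'))
  · exact Or.inr (Or.inl (step_eq_one h'))

lemma deriv_step_mul_plateau (x : ℝ) : deriv step x = 0 ∨ plateau x = 1 := by
  by_cases h : x < 1 / 3 ∨ 2 / 3 < x
  · exact Or.inl (deriv_step_eq_zero h)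
  · rw [not_or, not_lt, not_lt] at h
    exact Or.inr (plateau_eq_one h.1 h.2)

end Step

/-! ### Spheres, tori and contractible orbits -/

section Spheres

variable {m : ℕ} {M : Type u} [TopologicalSpace M] [ChartedSpace (EuclideanSpace ℝ (Fin m)) M]
  [IsManifold (𝓡 m) ∞ M]

lemma contDiff_prod_step {τ ρ κ : ℝ → ℝ} (hτ : ContDiff ℝ ∞ τ) (hρ : ContDiff ℝ ∞ ρ) (hκ : ContDiff ℝ ∞ κ) :
    ContDiff ℝ ∞ fun z : ℝ × ℝ => (τ z.1, ρ z.1 * κ z.2) :=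
  (hτ.comp contDiff_fst).prodMk ((hρ.comp contDiff_fst).mul (hκ.comp contDiff_snd))

/-- If `Ω` vanishes on `π₂`, then it vanishes on cylinders with identified sides whose ends
are collapsed to one point. -/
lemma VanishesOnPiTwo.area_eq_zero {Ω : Form m M 2} (h : VanishesOnPiTwo Ω) (hΩ : Ω.IsSmooth) {F : ℝ × ℝ → M}
    (hF : ContMDiff 𝓘(ℝ, ℝ × ℝ) (𝓡 m) ∞ F) {p : M} (h0 : ∀ t, F (t, 0) = p) (h1 : ∀ t, F (t, 1) = p)
    (hper : ∀ s, F (0, s) = F (1, s)) : area Ω F = 0 := by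
  let κ₁ : ℝ → ℝ := fun s => step (2 * s + 0)
  let κ₂ : ℝ → ℝ := fun s => step (-2 * s + 2)
  have hκ₁ : ContDiff ℝ ∞ κ₁ := contDiff_step_comp 2 0
  have hκ₂ : ContDiff ℝ ∞ κ₂ := contDiff_step_comp (-2) 2
  -- The lower half of the square covers F and is collapsed to p on three sides. Its top edge runs
  -- out along F(0, ·) and back along F(1, ·), which is the same path; the upper half `v₂` retracts
  -- this edge to p inside the curve F(0, ·).
  let v₁ : ℝ × ℝ → M := fun z => F (step z.1, plateau z.1 * κ₁ z.2)
  let v₂ : ℝ × ℝ → M := fun z => F (0, plateau z.1 * κ₂ z.2)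
  have hv₁ : ContMDiff 𝓘(ℝ, ℝ × ℝ) (𝓡 m) ∞ v₁ := hF.comp (contDiff_prod_step contDiff_step contDiff_plateau hκ₁).contMDiff
  have hv₂ : ContMDiff 𝓘(ℝ, ℝ × ℝ) (𝓡 m) ∞ v₂ := hF.comp (contDiff_prod_step contDiff_const contDiff_plateau hκ₂).contMDiff
  let u : ℝ × ℝ → M := fun z => if z.2 < 1 / 2 then v₁ z else v₂ z
  have hv : ∀ z : ℝ × ℝ, 1 / 3 ≤ z.2 → z.2 ≤ 2 / 3 → v₁ z = v₂ z := fun z hz hz' => by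
    have e1 : κ₁ z.2 = 1 := step_eq_one (by linarith)
    have e2 : κ₂ z.2 = 1 := step_eq_one (by linarith)
    simp only [v₁, v₂, e1, e2, mul_one]
    rcases step_or_plateau z.1 with h | h | h
    · rw [h]
    · rw [h, hper]
    · rw [h, h1, h1]
  have hu₁ : ∀ z : ℝ × ℝ, z.2 < 2 / 3 → u =ᶠ[nhds z] v₁ := fun z hz => by
    filter_upwards [continuousAt_snd.eventually (gt_mem_nhds hz)] with w hw
    by_cases hw' : w.2 < 1 / 2
    · exact if_pos hw'
    · exact (if_neg hw').trans (hv w (by linarith) hw.le).symm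
  have hu₂ : ∀ z : ℝ × ℝ, 1 / 3 < z.2 → u =ᶠ[nhds z] v₂ := fun z hz => by
    filter_upwards [continuousAt_snd.eventually (lt_mem_nhds hz)] with w hw
    by_cases hw' : w.2 < 1 / 2
    · exact (if_pos hw').trans (hv w hw.le (by linarith))
    · exact if_neg hw'
  have hu : ContMDiff 𝓘(ℝ, ℝ × ℝ) (𝓡 m) ∞ u := fun z => by
    rcases lt_or_ge z.2 (2 / 3) with hz | hz
    · exact (hv₁ z).congr_of_eventuallyEq (hu₁ z hz)
    · exact (hv₂ z).congr_of_eventuallyEq (hu₂ z (by linarith))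
  have hb : ∀ z : ℝ × ℝ, plateau z.1 = 0 → u z = p := fun z hz => by
    simp only [u, v₁, v₂, hz, zero_mul, h0, ite_self]
  have hu0 : area Ω u = 0 := h p u hu fun s _ => by
    refine ⟨hb _ plateau_zero, hb _ plateau_one, ?_, ?_⟩
    · refine (if_pos (by norm_num)).trans ?_
      have : κ₁ 0 = 0 := step_eq_zero (by norm_num)
      simp only [v₁, this, mul_zero, h0]
    · refine (if_neg (by norm_num)).trans ?_
      have : κ₂ 1 = 0 := step_eq_zero (by norm_num)
      simp only [v₂, this, mul_zero, h0]
  have hd : ∀ {f : ℝ → ℝ}, ContDiff ℝ ∞ f → ∀ t, HasDerivAt f (deriv f t) t := fun hf t =>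
    (hf.differentiable (by simp) t).hasDerivAt
  rw [area_eq_areaDensity, integral_integral_split (continuous_areaDensity hΩ hu) _ _ _ (1 / 2)] at hu0
  have e1 : ∫ t in (0 : ℝ)..1, ∫ s in (0 : ℝ)..(1 / 2), areaDensity Ω u (t, s) =
      ∫ t in (0 : ℝ)..1, ∫ s in (0 : ℝ)..(1 / 2), areaDensity Ω F (step t, κ₁ s) * (deriv step t * deriv κ₁ s) := by
    refine intervalIntegral.integral_congr fun t _ => intervalIntegral.integral_congr fun s hs => ?_
    rw [Set.uIcc_of_le (by norm_num)] at hs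
    rw [areaDensity_congr Ω (hu₁ (t, s) (lt_of_le_of_lt hs.2 (by norm_num))),
      areaDensity_comp Ω hF (hd contDiff_step t) (hd contDiff_plateau t) (hd hκ₁ s)]
    -- Either the Jacobian vanishes or the plateau factor is 1; so the collapse does not affect the
    -- area.
    rcases deriv_step_mul_plateau t with h | h <;> simp [h]
  -- The upper half stays in a curve and sweeps no area.
  have e2 : ∫ t in (0 : ℝ)..1, ∫ s in (1 / 2 : ℝ)..1, areaDensity Ω u (t, s) = ∫ t in (0 : ℝ)..1, ∫ s in (1 / 2 : ℝ)..1, (0 : ℝ) := by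
    refine intervalIntegral.integral_congr fun t _ => intervalIntegral.integral_congr fun s hs => ?_
    rw [Set.uIcc_of_le (by norm_num)] at hs
    rw [areaDensity_congr Ω (hu₂ (t, s) (lt_of_lt_of_le (by norm_num) hs.1)),
      areaDensity_comp Ω hF (hasDerivAt_const t (0 : ℝ)) (hd contDiff_plateau t) (hd hκ₂ s), zero_mul, mul_zero]
  rw [e1, e2, integral_comp_prodMap_mul_deriv (continuous_areaDensity hΩ hF) contDiff_step hκ₁,
    step_eq_zero (by norm_num), step_eq_one (by norm_num), show κ₁ 0 = 0 from step_eq_zero (by norm_num),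
    show κ₁ (1 / 2) = 1 from step_eq_one (by norm_num)] at hu0
  simpa [area_eq_areaDensity] using hu0

/-- If `Ω` vanishes on `π₂`, then it vanishes on tori one of whose meridians can be contracted. -/
lemma VanishesOnPiTwo.area_torus_eq_zero {Ω : Form m M 2} (h : VanishesOnPiTwo Ω) (hΩ : Ω.IsSmooth) {D G : ℝ × ℝ → M}
    (hD : ContMDiff 𝓘(ℝ, ℝ × ℝ) (𝓡 m) ∞ D) (hG : ContMDiff 𝓘(ℝ, ℝ × ℝ) (𝓡 m) ∞ G) {p : M}
    (hD0 : ∀ t, D (t, 0) = p) (hDG : ∀ t, D (t, 1) = G (t, 0)) (hG1 : ∀ t, G (t, 1) = G (t, 0))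
    (hDper : ∀ s, D (0, s) = D (1, s)) (hGper : ∀ s, G (0, s) = G (1, s)) : area Ω G = 0 := by
  let κ₁ : ℝ → ℝ := fun s => step (3 * s + 0)
  let κ₂ : ℝ → ℝ := fun s => step (3 * s + -1)
  let κ₃ : ℝ → ℝ := fun s => step (-3 * s + 3)
  have hκ₁ : ContDiff ℝ ∞ κ₁ := contDiff_step_comp 3 0
  have hκ₂ : ContDiff ℝ ∞ κ₂ := contDiff_step_comp 3 (-1)
  have hκ₃ : ContDiff ℝ ∞ κ₃ := contDiff_step_comp (-3) 3
  let v₁ : ℝ × ℝ → M := fun z => D (z.1, κ₁ z.2)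
  let v₂ : ℝ × ℝ → M := fun z => G (z.1, κ₂ z.2)
  let v₃ : ℝ × ℝ → M := fun z => D (z.1, κ₃ z.2)
  have hP : ∀ {κ : ℝ → ℝ}, ContDiff ℝ ∞ κ → ContMDiff 𝓘(ℝ, ℝ × ℝ) 𝓘(ℝ, ℝ × ℝ) ∞ fun z : ℝ × ℝ => (z.1, κ z.2) := fun hκ =>
    (contDiff_fst.prodMk (hκ.comp contDiff_snd)).contMDiff
  have hv₁ : ContMDiff 𝓘(ℝ, ℝ × ℝ) (𝓡 m) ∞ v₁ := hD.comp (hP hκ₁)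
  have hv₂ : ContMDiff 𝓘(ℝ, ℝ × ℝ) (𝓡 m) ∞ v₂ := hG.comp (hP hκ₂)
  have hv₃ : ContMDiff 𝓘(ℝ, ℝ × ℝ) (𝓡 m) ∞ v₃ := hD.comp (hP hκ₃)
  -- The torus cut open with a disc on each end: D, then G, then D reversed. The reparametrizations
  -- are constant near the seams, so F is smooth.
  let F : ℝ × ℝ → M := fun z => if z.2 < 1 / 3 then v₁ z else if z.2 < 2 / 3 then v₂ z else v₃ z
  have hv₁₂ : ∀ z : ℝ × ℝ, 2 / 9 ≤ z.2 → z.2 ≤ 4 / 9 → v₁ z = v₂ z := fun z hz hz' => by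
    have e1 : κ₁ z.2 = 1 := step_eq_one (by linarith)
    have e2 : κ₂ z.2 = 0 := step_eq_zero (by linarith)
    simp only [v₁, v₂, e1, e2, hDG]
  have hv₂₃ : ∀ z : ℝ × ℝ, 5 / 9 ≤ z.2 → z.2 ≤ 7 / 9 → v₂ z = v₃ z := fun z hz hz' => by
    have e1 : κ₂ z.2 = 1 := step_eq_one (by linarith)
    have e2 : κ₃ z.2 = 1 := step_eq_one (by linarith)
    simp only [v₂, v₃, e1, e2, hDG, hG1]
  have hF₁ : ∀ z : ℝ × ℝ, z.2 < 4 / 9 → F =ᶠ[nhds z] v₁ := fun z hz => by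
    filter_upwards [continuousAt_snd.eventually (gt_mem_nhds hz)] with w hw
    by_cases hw' : w.2 < 1 / 3
    · exact if_pos hw'
    · exact (if_neg hw').trans ((if_pos (by linarith)).trans (hv₁₂ w (by linarith) hw.le).symm)
  have hF₂ : ∀ z : ℝ × ℝ, 2 / 9 < z.2 → z.2 < 7 / 9 → F =ᶠ[nhds z] v₂ := fun z hz hz' => by
    filter_upwards [continuousAt_snd.eventually (lt_mem_nhds hz), continuousAt_snd.eventually (gt_mem_nhds hz')] with w h1 h2
    by_cases h3 : w.2 < 1 / 3
    · exact (if_pos h3).trans (hv₁₂ w h1.le (by linarith))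
    · refine (if_neg h3).trans ?_
      by_cases h4 : w.2 < 2 / 3
      · exact if_pos h4
      · exact (if_neg h4).trans (hv₂₃ w (by linarith) h2.le).symm
  have hF₃ : ∀ z : ℝ × ℝ, 5 / 9 < z.2 → F =ᶠ[nhds z] v₃ := fun z hz => by
    filter_upwards [continuousAt_snd.eventually (lt_mem_nhds hz)] with w hw
    refine (if_neg (by linarith)).trans ?_
    by_cases h4 : w.2 < 2 / 3
    · exact (if_pos h4).trans (hv₂₃ w hw.le (by linarith))
    · exact if_neg h4
  have hF : ContMDiff 𝓘(ℝ, ℝ × ℝ) (𝓡 m) ∞ F := fun z => by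
    rcases lt_or_ge z.2 (4 / 9) with hz | hz
    · exact (hv₁ z).congr_of_eventuallyEq (hF₁ z hz)
    rcases lt_or_ge z.2 (7 / 9) with hz' | hz'
    · exact (hv₂ z).congr_of_eventuallyEq (hF₂ z (by linarith) hz')
    · exact (hv₃ z).congr_of_eventuallyEq (hF₃ z (by linarith))
  have hF0 : area Ω F = 0 := by
    refine h.area_eq_zero hΩ hF (p := p) (fun t => ?_) (fun t => ?_) fun s => ?_
    · refine (if_pos (by norm_num)).trans ?_
      have : κ₁ 0 = 0 := step_eq_zero (by norm_num)
      simp only [v₁, this, hD0]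
    · refine (if_neg (by norm_num)).trans ((if_neg (by norm_num)).trans ?_)
      have : κ₃ 1 = 0 := step_eq_zero (by norm_num)
      simp only [v₃, this, hD0]
    · simp only [F, v₁, v₂, v₃, hDper, hGper]
  -- Each strip contributes the area of its piece with the orientation of κ. As κ₃ runs from 1 to 0,
  -- the two discs cancel.
  have layer : ∀ {u : ℝ × ℝ → M} {κ : ℝ → ℝ} {c d : ℝ}, ContMDiff 𝓘(ℝ, ℝ × ℝ) (𝓡 m) ∞ u → ContDiff ℝ ∞ κ → c ≤ d →
      (∀ z : ℝ × ℝ, z.2 ∈ Set.Icc c d → F =ᶠ[nhds z] fun z => u (z.1, κ z.2)) →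
      ∫ t in (0 : ℝ)..1, ∫ s in c..d, areaDensity Ω F (t, s) =
        ∫ t in (0 : ℝ)..1, ∫ s in κ c..κ d, areaDensity Ω u (t, s) := by
    intro u κ c d hu hκ hcd hFu
    refine Eq.trans ?_ (integral_comp_prodMap_mul_deriv (τ := id) (continuous_areaDensity hΩ hu) contDiff_id hκ 0 1 c d)
    refine intervalIntegral.integral_congr fun t _ => intervalIntegral.integral_congr fun s hs => ?_
    rw [Set.uIcc_of_le hcd] at hs
    rw [areaDensity_congr Ω (hFu (t, s) hs), deriv_id]
    exact areaDensity_prodMap Ω hu (hasDerivAt_id t) (hκ.differentiable (by simp) s).hasDerivAt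
  have hc := continuous_areaDensity hΩ hF
  rw [area_eq_areaDensity, integral_integral_split hc _ _ _ (1 / 3), integral_integral_split hc _ _ (1 / 3) (2 / 3),
    layer hD hκ₁ (by norm_num) fun z hz => hF₁ z (lt_of_le_of_lt hz.2 (by norm_num)),
    layer hG hκ₂ (by norm_num) fun z hz => hF₂ z (lt_of_lt_of_le (by norm_num) hz.1) (lt_of_le_of_lt hz.2 (by norm_num)),
    layer hD hκ₃ (by norm_num) fun z hz => hF₃ z (lt_of_lt_of_le (by norm_num) hz.1),
    show κ₁ 0 = 0 from step_eq_zero (by norm_num), show κ₁ (1 / 3) = 1 from step_eq_one (by norm_num),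
    show κ₂ (1 / 3) = 0 from step_eq_zero (by norm_num), show κ₂ (2 / 3) = 1 from step_eq_one (by norm_num),
    show κ₃ (2 / 3) = 1 from step_eq_one (by norm_num), show κ₃ 1 = 0 from step_eq_zero (by norm_num)] at hF0
  simp only [intervalIntegral.integral_symm (0 : ℝ) 1, intervalIntegral.integral_neg] at hF0
  rw [area_eq_areaDensity]
  linarith

/-- A contractible smooth loop, reparametrized to be constant near its ends, is the end of a smooth contraction. -/
lemma exists_smooth_contraction {c : ℝ → M} (hc : ContMDiff 𝓘(ℝ, ℝ) (𝓡 m) ∞ c) {p : M} {q : Path p p}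
    (hq : ∀ t : unitInterval, q t = c t) (h : q.Homotopic (Path.refl p)) :
    ∃ D : ℝ × ℝ → M, ContMDiff 𝓘(ℝ, ℝ × ℝ) (𝓡 m) ∞ D ∧ (∀ t, D (t, 0) = p) ∧ (∀ t, D (t, 1) = c (step t)) ∧
      ∀ s, D (0, s) = p ∧ D (1, s) = p := by
  obtain ⟨K⟩ := h
  let σ : ℝ → unitInterval := fun x => ⟨step x, step_mem x⟩
  have hσ : Continuous σ := contDiff_step.continuous.subtype_mk _
  have hσ0 : ∀ {x : ℝ}, x ≤ 1 / 3 → σ x = 0 := fun hx => Subtype.ext (step_eq_zero hx)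
  have hσ1 : ∀ {x : ℝ}, 2 / 3 ≤ x → σ x = 1 := fun hx => Subtype.ext (step_eq_one hx)
  -- The homotopy is reversed, so that the constant path sits at 0. Using `step` in both variables
  -- makes H smooth off the middle square [1/3, 2/3]².
  let H : ℝ × ℝ → M := fun z => K (unitInterval.symm (σ z.2), σ z.1)
  have hH : Continuous H := K.continuous.comp
    ((unitInterval.continuous_symm.comp (hσ.comp continuous_snd)).prodMk (hσ.comp continuous_fst))
  have H1 : ∀ z : ℝ × ℝ, z.1 ≤ 1 / 3 → H z = p := fun z hz => by
    simp only [H, hσ0 hz]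
    exact K.source _
  have H2 : ∀ z : ℝ × ℝ, 2 / 3 ≤ z.1 → H z = p := fun z hz => by
    simp only [H, hσ1 hz]
    exact K.target _
  have H3 : ∀ z : ℝ × ℝ, z.2 ≤ 1 / 3 → H z = p := fun z hz => by
    simp only [H, hσ0 hz, unitInterval.symm_zero]
    exact K.apply_one _
  have H4 : ∀ z : ℝ × ℝ, 2 / 3 ≤ z.2 → H z = c (step z.1) := fun z hz => by
    simp only [H, hσ1 hz, unitInterval.symm_one]
    exact (K.apply_zero _).trans (hq _)
  have hK : IsCompact (Set.Icc (1 / 3 : ℝ) (2 / 3) ×ˢ Set.Icc (1 / 3 : ℝ) (2 / 3)) := isCompact_Icc.prod isCompact_Icc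
  -- Smoothing changes H only inside the open unit square, so the prescribed values on its boundary
  -- lines persist.
  obtain ⟨D, hD, hDH⟩ := exists_contMDiff_eqOn_compl (m := m) hH hK (isOpen_Ioo.prod isOpen_Ioo : IsOpen (Set.Ioo (0 : ℝ) 1 ×ˢ Set.Ioo (0 : ℝ) 1))
    (Set.prod_mono (Set.Icc_subset_Ioo (by norm_num) (by norm_num)) (Set.Icc_subset_Ioo (by norm_num) (by norm_num)))
    (fun w hw => by
      have hp : ContMDiffAt 𝓘(ℝ, ℝ × ℝ) (𝓡 m) ∞ (fun _ : ℝ × ℝ => p) w := contMDiffAt_const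
      have h5 : w.1 < 1 / 3 ∨ 2 / 3 < w.1 ∨ w.2 < 1 / 3 ∨ 2 / 3 < w.2 := by
        by_contra h6
        simp only [not_or, not_lt] at h6
        exact hw ⟨⟨h6.1, h6.2.1⟩, h6.2.2⟩
      rcases h5 with h5 | h5 | h5 | h5
      · refine hp.congr_of_eventuallyEq ?_
        filter_upwards [continuousAt_fst.eventually (gt_mem_nhds h5)] with z hz using H1 z hz.le
      · refine hp.congr_of_eventuallyEq ?_
        filter_upwards [continuousAt_fst.eventually (lt_mem_nhds h5)] with z hz using H2 z hz.le
      · refine hp.congr_of_eventuallyEq ?_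
        filter_upwards [continuousAt_snd.eventually (gt_mem_nhds h5)] with z hz using H3 z hz.le
      · have h6 : ContMDiffAt 𝓘(ℝ, ℝ × ℝ) (𝓡 m) ∞ (fun z : ℝ × ℝ => c (step z.1)) w :=
          (hc.comp (contDiff_step.comp contDiff_fst).contMDiff) w
        refine h6.congr_of_eventuallyEq ?_
        filter_upwards [continuousAt_snd.eventually (lt_mem_nhds h5)] with z hz using H4 z hz.le)
  refine ⟨D, hD, fun t => ?_, fun t => ?_, fun s => ⟨?_, ?_⟩⟩
  · rw [hDH _ fun h => lt_irrefl _ h.2.1, H3 _ (by norm_num)]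
  · rw [hDH _ fun h => lt_irrefl _ h.2.2, H4 _ (by norm_num)]
  · rw [hDH _ fun h => lt_irrefl _ h.1.1, H1 _ (by norm_num)]
  · rw [hDH _ fun h => lt_irrefl _ h.1.2, H2 _ (by norm_num)]

/-- The meridian through γ(0) is contracted by a smooth disc whose boundary is run through at the
speed of `step`. The torus must therefore be reparametrized in time by `step` as well, which leaves
its area unchanged. -/
theorem area_sweep_eq_zero_of_contractible {Ω : Form m M 2} (hΩ : Ω.IsSmooth) (h : VanishesOnPiTwo Ω)
    {φ : ℝ → Diffeomorph (𝓡 m) (𝓡 m) M M ∞} (hφ : IsSympLoop Ω φ)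
    (h0 : ∀ x, (orbit hφ x).Homotopic (Path.refl (φ 0 x))) {γ : ℝ → M} (hγ : IsSmoothLoop (m := m) γ) :
    area Ω (fun z => φ z.1 (γ z.2)) = 0 := by
  have hu : ContMDiff 𝓘(ℝ, ℝ × ℝ) (𝓡 m) ∞ (fun z : ℝ × ℝ => φ z.1 (γ z.2)) := hφ.contMDiff_sweep hγ.smooth
  have hc : ContMDiff 𝓘(ℝ, ℝ) (𝓡 m) ∞ (fun t : ℝ => φ t (γ 0)) :=
    hu.comp (contDiff_id.prodMk contDiff_const : ContDiff ℝ ∞ fun t : ℝ => (t, (0 : ℝ))).contMDiff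
  obtain ⟨D, hD, hD0, hD1, hDs⟩ := exists_smooth_contraction hc (fun _ => rfl) (h0 (γ 0))
  have hG : ContMDiff 𝓘(ℝ, ℝ × ℝ) (𝓡 m) ∞ (fun z : ℝ × ℝ => φ (step z.1) (γ z.2)) :=
    hu.comp ((contDiff_step.comp contDiff_fst).prodMk contDiff_snd : ContDiff ℝ ∞ fun z : ℝ × ℝ => (step z.1, z.2)).contMDiff
  have h1 := h.area_torus_eq_zero hΩ hD hG hD0 hD1
    (fun t => congrArg (φ (step t)) (by simpa using hγ.periodic 0)) (fun s => (hDs s).1.trans (hDs s).2.symm)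
    (fun s => by
      simp only [step_eq_zero (show (0 : ℝ) ≤ 1 / 3 by norm_num), step_eq_one (show (2 / 3 : ℝ) ≤ 1 by norm_num)]
      exact congrArg (fun f : Diffeomorph (𝓡 m) (𝓡 m) M M ∞ => f (γ s)) (by simpa using (hφ.periodic 0).symm))
  have h2 := integral_comp_prodMap_mul_deriv (continuous_areaDensity hΩ hu) contDiff_step contDiff_id 0 1 0 1
  rw [step_eq_zero (by norm_num), step_eq_one (by norm_num)] at h2
  rw [area_eq_areaDensity] at h1 ⊢
  refine h2.symm.trans (Eq.trans ?_ h1)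
  refine intervalIntegral.integral_congr fun t _ => intervalIntegral.integral_congr fun s _ => ?_
  rw [deriv_id]
  exact (areaDensity_prodMap Ω hu (contDiff_step.differentiable (by simp) t).hasDerivAt (hasDerivAt_id s)).symm

end Spheres

end SymplecticFlux

end

theorem mainTheorem8 (n : ℕ) (V : Type*) [TopologicalSpace V]
    [ChartedSpace (EuclideanSpace ℝ (Fin (2 * n))) V] [IsManifold (𝓡 (2 * n)) ∞ V]
    [CompactSpace V] [T2Space V]
    (Ω : SymplecticFlux.Form (2 * n) V 2) (hΩ : SymplecticFlux.IsSymplectic Ω) :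
    (SymplecticFlux.VanishesOnPiTwo Ω →
      ∀ (φ : ℝ → Diffeomorph (𝓡 (2 * n)) (𝓡 (2 * n)) V V ∞)
        (hφ : SymplecticFlux.IsSympLoop Ω φ),
        (∀ x : V, (SymplecticFlux.orbit hφ x).Homotopic (Path.refl (φ 0 x))) →
        SymplecticFlux.IsFlux Ω φ 0) ∧
    (SymplecticFlux.IsLefschetz n Ω →
      ∀ (φ : ℝ → Diffeomorph (𝓡 (2 * n)) (𝓡 (2 * n)) V V ∞)
        (hφ : SymplecticFlux.IsSympLoop Ω φ),
        (∀ x : V, SymplecticFlux.IsNullHomologous (SymplecticFlux.orbit hφ x)) →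
        SymplecticFlux.IsFlux Ω φ 0) := by
  -- The zero form represents the zero class, so the flux vanishes once all the swept areas do.
  have flux_zero : ∀ φ : ℝ → Diffeomorph (𝓡 (2 * n)) (𝓡 (2 * n)) V V ∞,
      (∀ γ : ℝ → V, SymplecticFlux.IsSmoothLoop (m := 2 * n) γ →
        SymplecticFlux.area Ω (fun z => φ z.1 (γ z.2)) = 0) → SymplecticFlux.IsFlux Ω φ 0 := fun φ h => by
    refine ⟨0, rfl, fun γ hγ => ?_⟩
    rw [h γ hγ]
    exact intervalIntegral.integral_zero
  refine ⟨fun hΩ₂ φ hφ h0 => flux_zero φ fun γ hγ =>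
      SymplecticFlux.area_sweep_eq_zero_of_contractible hΩ.closed.1 hΩ₂ hφ h0 hγ,
    fun hL φ hφ h0 => flux_zero φ fun γ hγ => ?_⟩
  cases n with
  | zero =>
    -- In dimension 0 the truncated degree 2(n-1)+1 is 1 and carries no information; but the tangent
    -- spaces are trivial and every area is zero.
    have : Subsingleton (EuclideanSpace ℝ (Fin (2 * 0))) := inferInstanceAs (Subsingleton (EuclideanSpace ℝ (Fin 0)))
    have h1 : ∀ z : ℝ × ℝ, SymplecticFlux.areaDensity Ω (fun z => φ z.1 (γ z.2)) z = 0 := fun z =>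
      (Ω (φ z.1 (γ z.2))).map_coord_zero (0 : Fin 2)
        (Subsingleton.elim (α := EuclideanSpace ℝ (Fin (2 * 0))) _ _)
    rw [SymplecticFlux.area_eq_areaDensity]
    simp only [h1, intervalIntegral.integral_zero]
  | succ k =>
    exact SymplecticFlux.area_sweep_eq_zero_of_lefschetz (k := k) (M := V) hΩ
      (fun η hη => SymplecticFlux.IsLefschetz.exists_sub_mem_exactForms (n := k + 1) hL hη) hφ h0 hγ
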